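/- Let $D_0\subset\mathbb{R}^2\simeq\mathbb{C}$ be the open unit disk. For real $\mathcal{E},h,\mu$ with $\mathcal{E}+h>0$ and $\mu>0$ put $V_I(z)=\mathcal{E}+h+\mu/|z|$ for $z\neq0$, and write $(HS_I)[z]$ for the system $z''=\nabla V_I(z)$, $\tfrac12|z'|^2-V_I(z)=0$. For $p_0,p_1\in\partial D_0$ consider the problem $$(P)\qquad (HS_I)[z(s)]\ \text{ for } s\in[0,T],\qquad |z(s)|<1\ \text{ for } s\in(0,T),\qquad z(0)=p_0,\ z(T)=p_1,\qquad T>0 .$$ A classical solution satisfies $z(s)\ne 0$ and $(HS_I)$ on all of $[0,T]$. An ejection-collision solution is a continuous $z:[0,T]\to\mathbb{R}^2$ that vanishes at exactly one time $c\in(0,T)$, satisfies $(HS_I)$ on $[0,T]\setminus\{c\}$ and the remaining conditions of $(P)$, and for which $z(s)/|z(s)|$ has a limit as $s\to c$. If $p_0,p_1$ are non-antipodal ($|p_0-p_1|<2$), the winding index of a $C^1$ curve $z$ from $p_0$ to $p_1$ avoiding $0$ is $\mathrm{Ind}(z([0,T]),0)=\frac1{2\pi i}\int_\Gamma \frac{d\zeta}{\zeta}$,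 where $\Gamma$ is $z$ followed by the shortest arc of $\partial D_0$ from $p_1$ to $p_0$. **Theorem.** For all $p_0,p_1\in\partial D_0$ with $|p_0-p_1|<2$ there are $T=T(p_0,p_1)>0$ and a solution $z(\cdot;p_0,p_1)$ of $(P)$ such that: * if $p_0=p_1$, then $z(\cdot;p_0,p_0)$ is an ejection-collision solution, and $(T,z)$ is unique among all classical and ejection-collision solutions of $(P)$; * if $p_0\neq p_1$, then $z(\cdot;p_0,p_1)$ is a classical solution of $(P)$, it is a simple curve, $|\mathrm{Ind}(z([0,T]),0)|=1$, and $(T,z)$ is unique among the classical solutions of $(P)$ whose index has modulus $1$; * $T$ and $z$ are of class $C^1$ with respect to the endpoints: writing $p_j=e^{i\xi_j}$, the map $(\xi_0,\xi_1)\mapsto T(p_0,p_1)$ is $C^1$; for every fixed $s$ the map $(\xi_0,\xi_1)\mapsto z(s;p_0,p_1)$ is $C^1$ on the set where $0\le s\le T(p_0,p_1)$; and $(s,\xi_0,\xi_1)\mapsto z(s;p_0,p_1)$ is $C^1$ on the set where $0\le s\le T(p_0,p_1)$ and $z(s;p_0,p_1)\neq0$; * as $p_1\to p_0$ on $\partial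 D_0$, $T(p_0,p_1)\to T(p_0,p_0)$ and $z(t\,T(p_0,p_1);p_0,p_1)\to z(t\,T(p_0,p_0);p_0,p_0)$ uniformly in $t\in[0,1]$. Moreover, there is a quantity $C=C(\mathcal{E}+h,\mu,|p_0-p_1|)$, bounded below by some $C_0=C_0(\mathcal{E}+h,\mu)$ with $0<C_0\le C<1$, such that for all $p_0,p_1$ as above $$-p_0\cdot\frac{z'(0;p_0,p_1)}{|z'(0;p_0,p_1)|}>C\qquad\text{and}\qquad p_1\cdot\frac{z'(T;p_0,p_1)}{|z'(T;p_0,p_1)|}>C ;$$ for fixed $\mu$, $C_0\to1$ (hence $C\to1$ uniformly in the endpoints) as $\mathcal{E}+h\to\infty$, in particular as $\mathcal{E}\to\infty$ with $h$ fixed; and, for fixed $\mathcal{E}+h$ and $\mu$, $C\to1$ as $|p_0-p_1|\to0$ with $p_0\ne p_1$. -/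

import Mathlib

open Set Filter Topology

/-- The inner (Kepler) potential `V_I(z) = E + h + μ / |z|` on the plane `ℝ² = ℂ`. -/
noncomputable def innerPotential (E h μ : ℝ) (z : ℂ) : ℝ := E + h + μ / ‖z‖

/-- Sanity check: `∇ V_I(z) = - μ z / |z|³` away from the origin. -/
theorem hasGradientAt_innerPotential (E h μ : ℝ) {z : ℂ} (hz : z ≠ 0) :
    HasGradientAt (innerPotential E h μ) (-(μ / ‖z‖ ^ 3) • z) z := by
  have hn : ‖z‖ ≠ 0 := norm_ne_zero_iff.mpr hz
  have h1 : HasFDerivAt (fun w : ℂ => ‖w‖ ^ 2) (2 • (innerSL ℝ z)) z :=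
    (hasStrictFDerivAt_norm_sq z).hasFDerivAt
  have h2 : HasFDerivAt (fun w : ℂ => ‖w‖) ((1 / (2 * ‖z‖)) • (2 • (innerSL ℝ z))) z := by
    have h3 := h1.sqrt (by positivity)
    simpa [Real.sqrt_sq (norm_nonneg _)] using h3
  have h4 : HasDerivAt (fun r : ℝ => E + h + μ / r) (-(μ / ‖z‖ ^ 2)) ‖z‖ := by
    have h5 := ((hasDerivAt_inv hn).const_mul μ).const_add (E + h)
    refine (h5.congr_deriv ?_).congr_of_eventuallyEq (Eventually.of_forall fun r => ?_)
    · field_simp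
    · simp [div_eq_mul_inv]
  rw [hasGradientAt_iff_hasFDerivAt]
  refine (h4.comp_hasFDerivAt z h2).congr_fderiv ?_
  refine ContinuousLinearMap.ext fun w => ?_
  rw [InnerProductSpace.toDual_apply_apply, real_inner_smul_left]
  simp only [smul_apply, innerSL_apply_apply, smul_eq_mul, nsmul_eq_mul]
  field_simp
  norm_num

/-- `(HS_I)[z]` on a set `S` of times: `z` avoids the origin, is twice differentiable on `S`
(one-sidedly at end times), and satisfies `z'' = ∇ V_I(z)` and `|z'|² / 2 - V_I(z) = 0`. -/
def SolvesInner (E h μ : ℝ) (z : ℝ → ℂ) (S : Set ℝ) : Prop :=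
  ∃ v : ℝ → ℂ, ∀ s ∈ S,
    z s ≠ 0 ∧
    HasDerivWithinAt z (v s) S s ∧
    HasDerivWithinAt v (gradient (innerPotential E h μ) (z s)) S s ∧
    1 / 2 * ‖v s‖ ^ 2 - innerPotential E h μ (z s) = 0

/-- `z` on `[0, T]` goes from `p₀` to `p₁` and stays in the open unit disk in between. -/
structure JoinsInside (p₀ p₁ : ℂ) (T : ℝ) (z : ℝ → ℂ) : Prop where
  pos : 0 < T
  left : z 0 = p₀
  right : z T = p₁
  inside : ∀ s ∈ Ioo 0 T, ‖z s‖ < 1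

/-- Classical (collisionless) solution of the inner fixed ends problem in the disk. -/
def IsClassicalArc (E h μ : ℝ) (p₀ p₁ : ℂ) (T : ℝ) (z : ℝ → ℂ) : Prop :=
  JoinsInside p₀ p₁ T z ∧ SolvesInner E h μ z (Icc 0 T)

/-- Ejection-collision solution of the inner fixed ends problem in the disk: a continuous curve
that reaches the origin at exactly one time `c`, solves `(HS_I)` at all other times, and leaves
the origin in the direction from which it arrived (as prescribed by the Levi-Civita
regularisation). -/
def IsEjectionCollisionArc (E h μ : ℝ) (p₀ p₁ : ℂ) (T : ℝ) (z : ℝ → ℂ) : Prop :=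
  JoinsInside p₀ p₁ T z ∧ ContinuousOn z (Icc 0 T) ∧
    ∃ c ∈ Ioo 0 T, z c = 0 ∧ SolvesInner E h μ z (Icc 0 T \ {c}) ∧
      ∃ u : ℂ, Tendsto (fun s => z s / (‖z s‖ : ℂ)) (𝓝[≠] c) (𝓝 u)

/-- The shortest arc of the unit circle from `p` to `q` (`p`, `q` non-antipodal points of the
circle), parametrised by `t ∈ [0, 1]`. -/
noncomputable def shortestArc (p q : ℂ) (t : ℝ) : ℂ :=
  p * Complex.exp (t * Complex.arg (q / p) * Complex.I)

/-- The winding index with respect to the origin of a curve `α` on `[a, b]` whose end points are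
non-antipodal points of the unit circle: `(2πi)⁻¹ ∫_Γ dz / z`, where the closed curve `Γ` follows
`α` and then the shortest arc of the circle from `α b` to `α a`. -/
noncomputable def openCurveIndex (α : ℝ → ℂ) (a b : ℝ) : ℂ :=
  1 / (2 * Real.pi * Complex.I) *
    ((∫ s in a..b, derivWithin α (Icc a b) s / α s) +
      ∫ t in (0 : ℝ)..1,
        deriv (shortestArc (α b) (α a)) t / shortestArc (α b) (α a) t)

/-- `p₀` and `p₁` lie on the unit circle and `|p₀ - p₁| < 2`. -/
def NonAntipodal (p₀ p₁ : ℂ) : Prop := ‖p₀‖ = 1 ∧ ‖p₁‖ = 1 ∧ ‖p₀ - p₁‖ < 2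

/-- The point of the unit circle with polar angle `ξ`. -/
noncomputable def circlePoint (ξ : ℝ) : ℂ := Complex.exp (ξ * Complex.I)

/-! Put `e = E + h`. Every orbit of energy `e > 0` is a branch of a Kepler hyperbola with semi-axis
`a = μ / (2e)` and mean motion `n`, where `n²a² = 2e` and `n²a³ = μ`. Rotate the plane so that the
midpoint of the shortest arc between the end points is `1`, and write the end points as `c ± iδ`.
The orbit sought is symmetric about the real axis, opens towards `1` and has its pericentre on the
far side of the origin, so that it closes up with the short arc to a loop around `0`. With the
eccentric anomaly `u` as parameter it is `a (cosh u - ε) + i ρ sinh u`, at distance `a (ε cosh u -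
1)` from the origin, and time enters through Kepler's equation `ε sinh u - u = n s - const`.
Requiring radius `1` and real part `c` at the end, and putting `X = cosh u` there, gives `a X² - c X
= a + 1`. This has exactly one positive root, so all orbit elements are explicit functions of `c`.
If the end points coincide, then `ε = 1` and the orbit is radial.

Uniqueness of the classical solution rests on the Levi-Civita map `z = w²`. In the time `u` with `du
= (n a / |z|) ds` the equation becomes `w'' = w / 4`, so `w = A cosh (u/2) + B sinh (u/2)`. The end
points fix `w` at both ends up to sign, and index `±1` fixes the relative sign; energy then leads
back to the same quadratic equation (`exists_leviCivita`, `eq_framePoint_of_leviCivita`). For equal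
end points either choice of sign is contradictory. For a collision solution angular momentum
vanishes, so the motion is a one-dimensional free fall determined by its fall time
(`radial_of_collision`).

Smooth dependence on the end points is the implicit function theorem for Kepler's equation wherever
`ε cosh u ≠ 1`. The delicate point is the fixed time at which the radial orbit collides: there `u`
is only of order `|δ|^(2/3)`, but the position involves `cosh u - ε` and `δ sinh u`, whose
`δ`-derivatives tend to `0` (`tendsto_deriv_anomaly_collision`).

Transversality is a computation: the squared cosine of the angle to the normal is `1 - a² (ε² - 1) /
(1 + 2a)`, and `ε² < 1 + 1/a` bounds it below by `(1 + a) / (1 + 2a)`. -/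

namespace HyperbolicKepler

open Real

/-! ### Kepler's equation for hyperbolic orbits -/

/-- The left-hand side `ε sinh u - u` of Kepler's equation for hyperbolic orbits. -/
noncomputable def kepler (ε u : ℝ) : ℝ := ε * sinh u - u

/-- The eccentric anomaly `u` solving `ε sinh u - u = M`. -/
noncomputable def keplerInv (ε M : ℝ) : ℝ := Function.invFun (kepler ε) M

theorem one_add_sq_div_two_le_cosh (u : ℝ) : 1 + u ^ 2 / 2 ≤ cosh u := by
  have h : cosh u = 1 + 2 * sinh (u / 2) ^ 2 := by
    have := Real.cosh_two_mul (u / 2)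
    rw [mul_div_cancel₀ u two_ne_zero, Real.cosh_sq] at this
    linarith
  have h2 : (u / 2) ^ 2 ≤ sinh (u / 2) ^ 2 := by
    rw [sq_le_sq, Real.abs_sinh]
    exact Real.self_le_sinh_iff.mpr (abs_nonneg _)
  rw [h]; nlinarith

theorem cosh_sub_one_le {u : ℝ} (hu : |u| ≤ 1) : cosh u - 1 ≤ 2 * u ^ 2 ∧ |sinh u| ≤ 2 * |u| := by
  -- Since `e < 2.72` and `e⁻¹ < 1`, `cosh 1 < 2`; this is the source of the factors `2` in the
  -- statement.
  have hc : ∀ v : ℝ, |v| ≤ 1 → cosh v ≤ 2 := fun v hv => by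
    have h1 : cosh v ≤ cosh 1 := cosh_le_cosh.mpr (by simpa using hv)
    have h2 := Real.exp_one_lt_d9
    have h3 : exp (-1) < 1 := by rw [exp_lt_one_iff]; norm_num
    rw [Real.cosh_eq 1] at h1
    linarith
  have hs : ∀ v : ℝ, |v| ≤ 1 → |sinh v| ≤ 2 * |v| := fun v hv => by
    rw [Real.abs_sinh]
    have h := image_le_of_deriv_right_le_deriv_boundary (f := sinh) (f' := cosh) (a := 0)
      (b := |v|) (B := fun t => 2 * t) (B' := fun _ => 2) continuous_sinh.continuousOn
      (fun x _ => (hasDerivAt_sinh x).hasDerivWithinAt) (by simp) (by fun_prop)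
      (fun x _ => by simpa using ((hasDerivAt_id x).const_mul 2).hasDerivWithinAt)
      (fun x hx => hc x (by rw [abs_of_nonneg hx.1]; exact hx.2.le.trans hv))
    exact h ⟨abs_nonneg _, le_rfl⟩
  refine ⟨?_, hs u hu⟩
  have h : cosh u = 1 + 2 * sinh (u / 2) ^ 2 := by
    have := Real.cosh_two_mul (u / 2)
    rw [mul_div_cancel₀ u two_ne_zero, Real.cosh_sq] at this
    linarith
  have h2 := hs (u / 2) (by rw [abs_div, abs_two]; linarith [abs_nonneg u])
  have h3 : sinh (u / 2) ^ 2 ≤ (2 * |u / 2|) ^ 2 := by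
    rw [← sq_abs]; gcongr
  rw [h, mul_pow, sq_abs] at *
  linarith

theorem kepler_neg (ε u : ℝ) : kepler ε (-u) = -kepler ε u := by
  simp [kepler]; ring

theorem kepler_zero (ε : ℝ) : kepler ε 0 = 0 := by simp [kepler]

theorem hasDerivAt_kepler (ε u : ℝ) : HasDerivAt (kepler ε) (ε * cosh u - 1) u :=
  ((hasDerivAt_sinh u).const_mul ε).sub (hasDerivAt_id u)

theorem continuous_kepler (ε : ℝ) : Continuous (kepler ε) :=
  continuous_iff_continuousAt.mpr fun u => (hasDerivAt_kepler ε u).continuousAt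

/-- The bound is uniform in `ε ≥ 1`. It replaces a lower bound on the derivative, which degenerates
at `ε = 1`, `u = 0`. -/
theorem cube_le_kepler {ε u : ℝ} (hε : 1 ≤ ε) (hu : 0 ≤ u) : u ^ 3 / 6 ≤ kepler ε u := by
  have h1 : MonotoneOn (fun t : ℝ => kepler 1 t - t ^ 3 / 6) (Ici 0) := by
    have hd : ∀ t : ℝ, HasDerivAt (fun t : ℝ => kepler 1 t - t ^ 3 / 6)
        (1 * cosh t - 1 - 3 * t ^ 2 / 6) t := fun t =>
      (hasDerivAt_kepler 1 t).sub (by simpa using (hasDerivAt_pow 3 t).div_const 6)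
    refine monotoneOn_of_deriv_nonneg (convex_Ici 0)
      (fun t _ => (hd t).continuousAt.continuousWithinAt)
      (fun t _ => (hd t).differentiableAt.differentiableWithinAt) fun t _ => ?_
    rw [(hd t).deriv]
    linarith [one_add_sq_div_two_le_cosh t]
  have h2 := h1 (mem_Ici.mpr le_rfl) (mem_Ici.mpr hu) hu
  have h3 : 0 ≤ sinh u := sinh_nonneg_iff.mpr hu
  simp only [kepler, sinh_zero] at h2 ⊢
  nlinarith

theorem abs_cube_le_kepler {ε : ℝ} (hε : 1 ≤ ε) (u : ℝ) : |u| ^ 3 / 6 ≤ |kepler ε u| := by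
  rcases le_total 0 u with hu | hu
  · rw [abs_of_nonneg hu]
    exact (cube_le_kepler hε hu).trans (le_abs_self _)
  · rw [abs_of_nonpos hu, ← abs_neg, ← kepler_neg]
    exact (cube_le_kepler hε (neg_nonneg.mpr hu)).trans (le_abs_self _)

/-- The cubic growth in `cube_le_kepler` is sharp at `ε = 1`. Near the collision the two bounds
together compare the anomaly with the cube root of the mean anomaly. -/
theorem abs_kepler_one_le {u : ℝ} (hu : |u| ≤ 1) : |kepler 1 u| ≤ |u| ^ 3 := by
  have key : ∀ v : ℝ, 0 ≤ v → v ≤ 1 → kepler 1 v ≤ v ^ 3 := fun v hv hv1 => by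
    have h := image_le_of_deriv_right_le_deriv_boundary (f := kepler 1)
      (f' := fun u => 1 * cosh u - 1) (a := 0)
      (b := v) (B := fun t => t ^ 3) (B' := fun t => 3 * t ^ 2) (continuous_kepler 1).continuousOn
      (fun x _ => (hasDerivAt_kepler 1 x).hasDerivWithinAt) (by simp [kepler]) (by fun_prop)
      (fun x _ => by simpa using (hasDerivAt_pow 3 x).hasDerivWithinAt)
      (fun x hx => by
        have := (cosh_sub_one_le (u := x) (by rw [abs_of_nonneg hx.1]; exact hx.2.le.trans hv1)).1
        nlinarith [sq_nonneg x])
    exact h ⟨hv, le_rfl⟩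
  have pos : ∀ v : ℝ, 0 ≤ v → 0 ≤ kepler 1 v := fun v hv =>
    (by positivity : (0:ℝ) ≤ v ^ 3 / 6).trans (cube_le_kepler le_rfl hv)
  rcases le_total 0 u with h0 | h0
  · rw [abs_of_nonneg (pos u h0), abs_of_nonneg h0] at *
    exact key u h0 hu
  · have h1 := pos (-u) (by linarith)
    have h2 := key (-u) (by linarith) (by rw [abs_of_nonpos h0] at hu; exact hu)
    rw [← abs_neg, ← kepler_neg, abs_of_nonneg h1, abs_of_nonpos h0]
    exact h2

/-- For `ε = 1` the derivative vanishes at `u = 0`, so the two half-lines are treated separately and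
glued. -/
theorem strictMono_kepler {ε : ℝ} (hε : 1 ≤ ε) : StrictMono (kepler ε) := by
  have h1 : ∀ u : ℝ, u ≠ 0 → 0 < ε * cosh u - 1 := fun u hu => by
    nlinarith [one_lt_cosh.mpr hu]
  have hp : StrictMonoOn (kepler ε) (Ici 0) := by
    refine strictMonoOn_of_deriv_pos (convex_Ici 0) (continuous_kepler ε).continuousOn fun u hu => ?_
    rw [interior_Ici] at hu
    rw [(hasDerivAt_kepler ε u).deriv]
    exact h1 u (ne_of_gt hu)
  have hn : StrictMonoOn (kepler ε) (Iic 0) := by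
    refine strictMonoOn_of_deriv_pos (convex_Iic 0) (continuous_kepler ε).continuousOn fun u hu => ?_
    rw [interior_Iic] at hu
    rw [(hasDerivAt_kepler ε u).deriv]
    exact h1 u (ne_of_lt hu)
  exact hn.Iic_union_Ici hp

theorem surjective_kepler {ε : ℝ} (hε : 1 ≤ ε) : Function.Surjective (kepler ε) := by
  have ht : Tendsto (kepler ε) atTop atTop := by
    refine tendsto_atTop_mono' atTop ?_ ((tendsto_pow_atTop (n := 3) (by norm_num)).atTop_div_const
      (show (0:ℝ) < 6 by norm_num))
    filter_upwards [eventually_ge_atTop 0] with u hu using cube_le_kepler hε hu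
  refine (continuous_kepler ε).surjective ht ?_
  have : kepler ε = fun u => -kepler ε (-u) := by
    funext u; rw [kepler_neg, neg_neg]
  rw [this]
  exact tendsto_neg_atTop_atBot.comp (ht.comp tendsto_neg_atBot_atTop)

theorem kepler_keplerInv {ε : ℝ} (hε : 1 ≤ ε) (M : ℝ) : kepler ε (keplerInv ε M) = M :=
  Function.invFun_eq (surjective_kepler hε M)

theorem keplerInv_kepler {ε : ℝ} (hε : 1 ≤ ε) (u : ℝ) : keplerInv ε (kepler ε u) = u :=
  Function.leftInverse_invFun (strictMono_kepler hε).injective u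

theorem keplerInv_eq_iff {ε : ℝ} (hε : 1 ≤ ε) {M u : ℝ} : keplerInv ε M = u ↔ kepler ε u = M :=
  ⟨fun h => h ▸ kepler_keplerInv hε M, fun h => h ▸ keplerInv_kepler hε u⟩

theorem strictMono_keplerInv {ε : ℝ} (hε : 1 ≤ ε) : StrictMono (keplerInv ε) := fun M N h => by
  rw [← (strictMono_kepler hε).lt_iff_lt, kepler_keplerInv hε, kepler_keplerInv hε]
  exact h

theorem continuous_keplerInv {ε : ℝ} (hε : 1 ≤ ε) : Continuous (keplerInv ε) :=
  (strictMono_keplerInv hε).monotone.continuous_of_surjective fun u =>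
    ⟨kepler ε u, keplerInv_kepler hε u⟩

theorem hasDerivAt_keplerInv {ε M : ℝ} (hε : 1 ≤ ε) (h : ε * cosh (keplerInv ε M) - 1 ≠ 0) :
    HasDerivAt (keplerInv ε) (ε * cosh (keplerInv ε M) - 1)⁻¹ M :=
  HasDerivAt.of_local_left_inverse (continuous_keplerInv hε).continuousAt
    (hasDerivAt_kepler ε _) h (Eventually.of_forall (kepler_keplerInv hε))

/-! ### The orbit elements as functions of the end points -/

/-- The square root of the discriminant of the quadratic equation for the eccentricity. -/
noncomputable def disc (a c : ℝ) : ℝ := √(c ^ 2 + 4 * a ^ 2 + 4 * a)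

/-- The eccentricity of the orbit with semi-axis `a` whose end points, on the unit circle, have
component `c` along the axis. -/
noncomputable def ecc (a c : ℝ) : ℝ := (disc a c - c) / (2 * a)

/-- The hyperbolic cosine of the eccentric anomaly at the end of the orbit. -/
noncomputable def endCosh (a c : ℝ) : ℝ := (disc a c + c) / (2 * a)

/-- The hyperbolic sine of the eccentric anomaly at the end of the orbit. -/
noncomputable def endSinh (a c : ℝ) : ℝ := √(endCosh a c ^ 2 - 1)

/-- The eccentric anomaly at the end of the orbit. -/
noncomputable def endAnomaly (a c : ℝ) : ℝ := arsinh (endSinh a c)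

/-- The mean anomaly at the end of the orbit. -/
noncomputable def endMean (a c : ℝ) : ℝ := ecc a c * endSinh a c - endAnomaly a c

section Elements

variable {a c : ℝ}

theorem disc_arg_pos (ha : 0 < a) (c : ℝ) : 0 < c ^ 2 + 4 * a ^ 2 + 4 * a := by positivity

theorem disc_sq (ha : 0 < a) (c : ℝ) : disc a c ^ 2 = c ^ 2 + 4 * a ^ 2 + 4 * a :=
  sq_sqrt (disc_arg_pos ha c).le

theorem disc_pos (ha : 0 < a) (c : ℝ) : 0 < disc a c := sqrt_pos.mpr (disc_arg_pos ha c)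

theorem endCosh_sub_ecc (ha : 0 < a) (c : ℝ) : a * (endCosh a c - ecc a c) = c := by
  unfold endCosh ecc; field_simp; ring

theorem ecc_mul_endCosh (ha : 0 < a) (c : ℝ) : a * (ecc a c * endCosh a c) = a + 1 := by
  have := disc_sq ha c
  unfold endCosh ecc; field_simp; linarith

theorem abs_lt_disc (ha : 0 < a) (c : ℝ) : |c| < disc a c := by
  unfold disc
  rw [← sqrt_sq_eq_abs]
  exact sqrt_lt_sqrt (sq_nonneg c) (by nlinarith)

theorem ecc_pos (ha : 0 < a) (c : ℝ) : 0 < ecc a c := by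
  have := abs_lt_disc ha c
  have := le_abs_self c
  unfold ecc
  apply div_pos <;> linarith

theorem endCosh_pos (ha : 0 < a) (c : ℝ) : 0 < endCosh a c := by
  have := abs_lt_disc ha c
  have := neg_abs_le c
  unfold endCosh
  apply div_pos <;> linarith

/-- `endCosh` is the positive root of `a x² - c x - (a + 1)`, whose value at `1` is `-1 - c < 0`. -/
theorem one_lt_endCosh (ha : 0 < a) (hc : -1 < c) : 1 < endCosh a c := by
  have h1 := endCosh_sub_ecc ha c
  have h2 := ecc_mul_endCosh ha c
  have h3 := endCosh_pos ha c
  have h4 : a * ecc a c = a * endCosh a c - c := by linarith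
  have h5 : (a * endCosh a c - c) * endCosh a c = a + 1 := by rw [← h4]; linarith
  by_contra h
  push Not at h
  nlinarith [mul_nonneg (sub_nonneg.mpr h) (mul_pos ha (ecc_pos ha c)).le]

/-- Eliminating `endCosh` leaves `a ε² + c ε = a + 1`. The left side increases with `ε > 0` and
equals `a + c ≤ a + 1` at `ε = 1`; dropping `c ε > 0` gives the upper bound. -/
theorem ecc_mem (ha : 0 < a) (hc0 : 0 < c) (hc : c ≤ 1) :
    1 ≤ ecc a c ∧ ecc a c ^ 2 < 1 + 1 / a := by
  have h1 := endCosh_sub_ecc ha c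
  have h2 := ecc_mul_endCosh ha c
  have h3 := ecc_pos ha c
  have h5 : ecc a c * (a * ecc a c + c) = a + 1 := by
    have : a * ecc a c + c = a * endCosh a c := by linarith
    rw [this]; linarith
  constructor
  · by_contra h
    push Not at h
    nlinarith [mul_pos ha (mul_pos (sub_pos.mpr h) (by linarith : 0 < 1 + ecc a c)),
      mul_pos (sub_pos.mpr h) hc0]
  · have h6 : 1 + 1 / a = (a + 1) / a := by field_simp
    rw [h6, lt_div_iff₀ ha]
    nlinarith [mul_pos h3 hc0]

theorem one_le_ecc (ha : 0 < a) (hc0 : 0 < c) (hc : c ≤ 1) : 1 ≤ ecc a c :=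
  (ecc_mem ha hc0 hc).1

theorem one_lt_ecc (ha : 0 < a) (hc0 : 0 < c) (hc : c < 1) : 1 < ecc a c := by
  have h1 := endCosh_sub_ecc ha c
  have h2 := ecc_mul_endCosh ha c
  have h3 := ecc_pos ha c
  have h5 : ecc a c * (a * ecc a c + c) = a + 1 := by
    have : a * ecc a c + c = a * endCosh a c := by linarith
    rw [this]; linarith
  by_contra h
  push Not at h
  nlinarith [mul_nonneg ha.le (mul_nonneg (sub_nonneg.mpr h) (by linarith : 0 ≤ 1 + ecc a c)),
    mul_nonneg (sub_nonneg.mpr h) hc0.le]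

theorem ecc_one (ha : 0 < a) : ecc a 1 = 1 := by
  have h : disc a 1 = 2 * a + 1 := by
    unfold disc; rw [show (1:ℝ) ^ 2 + 4 * a ^ 2 + 4 * a = (2 * a + 1) ^ 2 by ring]
    exact sqrt_sq (by positivity)
  unfold ecc; rw [h]; field_simp; ring

theorem endSinh_sq (ha : 0 < a) (hc : -1 < c) : endSinh a c ^ 2 = endCosh a c ^ 2 - 1 :=
  sq_sqrt (by nlinarith [one_lt_endCosh ha hc])

theorem endSinh_pos (ha : 0 < a) (hc : -1 < c) : 0 < endSinh a c :=
  sqrt_pos.mpr (by nlinarith [one_lt_endCosh ha hc])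

theorem sinh_endAnomaly (a c : ℝ) : sinh (endAnomaly a c) = endSinh a c := sinh_arsinh _

theorem cosh_endAnomaly (ha : 0 < a) (hc : -1 < c) : cosh (endAnomaly a c) = endCosh a c := by
  rw [endAnomaly, cosh_arsinh, endSinh_sq ha hc, add_sub_cancel, sqrt_sq (endCosh_pos ha c).le]

theorem endAnomaly_pos (ha : 0 < a) (hc : -1 < c) : 0 < endAnomaly a c :=
  arsinh_pos_iff.mpr (endSinh_pos ha hc)

theorem kepler_endAnomaly (a c : ℝ) : kepler (ecc a c) (endAnomaly a c) = endMean a c := by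
  rw [kepler, sinh_endAnomaly, endMean]

theorem endMean_pos (ha : 0 < a) (hc0 : 0 < c) (hc : c ≤ 1) : 0 < endMean a c := by
  rw [← kepler_endAnomaly]
  have := endAnomaly_pos ha (c := c) (by linarith)
  exact (by positivity : 0 < endAnomaly a c ^ 3 / 6).trans_le (cube_le_kepler (one_le_ecc ha hc0 hc) this.le)

/-- The identity between the two expressions of the semi-minor axis. -/
theorem semiminor_sq (ha : 0 < a) (hc : -1 < c) :
    (1 - c ^ 2) / endSinh a c ^ 2 = a ^ 2 * (ecc a c ^ 2 - 1) := by
  rw [div_eq_iff (pow_ne_zero 2 (endSinh_pos ha hc).ne'), endSinh_sq ha hc]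
  have h1 := endCosh_sub_ecc ha c
  have h2 := ecc_mul_endCosh ha c
  set x := endCosh a c
  set ε := ecc a c
  -- The left side depends only on the product and the difference of `ε` and `x`, which are the two
  -- known quantities.
  have : a ^ 2 * (ε ^ 2 - 1) * (x ^ 2 - 1)
      = (a * (ε * x)) ^ 2 - (a * (x - ε)) ^ 2 - 2 * a * (a * (ε * x)) + a ^ 2 := by ring
  rw [this, h1, h2]; ring

/-- A hyperbolic cosine solving the boundary value equation is the one of the orbit. -/
theorem eq_endCosh (ha : 0 < a) {x : ℝ} (hx : 0 < x) (h : a * x ^ 2 - c * x = a + 1) :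
    x = endCosh a c := by
  have h1 := endCosh_sub_ecc ha c
  have h2 := ecc_mul_endCosh ha c
  have h3 := ecc_pos ha c
  -- The roots of the quadratic are `endCosh` and `-ecc`, and the second is negative.
  have h4 : (x - endCosh a c) * (x + ecc a c) = 0 := by
    have : a * ((x - endCosh a c) * (x + ecc a c))
      = a * x ^ 2 - (a * (endCosh a c - ecc a c)) * x - a * (ecc a c * endCosh a c) := by ring
    rw [h1, h2, h, sub_self] at this
    exact (mul_eq_zero.mp this).resolve_left ha.ne'
  rcases mul_eq_zero.mp h4 with h5 | h5 <;> linarith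

theorem contDiffAt_disc (ha : 0 < a) (c : ℝ) : ContDiffAt ℝ 1 (disc a) c := by
  unfold disc
  exact ContDiffAt.sqrt (by fun_prop) (disc_arg_pos ha c).ne'

theorem contDiffAt_ecc (ha : 0 < a) (c : ℝ) : ContDiffAt ℝ 1 (ecc a) c :=
  ((contDiffAt_disc ha c).sub contDiffAt_id).div_const _

theorem contDiffAt_endCosh (ha : 0 < a) (c : ℝ) : ContDiffAt ℝ 1 (endCosh a) c :=
  ((contDiffAt_disc ha c).add contDiffAt_id).div_const _

theorem contDiffAt_endSinh (ha : 0 < a) (hc : -1 < c) : ContDiffAt ℝ 1 (endSinh a) c := by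
  unfold endSinh
  exact ContDiffAt.sqrt (((contDiffAt_endCosh ha c).pow 2).sub contDiffAt_const)
    (by nlinarith [one_lt_endCosh ha hc])

theorem contDiffAt_endAnomaly (ha : 0 < a) (hc : -1 < c) : ContDiffAt ℝ 1 (endAnomaly a) c :=
  (contDiffAt_endSinh ha hc).arsinh

theorem contDiffAt_endMean (ha : 0 < a) (hc : -1 < c) : ContDiffAt ℝ 1 (endMean a) c :=
  ((contDiffAt_ecc ha c).mul (contDiffAt_endSinh ha hc)).sub (contDiffAt_endAnomaly ha hc)

theorem hasDerivAt_disc (ha : 0 < a) (c : ℝ) : HasDerivAt (disc a) (c / disc a c) c := by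
  have h : HasDerivAt (fun c : ℝ => c ^ 2 + 4 * a ^ 2 + 4 * a) (2 * c) c := by
    simpa using ((hasDerivAt_pow 2 c).add_const (4 * a ^ 2)).add_const (4 * a)
  refine (h.sqrt (disc_arg_pos ha c).ne').congr_deriv ?_
  have := disc_pos ha c
  unfold disc at this ⊢
  field_simp

/-- The derivative is `-1 / (a y (2a + 1))` with `y = endSinh a 1`. Being nonzero, it makes the
half-duration vary at exactly second order in the offset `δ`, which controls the passage through the
collision. -/
theorem deriv_endMean_one_ne_zero (ha : 0 < a) : deriv (endMean a) 1 ≠ 0 := by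
  have hdisc : disc a 1 = 2 * a + 1 := by
    unfold disc; rw [show (1:ℝ) ^ 2 + 4 * a ^ 2 + 4 * a = (2 * a + 1) ^ 2 by ring]
    exact sqrt_sq (by positivity)
  have hcosh : endCosh a 1 = (a + 1) / a := by unfold endCosh; rw [hdisc]; field_simp; ring
  have hd := hasDerivAt_disc ha 1
  rw [hdisc] at hd
  have h1 : HasDerivAt (ecc a) ((1 / (2 * a + 1) - 1) / (2 * a)) 1 :=
    (hd.sub (hasDerivAt_id 1)).div_const _
  have h2 : HasDerivAt (endCosh a) ((1 / (2 * a + 1) + 1) / (2 * a)) 1 :=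
    (hd.add (hasDerivAt_id 1)).div_const _
  have hy := endSinh_pos ha (c := 1) (by norm_num)
  have hy2 := endSinh_sq ha (c := 1) (by norm_num)
  have h3 := ((h2.pow 2).sub_const 1).sqrt (by
    have := one_lt_endCosh ha (c := 1) (by norm_num)
    simp only [Pi.pow_apply]
    nlinarith)
  have h3' : HasDerivAt (endSinh a) _ 1 := h3
  have h4 := ((h1.mul h3').sub h3'.arsinh).deriv
  have h5 : deriv (endMean a) 1 = _ := h4
  rw [h5, ecc_one ha]
  have e1 : √(1 + endSinh a 1 ^ 2) = (a + 1) / a := by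
    rw [hy2, hcosh, add_sub_cancel]; exact sqrt_sq (by positivity)
  have e2 : √((endCosh a ^ 2) 1 - 1) = endSinh a 1 := rfl
  rw [e1, e2, hcosh]
  rw [hcosh] at hy2
  set y := endSinh a 1
  have hy3 : a ^ 2 * y ^ 2 = 2 * a + 1 := by rw [hy2]; field_simp; ring
  have e3 : (1 / (2 * a + 1) - 1) / (2 * a) * y +
      1 * (((2 : ℕ) : ℝ) * ((a + 1) / a) ^ (2 - 1) * ((1 / (2 * a + 1) + 1) / (2 * a)) / (2 * y)) -
      ((a + 1) / a)⁻¹ • (((2 : ℕ) : ℝ) * ((a + 1) / a) ^ (2 - 1) *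
        ((1 / (2 * a + 1) + 1) / (2 * a)) / (2 * y)) = -(1 / (a * y * (2 * a + 1))) := by
    simp only [smul_eq_mul, Nat.add_one_sub_one, pow_one, Nat.cast_ofNat]
    field_simp
    linear_combination (-2 : ℝ) * hy3
  rw [e3]
  exact neg_ne_zero.mpr (by positivity)

end Elements

/-! ### Regularity of the solution of Kepler's equation -/

theorem isInvertible_of_apply_one_ne_zero {f : ℝ →L[ℝ] ℝ} (hf : f 1 ≠ 0) : f.IsInvertible :=
  ⟨ContinuousLinearEquiv.unitsEquivAut ℝ (Units.mk0 (f 1) hf), by ext; simp⟩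

/-- Off the collision, Kepler's equation is solved by a function of class `C¹` of eccentricity and
mean anomaly. -/
theorem exists_contDiffAt_keplerInv {ε M : ℝ} (hε : 1 ≤ ε)
    (h : ε * cosh (keplerInv ε M) - 1 ≠ 0) :
    ∃ ψ : ℝ × ℝ → ℝ, ContDiffAt ℝ 1 ψ (ε, M) ∧
      ∀ᶠ x in 𝓝 (ε, M), 1 ≤ x.1 → keplerInv x.1 x.2 = ψ x := by
  let f : (ℝ × ℝ) × ℝ → ℝ := fun x => x.1.1 * sinh x.2 - x.2 - x.1.2
  have hf : ContDiff ℝ 1 f := by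
    have : ContDiff ℝ 1 sinh := contDiff_sinh
    fun_prop
  set u := keplerInv ε M
  have hd : HasFDerivAt f (fderiv ℝ f ((ε, M), u)) ((ε, M), u) :=
    (hf.differentiable one_ne_zero _).hasFDerivAt
  have h1 : (fderiv ℝ f ((ε, M), u) ∘L .inr ℝ (ℝ × ℝ) ℝ) 1 = ε * cosh u - 1 := by
    have e1 : HasDerivAt (fun t : ℝ => (((ε, M), t) : (ℝ × ℝ) × ℝ)) ((0, 0), 1) u :=
      (hasDerivAt_const u (ε, M)).prodMk (hasDerivAt_id u)
    have e2 := hd.comp_hasDerivAt u e1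
    have e3 : HasDerivAt (fun t => f ((ε, M), t)) (ε * cosh u - 1) u :=
      (hasDerivAt_kepler ε u).sub_const M
    exact e2.unique e3
  have hinv : (fderiv ℝ f ((ε, M), u) ∘L .inr ℝ (ℝ × ℝ) ℝ).IsInvertible :=
    isInvertible_of_apply_one_ne_zero (by rw [h1]; exact h)
  have hfa : ContDiffAt ℝ 1 f ((ε, M), u) := hf.contDiffAt
  refine ⟨hfa.implicitFunction one_ne_zero hinv, hfa.contDiffAt_implicitFunction one_ne_zero hinv,
    ?_⟩
  filter_upwards [hfa.eventually_apply_implicitFunction one_ne_zero hinv] with x hx h1x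
  have h0 : f ((ε, M), u) = 0 := sub_eq_zero.mpr (kepler_keplerInv hε M)
  rw [h0] at hx
  exact (keplerInv_eq_iff h1x).mpr (sub_eq_zero.mp hx)

theorem contDiffAt_keplerInv {X : Type*} [NormedAddCommGroup X] [NormedSpace ℝ X] {ε M : X → ℝ}
    {x₀ : X} (hε : ContDiffAt ℝ 1 ε x₀) (hM : ContDiffAt ℝ 1 M x₀) (h1 : ∀ᶠ x in 𝓝 x₀, 1 ≤ ε x)
    (h : ε x₀ * cosh (keplerInv (ε x₀) (M x₀)) - 1 ≠ 0) :
    ContDiffAt ℝ 1 (fun x => keplerInv (ε x) (M x)) x₀ := by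
  obtain ⟨ψ, hψ, he⟩ := exists_contDiffAt_keplerInv h1.self_of_nhds h
  have hp : ContDiffAt ℝ 1 (fun x => (ε x, M x)) x₀ := hε.prodMk hM
  refine (ContDiffAt.comp x₀ (g := ψ) hψ hp).congr_of_eventuallyEq ?_
  filter_upwards [hp.continuousAt.eventually he, h1] with x hx h1x using hx h1x

/-- Continuity holds even at the degenerate point `ε = 1`, `M = 0`: there `|u|³ ≤ 6 |M|`, uniformly
in `ε ≥ 1`. -/
theorem tendsto_keplerInv {X : Type*} {l : Filter X} {ε M : X → ℝ} {ε₀ M₀ : ℝ} (h₀ : 1 ≤ ε₀)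
    (hε : Tendsto ε l (𝓝 ε₀)) (hM : Tendsto M l (𝓝 M₀)) (h1 : ∀ᶠ x in l, 1 ≤ ε x) :
    Tendsto (fun x => keplerInv (ε x) (M x)) l (𝓝 (keplerInv ε₀ M₀)) := by
  by_cases h : ε₀ * cosh (keplerInv ε₀ M₀) - 1 = 0
  · have h3 : keplerInv ε₀ M₀ = 0 := by
      by_contra h0
      have := one_lt_cosh.mpr h0
      nlinarith
    have h4 : M₀ = 0 := by rw [← kepler_keplerInv h₀ M₀, h3, kepler_zero]
    rw [h3]
    have h5 : Tendsto (fun x => |keplerInv (ε x) (M x)| ^ 3) l (𝓝 0) := by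
      have h6 : Tendsto (fun x => 6 * |M x|) l (𝓝 0) := by
        have := (hM.abs).const_mul 6
        rwa [h4, abs_zero, mul_zero] at this
      refine tendsto_of_tendsto_of_tendsto_of_le_of_le' tendsto_const_nhds h6
        (Eventually.of_forall fun x => by positivity) ?_
      filter_upwards [h1] with x hx
      have := abs_cube_le_kepler hx (keplerInv (ε x) (M x))
      rw [kepler_keplerInv hx] at this
      linarith
    rw [tendsto_zero_iff_abs_tendsto_zero]
    have h7 := h5.rpow_const (p := 1 / 3) (Or.inr (by norm_num))
    rw [zero_rpow (by norm_num)] at h7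
    refine h7.congr fun x => ?_
    rw [← rpow_natCast, ← rpow_mul (abs_nonneg _)]
    norm_num
  · obtain ⟨ψ, hψ, he⟩ := exists_contDiffAt_keplerInv h₀ h
    have hp : Tendsto (fun x => (ε x, M x)) l (𝓝 (ε₀, M₀)) := hε.prodMk_nhds hM
    have h2 := hψ.continuousAt.tendsto.comp hp
    rw [← he.self_of_nhds h₀] at h2
    refine h2.congr' ?_
    filter_upwards [hp.eventually he, h1] with x hx h1x using (hx h1x).symm

/-! ### The orbits in the frame of their axis -/

/-- The component along the axis of a point of the unit circle with transversal component `δ`. -/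
noncomputable def axial (δ : ℝ) : ℝ := √(1 - δ ^ 2)

/-- The position with eccentric anomaly `u` on the orbit with end points `axial δ ± δ i`. -/
noncomputable def framePoint (a δ u : ℝ) : ℂ :=
  ((a * (cosh u - ecc a (axial δ)) : ℝ) : ℂ) +
    ((δ / endSinh a (axial δ) * sinh u : ℝ) : ℂ) * Complex.I

/-- The eccentric anomaly at time `s` on the orbit with mean motion `n`. -/
noncomputable def anomaly (a n δ s : ℝ) : ℝ :=
  keplerInv (ecc a (axial δ)) (n * s - endMean a (axial δ))

/-- The position at time `s` on the orbit with mean motion `n`. -/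
noncomputable def frameOrbit (a n δ s : ℝ) : ℂ := framePoint a δ (anomaly a n δ s)

section Frame

variable {a n δ : ℝ}

theorem axial_sq (hδ : δ ^ 2 < 1) : axial δ ^ 2 = 1 - δ ^ 2 := sq_sqrt (by linarith)

theorem axial_pos (hδ : δ ^ 2 < 1) : 0 < axial δ := sqrt_pos.mpr (by linarith)

theorem axial_le_one (δ : ℝ) : axial δ ≤ 1 := sqrt_le_one.mpr (by nlinarith [sq_nonneg δ])

theorem axial_lt_one (hδ : δ ≠ 0) : axial δ < 1 := by
  rw [axial, sqrt_lt' one_pos]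
  have : 0 < δ ^ 2 := by positivity
  linarith

theorem neg_one_lt_axial (δ : ℝ) : -1 < axial δ := by linarith [sqrt_nonneg (1 - δ ^ 2), axial.eq_1 δ]

theorem axial_zero : axial 0 = 1 := by simp [axial]

theorem contDiffAt_axial (hδ : δ ^ 2 < 1) : ContDiffAt ℝ 1 axial δ := by
  unfold axial
  exact ContDiffAt.sqrt (by fun_prop) (by linarith)

theorem one_le_ecc_axial (ha : 0 < a) (hδ : δ ^ 2 < 1) : 1 ≤ ecc a (axial δ) :=
  one_le_ecc ha (axial_pos hδ) (axial_le_one δ)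

theorem transversal_sq (ha : 0 < a) (hδ : δ ^ 2 < 1) :
    (δ / endSinh a (axial δ)) ^ 2 = a ^ 2 * (ecc a (axial δ) ^ 2 - 1) := by
  rw [← semiminor_sq ha (neg_one_lt_axial δ), axial_sq hδ, div_pow, sub_sub_cancel]

/-- The origin is a focus: `(cosh u - ε)² + (ε² - 1) sinh² u = (ε cosh u - 1)²`, and `ε ≥ 1` makes
the square root nonnegative. -/
theorem norm_framePoint (ha : 0 < a) (hδ : δ ^ 2 < 1) (u : ℝ) :
    ‖framePoint a δ u‖ = a * (ecc a (axial δ) * cosh u - 1) := by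
  have h1 := one_le_ecc_axial ha hδ
  have h2 := one_le_cosh u
  have h3 : 0 ≤ a * (ecc a (axial δ) * cosh u - 1) :=
    mul_nonneg ha.le (by nlinarith)
  rw [framePoint, Complex.norm_add_mul_I, ← sqrt_sq h3]
  congr 1
  rw [mul_pow (δ / _), transversal_sq ha hδ, sinh_sq]
  ring

theorem framePoint_ne_zero_iff (ha : 0 < a) (hδ : δ ^ 2 < 1) (u : ℝ) :
    framePoint a δ u ≠ 0 ↔ ecc a (axial δ) * cosh u - 1 ≠ 0 := by
  rw [← norm_ne_zero_iff, norm_framePoint ha hδ]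
  simp [ha.ne']

theorem eventually_sq_lt_one {X : Type*} [TopologicalSpace X] {f : X → ℝ} {x : X}
    (hf : ContinuousAt f x) (h : f x ^ 2 < 1) : ∀ᶠ y in 𝓝 x, f y ^ 2 < 1 :=
  (hf.pow 2).eventually (gt_mem_nhds h)

theorem contDiffAt_framePoint {X : Type*} [NormedAddCommGroup X] [NormedSpace ℝ X] {d u : X → ℝ}
    {x : X} (ha : 0 < a) (hd : ContDiffAt ℝ 1 d x) (hu : ContDiffAt ℝ 1 u x) (hδ : d x ^ 2 < 1) :
    ContDiffAt ℝ 1 (fun y => framePoint a (d y) (u y)) x := by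
  have h1 : ContDiffAt ℝ 1 (fun y => axial (d y)) x := (contDiffAt_axial hδ).comp x hd
  have h2 : ContDiffAt ℝ 1 (fun y => ecc a (axial (d y))) x := (contDiffAt_ecc ha _).comp x h1
  have h3 : ContDiffAt ℝ 1 (fun y => endSinh a (axial (d y))) x :=
    ContDiffAt.comp (g := endSinh a) x (contDiffAt_endSinh ha (neg_one_lt_axial _)) h1
  have h4 := (endSinh_pos ha (neg_one_lt_axial (d x))).ne'
  have h5 : ContDiff ℝ 1 (fun t : ℝ => (t : ℂ)) := Complex.ofRealCLM.contDiff
  have h6 : ContDiffAt ℝ 1 (fun y => a * (cosh (u y) - ecc a (axial (d y)))) x :=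
    contDiffAt_const.mul ((contDiff_cosh.contDiffAt.comp x hu).sub h2)
  have h7 : ContDiffAt ℝ 1 (fun y => d y / endSinh a (axial (d y)) * sinh (u y)) x :=
    (hd.div h3 h4).mul (contDiff_sinh.contDiffAt.comp x hu)
  exact (h5.contDiffAt.comp x h6).add ((h5.contDiffAt.comp x h7).mul contDiffAt_const)

theorem continuousAt_framePoint (ha : 0 < a) (hδ : δ ^ 2 < 1) (u : ℝ) :
    ContinuousAt (fun p : ℝ × ℝ => framePoint a p.1 p.2) (δ, u) :=
  (contDiffAt_framePoint (x := (δ, u)) (d := Prod.fst) (u := Prod.snd) ha contDiffAt_fst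
    contDiffAt_snd hδ).continuousAt

theorem tendsto_framePoint {X : Type*} {l : Filter X} {d u : X → ℝ} {u₀ : ℝ}
    (ha : 0 < a) (hd : Tendsto d l (𝓝 δ)) (hu : Tendsto u l (𝓝 u₀)) (hδ : δ ^ 2 < 1) :
    Tendsto (fun y => framePoint a (d y) (u y)) l (𝓝 (framePoint a δ u₀)) := by
  have h1 : Tendsto (fun y => (d y, u y)) l (𝓝 (δ, u₀)) := hd.prodMk_nhds hu
  have h2 : Tendsto (fun p : ℝ × ℝ => framePoint a p.1 p.2) (𝓝 (δ, u₀))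
      (𝓝 (framePoint a δ u₀)) := continuousAt_framePoint ha hδ u₀
  have h3 := h2.comp h1
  simp only [Function.comp_def] at h3
  exact h3

theorem contDiffAt_anomaly {X : Type*} [NormedAddCommGroup X] [NormedSpace ℝ X] {d t : X → ℝ}
    {x : X} (ha : 0 < a) (hd : ContDiffAt ℝ 1 d x) (ht : ContDiffAt ℝ 1 t x) (hδ : d x ^ 2 < 1)
    (h : frameOrbit a n (d x) (t x) ≠ 0) :
    ContDiffAt ℝ 1 (fun y => anomaly a n (d y) (t y)) x := by
  have h1 : ContDiffAt ℝ 1 (fun y => axial (d y)) x := (contDiffAt_axial hδ).comp x hd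
  refine contDiffAt_keplerInv ((contDiffAt_ecc ha _).comp x h1)
    ((contDiffAt_const.mul ht).sub (ContDiffAt.comp (g := endMean a) x (contDiffAt_endMean ha (neg_one_lt_axial _)) h1)) ?_
    ((framePoint_ne_zero_iff ha hδ _).mp h)
  filter_upwards [eventually_sq_lt_one hd.continuousAt hδ] with y hy using one_le_ecc_axial ha hy

theorem contDiffAt_frameOrbit {X : Type*} [NormedAddCommGroup X] [NormedSpace ℝ X] {d t : X → ℝ}
    {x : X} (ha : 0 < a) (hd : ContDiffAt ℝ 1 d x) (ht : ContDiffAt ℝ 1 t x) (hδ : d x ^ 2 < 1)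
    (h : frameOrbit a n (d x) (t x) ≠ 0) :
    ContDiffAt ℝ 1 (fun y => frameOrbit a n (d y) (t y)) x :=
  contDiffAt_framePoint ha hd (contDiffAt_anomaly ha hd ht hδ h) hδ

theorem tendsto_anomaly {X : Type*} {l : Filter X} {d t : X → ℝ} {t₀ : ℝ}
    (ha : 0 < a) (hd : Tendsto d l (𝓝 δ)) (ht : Tendsto t l (𝓝 t₀)) (hδ : δ ^ 2 < 1) :
    Tendsto (fun y => anomaly a n (d y) (t y)) l (𝓝 (anomaly a n δ t₀)) := by
  have h1 : Tendsto (fun y => axial (d y)) l (𝓝 (axial δ)) :=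
    (contDiffAt_axial hδ).continuousAt.tendsto.comp hd
  refine tendsto_keplerInv (one_le_ecc_axial ha hδ)
    ((contDiffAt_ecc ha _).continuousAt.tendsto.comp h1) ((ht.const_mul n).sub
    ((contDiffAt_endMean ha (neg_one_lt_axial _)).continuousAt.tendsto.comp h1)) ?_
  filter_upwards [hd.eventually ((continuousAt_id.pow 2).eventually (gt_mem_nhds hδ))] with y hy
    using one_le_ecc_axial ha hy

theorem tendsto_frameOrbit {X : Type*} {l : Filter X} {d t : X → ℝ} {t₀ : ℝ}
    (ha : 0 < a) (hd : Tendsto d l (𝓝 δ)) (ht : Tendsto t l (𝓝 t₀)) (hδ : δ ^ 2 < 1) :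
    Tendsto (fun y => frameOrbit a n (d y) (t y)) l (𝓝 (frameOrbit a n δ t₀)) :=
  tendsto_framePoint ha hd (tendsto_anomaly ha hd ht hδ) hδ

end Frame

/-! ### Differentiability with respect to the end points at the collision -/

/-- A function which is `C¹` near a point, except at the point where it is merely continuous, is
`C¹` there if its derivative tends to zero at the point. -/
theorem contDiffAt_of_tendsto_deriv_zero {F : Type*} [NormedAddCommGroup F] [NormedSpace ℝ F]
    {f : ℝ → F} {x : ℝ} (hf : ContinuousAt f x)
    (hd : ∀ᶠ y in 𝓝[≠] x, ContDiffAt ℝ 1 f y) (hl : Tendsto (deriv f) (𝓝[≠] x) (𝓝 0)) :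
    ContDiffAt ℝ 1 f x := by
  have hmem : {y | DifferentiableAt ℝ f y} ∈ 𝓝[≠] x :=
    hd.mono fun y hy => hy.differentiableAt one_ne_zero
  have hdiff : DifferentiableOn ℝ f {y | DifferentiableAt ℝ f y} :=
    fun y hy => DifferentiableAt.differentiableWithinAt hy
  -- A continuous function whose derivative has a limit from one side has that limit as one-sided
  -- derivative; both sides together give derivative `0` at `x`.
  have hr : HasDerivWithinAt f 0 (Ici x) x :=
    hasDerivWithinAt_Ici_of_tendsto_deriv hdiff hf.continuousWithinAt
      (nhdsWithin_mono x (fun y hy => ne_of_gt hy) hmem)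
      (hl.mono_left (nhdsWithin_mono x fun y hy => ne_of_gt hy))
  have hle : HasDerivWithinAt f 0 (Iic x) x :=
    hasDerivWithinAt_Iic_of_tendsto_deriv hdiff hf.continuousWithinAt
      (nhdsWithin_mono x (fun y hy => ne_of_lt hy) hmem)
      (hl.mono_left (nhdsWithin_mono x fun y hy => ne_of_lt hy))
  have h0 : HasDerivAt f 0 x := by simpa using hle.union hr
  have hall : ∀ᶠ y in 𝓝[≠] x, ContinuousAt (fderiv ℝ f) y ∧ HasFDerivAt f (fderiv ℝ f y) y :=
    hd.mono fun y hy => ⟨(hy.fderiv_right (m := 0) (by norm_num)).continuousAt,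
      (hy.differentiableAt one_ne_zero).hasFDerivAt⟩
  have hx : ContinuousAt (fderiv ℝ f) x ∧ HasFDerivAt f (fderiv ℝ f x) x := by
    refine ⟨?_, h0.differentiableAt.hasFDerivAt⟩
    rw [continuousAt_iff_punctured_nhds, ← toSpanSingleton_deriv, h0.deriv,
      ContinuousLinearMap.toSpanSingleton_zero, tendsto_zero_iff_norm_tendsto_zero]
    refine hl.norm.congr' (Eventually.of_forall fun y => ?_) |>.trans (by rw [norm_zero])
    rw [← toSpanSingleton_deriv, ContinuousLinearMap.norm_toSpanSingleton]
  have hev : ∀ᶠ y in 𝓝 x, ContinuousAt (fderiv ℝ f) y ∧ HasFDerivAt f (fderiv ℝ f y) y := by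
    rw [← nhdsNE_sup_pure x]
    exact eventually_sup.mpr ⟨hall, hx⟩
  exact contDiffAt_one_iff.mpr ⟨fderiv ℝ f, _, hev, fun y hy => hy.1.continuousWithinAt,
    fun y hy => hy.2⟩

theorem one_sub_axial {δ : ℝ} (hδ : δ ^ 2 < 1) :
    δ ^ 2 / 2 ≤ |axial δ - 1| ∧ |axial δ - 1| ≤ δ ^ 2 := by
  have h1 := axial_sq hδ
  have h2 := axial_pos hδ
  have h3 := axial_le_one δ
  rw [abs_of_nonpos (by linarith)]
  constructor <;> nlinarith

theorem hasDerivAt_axial {δ : ℝ} (hδ : δ ^ 2 < 1) : HasDerivAt axial (-δ / axial δ) δ := by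
  have h : HasDerivAt (fun δ : ℝ => 1 - δ ^ 2) (-(2 * δ)) δ := by
    simpa using (hasDerivAt_pow 2 δ).const_sub 1
  refine (h.sqrt (by linarith)).congr_deriv ?_
  have := axial_pos hδ
  unfold axial at this ⊢
  field_simp

theorem eventually_abs_deriv_le {G : ℝ → ℝ} {x : ℝ} (hG : ContDiffAt ℝ 1 G x) :
    ∃ K > 0, ∀ᶠ y in 𝓝 x, DifferentiableAt ℝ G y ∧ |deriv G y| ≤ K ∧ |G y - G x| ≤ K * |y - x| := by
  obtain ⟨K, t, ht, hK⟩ := hG.exists_lipschitzOnWith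
  refine ⟨K + 1, by positivity, ?_⟩
  filter_upwards [eventually_mem_nhds_iff.mpr ht, hG.eventually (by simp)] with y hy hy2
  refine ⟨hy2.differentiableAt one_ne_zero, ?_, ?_⟩
  · have := norm_deriv_le_of_lipschitzOn hy hK
    rw [Real.norm_eq_abs] at this
    linarith
  · have := hK.dist_le_mul y (mem_of_mem_nhds hy) x (mem_of_mem_nhds ht)
    rw [Real.dist_eq, Real.dist_eq] at this
    linarith [abs_nonneg (y - x)]

/-- Even functions of the transversal component: growth of the function and of its derivative. -/
theorem eventually_axial_le {G : ℝ → ℝ} (hG : ContDiffAt ℝ 1 G 1) :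
    ∃ K > 0, ∀ᶠ δ in 𝓝 (0 : ℝ), |deriv (fun δ => G (axial δ)) δ| ≤ K * |δ| ∧
      |G (axial δ) - G 1| ≤ K * δ ^ 2 := by
  obtain ⟨K, hK, h⟩ := eventually_abs_deriv_le hG
  have hcont : Tendsto axial (𝓝 0) (𝓝 1) := by
    have := (contDiffAt_axial (δ := 0) (by norm_num)).continuousAt.tendsto
    rwa [axial_zero] at this
  refine ⟨2 * K, by positivity, ?_⟩
  filter_upwards [hcont.eventually h, hcont.eventually (lt_mem_nhds (by norm_num : (1:ℝ)/2 < 1)),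
    eventually_sq_lt_one (f := id) (x := (0:ℝ)) continuousAt_id (by norm_num)]
    with δ ⟨h1, h2, h3⟩ h4 h5
  constructor
  · have h6 := (h1.hasDerivAt.comp δ (hasDerivAt_axial h5)).deriv
    simp only [Function.comp_def] at h6
    rw [h6, abs_mul, abs_div, abs_neg, abs_of_pos (by linarith : 0 < axial δ)]
    have h7 : |δ| / axial δ ≤ 2 * |δ| := by
      rw [div_le_iff₀ (by linarith)]
      nlinarith [abs_nonneg δ]
    calc |deriv G (axial δ)| * (|δ| / axial δ) ≤ K * (2 * |δ|) := by gcongr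
      _ = _ := by ring
  · have := (one_sub_axial h5).2
    simp only [id] at this
    nlinarith [mul_le_mul_of_nonneg_left this hK.le, sq_nonneg δ]

/-- A nonzero derivative makes `G c - G 1` comparable with `c - 1`, and `1 - axial δ` is at least
`δ² / 2`. -/
theorem eventually_le_axial {G : ℝ → ℝ} (hG : ContDiffAt ℝ 1 G 1) (h0 : deriv G 1 ≠ 0) :
    ∃ K > 0, ∀ᶠ δ in 𝓝 (0 : ℝ), δ ^ 2 ≤ K * |G (axial δ) - G 1| := by
  have hcont : Tendsto axial (𝓝 0) (𝓝 1) := by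
    have := (contDiffAt_axial (δ := 0) (by norm_num)).continuousAt.tendsto
    rwa [axial_zero] at this
  have h1 := (hG.differentiableAt one_ne_zero).hasDerivAt
  have h2 : (fun c => c - 1) =O[𝓝 1] fun c => G c - G 1 := by
    exact (HasDerivAtFilter.isTheta_sub h1 h0).isBigO_symm.comp_tendsto
      (k := fun c : ℝ => (c, (1 : ℝ))) (tendsto_id.prodMk (tendsto_pure.mpr (Eventually.of_forall fun _ => rfl)))
  obtain ⟨K, hK, h⟩ := h2.exists_pos
  refine ⟨2 * K, by positivity, ?_⟩
  filter_upwards [hcont.eventually h.bound,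
    eventually_sq_lt_one (f := id) (x := (0:ℝ)) continuousAt_id (by norm_num)] with δ h3 h4
  have := (one_sub_axial h4).1
  simp only [id] at this
  simp only [Real.norm_eq_abs] at h3
  linarith

/-- The anomaly, near the collision, of the orbits at the time of the collision. -/
theorem tendsto_deriv_anomaly_collision {E M : ℝ → ℝ} {K : ℝ} (hK : 1 ≤ K)
    (hE : ∀ᶠ δ in 𝓝[≠] (0 : ℝ), 1 < E δ ∧ DifferentiableAt ℝ E δ ∧ DifferentiableAt ℝ M δ ∧
      DifferentiableAt ℝ (fun δ => keplerInv (E δ) (M δ)) δ)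
    (hb : ∀ᶠ δ in 𝓝[≠] (0 : ℝ), |deriv E δ| ≤ K * |δ| ∧ |deriv M δ| ≤ K * |δ| ∧
      |E δ - 1| ≤ K * δ ^ 2 ∧ δ ^ 2 ≤ K * |M δ|)
    (hu : Tendsto (fun δ => keplerInv (E δ) (M δ)) (𝓝[≠] 0) (𝓝 0)) :
    Tendsto (fun δ => sinh (keplerInv (E δ) (M δ)) * deriv (fun δ => keplerInv (E δ) (M δ)) δ)
      (𝓝[≠] 0) (𝓝 0) ∧
    Tendsto (fun δ => δ * deriv (fun δ => keplerInv (E δ) (M δ)) δ) (𝓝[≠] 0) (𝓝 0) := by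
  set u : ℝ → ℝ := fun δ => keplerInv (E δ) (M δ) with hudef
  have hK0 : 0 < K := by linarith
  have hEe : ∀ᶠ δ in 𝓝[≠] (0 : ℝ), ∀ᶠ y in 𝓝 δ, 1 < E y := by
    have := eventually_eventually_nhdsWithin.mpr (hE.mono fun δ h => h.1)
    filter_upwards [this, self_mem_nhdsWithin] with δ h1 h2
    rwa [isOpen_compl_singleton.nhdsWithin_eq h2] at h1
  have hbound : ∀ᶠ δ in 𝓝[≠] (0 : ℝ), (u δ * deriv u δ) ^ 2 ≤ 72 * K ^ 3 * |u δ| ∧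
      |δ * deriv u δ| ≤ 12 * K ^ 2 * |u δ| ∧ |u δ| ≤ 1 := by
    have hsmall : ∀ᶠ δ in 𝓝[≠] (0 : ℝ), |u δ| < 1 / (4 * K ^ 2) := by
      have := hu.abs
      rw [abs_zero] at this
      exact this.eventually (gt_mem_nhds (by positivity))
    filter_upwards [hE, hEe, hb, hsmall, self_mem_nhdsWithin]
      with δ ⟨h1, h2, h3, h4⟩ h5 ⟨b1, b2, b3, b4⟩ b5 b6
    have hu1 : |u δ| ≤ 1 := by
      refine b5.le.trans ((div_le_one (by positivity)).mpr ?_)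
      nlinarith
    have b5' : 4 * K ^ 2 * |u δ| ≤ 1 := by
      rw [lt_div_iff₀ (by positivity)] at b5
      linarith
    have hk : kepler (E δ) (u δ) = M δ := kepler_keplerInv h1.le _
    obtain ⟨c1, c2⟩ := cosh_sub_one_le hu1
    have hd2 : 0 < δ ^ 2 := by have : δ ≠ 0 := b6; positivity
    -- Kepler's equation is split as `M = (E - 1) sinh u + (sinh u - u)`.
    have hM : |M δ| ≤ K * δ ^ 2 * (2 * |u δ|) + |u δ| ^ 3 := by
      have e : M δ = (E δ - 1) * sinh (u δ) + kepler 1 (u δ) := by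
        rw [← hk]; simp only [kepler]; ring
      rw [e]
      refine (abs_add_le _ _).trans (add_le_add ?_ (abs_kepler_one_le hu1))
      rw [abs_mul]
      gcongr
    -- In `δ² ≤ K |M|` the term `2 K² δ² |u|` is at most `δ² / 2` because `4 K² |u| ≤ 1`, and is
    -- absorbed on the left.
    have hδu : δ ^ 2 ≤ 2 * K * |u δ| ^ 3 := by
      have e : δ ^ 2 ≤ K * (K * δ ^ 2 * (2 * |u δ|) + |u δ| ^ 3) :=
        b4.trans (mul_le_mul_of_nonneg_left hM hK0.le)
      nlinarith [mul_le_mul_of_nonneg_right b5' hd2.le]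
    have hu0 : 0 < |u δ| := by
      by_contra h
      have : |u δ| = 0 := le_antisymm (not_lt.mp h) (abs_nonneg _)
      rw [this] at hδu
      nlinarith
    have hder : deriv E δ * sinh (u δ) + (E δ * cosh (u δ) - 1) * deriv u δ = deriv M δ := by
      have e1 := (h2.hasDerivAt.mul h4.hasDerivAt.sinh).sub h4.hasDerivAt
      have e2 : (E * fun y => sinh (u y)) - u =ᶠ[𝓝 δ] M := by
        filter_upwards [h5] with y hy using kepler_keplerInv hy.le _
      have e3 := (e1.congr_of_eventuallyEq e2.symm).unique h3.hasDerivAt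
      rw [← e3]; ring
    -- In the differentiated equation the coefficient of `u'` is at least `u² / 2`, and the
    -- remaining terms are `O(|δ|)`. Combined with `δ² ≤ 2 K |u|³`, this bounds both `(u u')²` and
    -- `δ u'` by multiples of `|u|`.
    have hup : u δ ^ 2 * |deriv u δ| ≤ 6 * K * |δ| := by
      have e1 : u δ ^ 2 / 2 ≤ E δ * cosh (u δ) - 1 := by
        nlinarith [one_add_sq_div_two_le_cosh (u δ), one_le_cosh (u δ)]
      have e2 : (E δ * cosh (u δ) - 1) * |deriv u δ| ≤ K * |δ| + K * |δ| * 2 := by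
        rw [← abs_of_nonneg ((by positivity : 0 ≤ u δ ^ 2 / 2).trans e1), ← abs_mul,
          (by linarith : (E δ * cosh (u δ) - 1) * deriv u δ = deriv M δ - deriv E δ * sinh (u δ))]
        refine (abs_sub _ _).trans (add_le_add b2 ?_)
        rw [abs_mul]
        gcongr
        linarith
      nlinarith [mul_le_mul_of_nonneg_right e1 (abs_nonneg (deriv u δ))]
    refine ⟨?_, ?_, hu1⟩
    · have e1 : (u δ ^ 2 * |deriv u δ|) ^ 2 ≤ (6 * K * |δ|) ^ 2 := by gcongr
      have e2 : (6 * K * |δ|) ^ 2 = 36 * K ^ 2 * δ ^ 2 := by rw [mul_pow, sq_abs]; ring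
      have e3 : (u δ ^ 2 * |deriv u δ|) ^ 2 = (u δ * deriv u δ) ^ 2 * |u δ| ^ 2 := by
        rw [mul_pow, sq_abs, mul_pow, sq_abs]; ring
      rw [e2, e3] at e1
      have e4 : 36 * K ^ 2 * δ ^ 2 ≤ 36 * K ^ 2 * (2 * K * |u δ| ^ 3) := by gcongr
      refine le_of_mul_le_mul_right (e1.trans (e4.trans (le_of_eq ?_))) (pow_pos hu0 2)
      ring
    · have e1 : |δ| * (u δ ^ 2 * |deriv u δ|) ≤ |δ| * (6 * K * |δ|) := by gcongr
      have e2 : |δ| * (6 * K * |δ|) = 6 * K * δ ^ 2 := by rw [← sq_abs δ]; ring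
      have e4 : 6 * K * δ ^ 2 ≤ 6 * K * (2 * K * |u δ| ^ 3) := by gcongr
      rw [abs_mul]
      refine le_of_mul_le_mul_right ?_ (pow_pos hu0 2)
      calc |δ| * |deriv u δ| * |u δ| ^ 2 = |δ| * (u δ ^ 2 * |deriv u δ|) := by
            rw [sq_abs]; ring
        _ ≤ 6 * K * (2 * K * |u δ| ^ 3) := e1.trans (e2.le.trans e4)
        _ = _ := by ring
  have habs : Tendsto (fun δ => |u δ|) (𝓝[≠] 0) (𝓝 0) := by simpa using hu.abs
  constructor
  · have hsq : Tendsto (fun δ => (u δ * deriv u δ) ^ 2) (𝓝[≠] 0) (𝓝 0) := by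
      refine squeeze_zero' (Eventually.of_forall fun δ => sq_nonneg _)
        (hbound.mono fun δ h => h.1) ?_
      simpa using habs.const_mul (72 * K ^ 3)
    have habs2 : Tendsto (fun δ => 2 * |u δ * deriv u δ|) (𝓝[≠] 0) (𝓝 0) := by
      have := (hsq.sqrt).const_mul 2
      simpa [sqrt_sq_eq_abs] using this
    refine squeeze_zero_norm' ?_ habs2
    filter_upwards [hbound] with δ h
    rw [Real.norm_eq_abs, abs_mul, abs_mul, ← mul_assoc]
    gcongr
    exact (cosh_sub_one_le h.2.2).2
  · refine squeeze_zero_norm' (hbound.mono fun δ h => h.2.1) ?_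
    simpa using habs.const_mul (12 * K ^ 2)

/-- At every fixed time the position is a `C¹` function of the end points, including when the
position is the collision. -/
theorem contDiffAt_frameOrbit_fixed_time {a n δ₀ : ℝ} (ha : 0 < a) (hδ₀ : δ₀ ^ 2 < 1) (s : ℝ) :
    ContDiffAt ℝ 1 (fun δ => frameOrbit a n δ s) δ₀ := by
  by_cases h : frameOrbit a n δ₀ s = 0
  swap
  · exact contDiffAt_frameOrbit (d := id) (t := fun _ => s) ha contDiffAt_id contDiffAt_const hδ₀ h
  have hcol : ecc a (axial δ₀) * cosh (anomaly a n δ₀ s) - 1 = 0 := by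
    have := (framePoint_ne_zero_iff ha hδ₀ (anomaly a n δ₀ s)).not.mp (not_not.mpr h)
    exact not_not.mp this
  -- The radius vanishes only if `ε = 1` and `u = 0`, and `ε > 1` for a nonzero offset.
  have h0 : δ₀ = 0 := by
    by_contra hne
    have := one_lt_ecc ha (axial_pos hδ₀) (axial_lt_one hne)
    nlinarith [one_le_cosh (anomaly a n δ₀ s)]
  subst h0
  rw [axial_zero, ecc_one ha, one_mul, sub_eq_zero] at hcol
  have hu0 : anomaly a n 0 s = 0 := by
    by_contra hne
    exact (one_lt_cosh.mpr hne).ne' hcol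
  have hM0 : n * s = endMean a 1 := by
    have := kepler_keplerInv (one_le_ecc_axial ha hδ₀) (n * s - endMean a (axial 0))
    rw [← anomaly, hu0, kepler_zero, axial_zero] at this
    linarith
  set u : ℝ → ℝ := fun δ => anomaly a n δ s with hu
  have hEq : u = fun δ => keplerInv (ecc a (axial δ)) (n * s - endMean a (axial δ)) := rfl
  have hlt : ∀ᶠ δ in 𝓝[≠] (0 : ℝ), δ ^ 2 < 1 ∧ δ ≠ 0 :=
    ((eventually_sq_lt_one (f := id) (x := (0:ℝ)) continuousAt_id (by norm_num)).filter_mono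
      nhdsWithin_le_nhds).and self_mem_nhdsWithin
  have hgt : ∀ {δ : ℝ}, δ ^ 2 < 1 → δ ≠ 0 → 1 < ecc a (axial δ) := fun h1 h2 =>
    one_lt_ecc ha (axial_pos h1) (axial_lt_one h2)
  have hne : ∀ {δ : ℝ}, δ ^ 2 < 1 → δ ≠ 0 → frameOrbit a n δ s ≠ 0 := fun {δ} h1 h2 =>
    (framePoint_ne_zero_iff ha h1 _).mpr (by nlinarith [hgt h1 h2, one_le_cosh (anomaly a n δ s)])
  have hut : Tendsto u (𝓝 0) (𝓝 0) := by
    have := tendsto_anomaly (n := n) (l := 𝓝 0) (d := id) (t := fun _ => s) ha tendsto_id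
      tendsto_const_nhds hδ₀
    rwa [hu0] at this
  have hcd : ∀ {δ : ℝ}, δ ^ 2 < 1 → δ ≠ 0 → ContDiffAt ℝ 1 u δ := fun h1 h2 =>
    contDiffAt_anomaly (d := id) (t := fun _ => s) ha contDiffAt_id contDiffAt_const h1 (hne h1 h2)
  obtain ⟨K₁, hK₁, b₁⟩ := eventually_axial_le (contDiffAt_ecc ha 1)
  obtain ⟨K₂, hK₂, b₂⟩ := eventually_axial_le (contDiffAt_endMean ha (by norm_num : (-1:ℝ) < 1))
  obtain ⟨K₃, hK₃, b₃⟩ := eventually_le_axial (contDiffAt_endMean ha (by norm_num : (-1:ℝ) < 1))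
    (deriv_endMean_one_ne_zero ha)
  have hbd : ∀ᶠ δ in 𝓝[≠] (0 : ℝ), |deriv (fun δ => ecc a (axial δ)) δ| ≤ (K₁ + K₂ + K₃ + 1) * |δ| ∧
      |deriv (fun δ => n * s - endMean a (axial δ)) δ| ≤ (K₁ + K₂ + K₃ + 1) * |δ| ∧
      |ecc a (axial δ) - 1| ≤ (K₁ + K₂ + K₃ + 1) * δ ^ 2 ∧
      δ ^ 2 ≤ (K₁ + K₂ + K₃ + 1) * |n * s - endMean a (axial δ)| := by
    filter_upwards [b₁.filter_mono nhdsWithin_le_nhds, b₂.filter_mono nhdsWithin_le_nhds,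
      b₃.filter_mono nhdsWithin_le_nhds] with δ c₁ c₂ c₃
    have hd0 := abs_nonneg δ
    refine ⟨c₁.1.trans (by gcongr; linarith), ?_, ?_, ?_⟩
    · rw [deriv_const_sub, abs_neg]
      exact c₂.1.trans (by gcongr; linarith)
    · rw [ecc_one ha] at c₁
      exact c₁.2.trans (by gcongr; linarith)
    · rw [hM0, abs_sub_comm]
      exact c₃.trans (by gcongr; linarith)
  have hax : ∀ {δ : ℝ}, δ ^ 2 < 1 → ContDiffAt ℝ 1 (fun δ => ecc a (axial δ)) δ := fun {δ} h1 =>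
    ContDiffAt.comp (g := ecc a) δ (contDiffAt_ecc ha _) (contDiffAt_axial h1)
  have hmean : ∀ {δ : ℝ}, δ ^ 2 < 1 → ContDiffAt ℝ 1 (fun δ => n * s - endMean a (axial δ)) δ :=
    fun {δ} h1 => contDiffAt_const.sub (ContDiffAt.comp (g := endMean a) δ
      (contDiffAt_endMean ha (neg_one_lt_axial _)) (contDiffAt_axial h1))
  obtain ⟨l₁, l₂⟩ := tendsto_deriv_anomaly_collision (E := fun δ => ecc a (axial δ))
    (M := fun δ => n * s - endMean a (axial δ)) (K := K₁ + K₂ + K₃ + 1) (by linarith)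
    (hlt.mono fun δ hδ => ⟨hgt hδ.1 hδ.2, (hax hδ.1).differentiableAt one_ne_zero,
      (hmean hδ.1).differentiableAt one_ne_zero,
      (hcd hδ.1 hδ.2).differentiableAt one_ne_zero⟩) hbd (hut.mono_left nhdsWithin_le_nhds)
  rw [← hEq] at l₁ l₂
  have hρ : ∀ {δ : ℝ}, δ ^ 2 < 1 → ContDiffAt ℝ 1 (fun δ => δ / endSinh a (axial δ)) δ :=
    fun {δ} h1 => contDiffAt_id.div (ContDiffAt.comp (g := endSinh a) δ
      (contDiffAt_endSinh ha (neg_one_lt_axial _)) (contDiffAt_axial h1))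
      (endSinh_pos ha (neg_one_lt_axial _)).ne'
  obtain ⟨K₄, hK₄, b₄⟩ := eventually_abs_deriv_le (hρ hδ₀)
  have hut' : Tendsto u (𝓝[≠] 0) (𝓝 0) := hut.mono_left nhdsWithin_le_nhds
  -- `hre` and `him` treat the real and imaginary parts of the `δ`-derivative of the position; both
  -- tend to `0`.
  have hre : Tendsto (fun δ => a * (sinh (u δ) * deriv u δ - deriv (fun δ => ecc a (axial δ)) δ))
      (𝓝[≠] 0) (𝓝 0) := by
    have : Tendsto (deriv (fun δ => ecc a (axial δ))) (𝓝[≠] 0) (𝓝 0) := by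
      refine squeeze_zero_norm' (hbd.mono fun δ h => h.1) ?_
      have : Tendsto (fun δ : ℝ => (K₁ + K₂ + K₃ + 1) * |δ|) (𝓝 0) (𝓝 ((K₁ + K₂ + K₃ + 1) * |0|)) :=
        (continuous_const.mul continuous_abs).tendsto 0
      simpa using this.mono_left nhdsWithin_le_nhds
    have h := (l₁.sub this).const_mul a
    rw [sub_zero, mul_zero] at h
    exact h
  have him : Tendsto (fun δ => deriv (fun δ => δ / endSinh a (axial δ)) δ * sinh (u δ) +
      δ / endSinh a (axial δ) * (cosh (u δ) * deriv u δ)) (𝓝[≠] 0) (𝓝 0) := by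
    have t1 : Tendsto (fun δ => deriv (fun δ => δ / endSinh a (axial δ)) δ * sinh (u δ))
        (𝓝[≠] 0) (𝓝 0) := by
      have hs : Tendsto (fun δ => K₄ * |sinh (u δ)|) (𝓝[≠] 0) (𝓝 0) := by
        have := (((continuous_sinh.tendsto 0).comp hut').abs).const_mul K₄
        simpa using this
      refine squeeze_zero_norm' ?_ hs
      filter_upwards [b₄.filter_mono nhdsWithin_le_nhds] with δ h
      rw [Real.norm_eq_abs, abs_mul]
      gcongr
      exact h.2.1
    have t2 : Tendsto (fun δ => (endSinh a (axial δ))⁻¹) (𝓝[≠] 0) (𝓝 (endSinh a (axial 0))⁻¹) :=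
      ((ContDiffAt.comp (g := endSinh a) 0 (contDiffAt_endSinh ha (neg_one_lt_axial _))
        (contDiffAt_axial hδ₀)).continuousAt.tendsto.inv₀
        (endSinh_pos ha (neg_one_lt_axial _)).ne').mono_left nhdsWithin_le_nhds
    have t3 : Tendsto (fun δ => cosh (u δ)) (𝓝[≠] 0) (𝓝 (cosh 0)) :=
      (continuous_cosh.tendsto 0).comp hut'
    have t4 := t1.add ((t2.mul t3).mul l₂)
    rw [mul_zero, add_zero] at t4
    refine t4.congr fun δ => ?_
    rw [div_eq_mul_inv]; ring
  refine contDiffAt_of_tendsto_deriv_zero ?_ ?_ ?_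
  · exact tendsto_frameOrbit (d := id) (t := fun _ => s) ha tendsto_id tendsto_const_nhds hδ₀
  · exact hlt.mono fun δ hδ => contDiffAt_frameOrbit (d := id) (t := fun _ => s) ha contDiffAt_id
      contDiffAt_const hδ.1 (hne hδ.1 hδ.2)
  · have hlim := ((Complex.continuous_ofReal.tendsto 0).comp hre).add
      (((Complex.continuous_ofReal.tendsto 0).comp him).mul_const Complex.I)
    simp only [Complex.ofReal_zero, zero_mul, add_zero] at hlim
    refine hlim.congr' ?_
    filter_upwards [hlt] with δ hδ
    have d1 := ((hcd hδ.1 hδ.2).differentiableAt one_ne_zero).hasDerivAt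
    have d2 := ((hax hδ.1).differentiableAt one_ne_zero).hasDerivAt
    have d3 := ((hρ hδ.1).differentiableAt one_ne_zero).hasDerivAt
    have d4 := ((d1.cosh.sub d2).const_mul a).ofReal_comp
    have d5 := ((d3.mul d1.sinh).ofReal_comp).mul_const Complex.I
    exact (d4.add d5).deriv.symm

/-! ### Frame of a pair of end points -/

/-- The midpoint of the shortest arc of the unit circle between two points. -/
noncomputable def arcMid (p q : ℂ) : ℂ := (p + q) / (‖p + q‖ : ℂ)

/-- The component of `q` transversal to the direction of `arcMid p q`. -/
noncomputable def offset (p q : ℂ) : ℝ := (q * (starRingEnd ℂ) p).im / ‖p + q‖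

/-- The point of the unit circle with transversal component `δ` in the right half-plane. -/
noncomputable def frameEnd (δ : ℝ) : ℂ := (axial δ : ℂ) + (δ : ℂ) * Complex.I

theorem frameEnd_re (δ : ℝ) : (frameEnd δ).re = axial δ := by simp [frameEnd]

theorem frameEnd_im (δ : ℝ) : (frameEnd δ).im = δ := by simp [frameEnd]

theorem conj_frameEnd (δ : ℝ) : (starRingEnd ℂ) (frameEnd δ) = frameEnd (-δ) := by
  simp [frameEnd, axial]

theorem norm_frameEnd {δ : ℝ} (hδ : δ ^ 2 < 1) : ‖frameEnd δ‖ = 1 := by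
  rw [frameEnd, Complex.norm_add_mul_I, axial_sq hδ, sub_add_cancel, sqrt_one]

theorem frameEnd_ne_zero {δ : ℝ} (hδ : δ ^ 2 < 1) : frameEnd δ ≠ 0 :=
  norm_ne_zero_iff.mp (by rw [norm_frameEnd hδ]; exact one_ne_zero)

theorem frameEnd_mul_frameEnd_neg {δ : ℝ} (hδ : δ ^ 2 < 1) : frameEnd δ * frameEnd (-δ) = 1 := by
  rw [← conj_frameEnd, Complex.mul_conj, Complex.normSq_eq_norm_sq, norm_frameEnd hδ]
  simp

section EndPoints

variable {p₀ p₁ : ℂ}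

theorem norm_add_sq_of_norm_eq_one (h₀ : ‖p₀‖ = 1) (h₁ : ‖p₁‖ = 1) :
    ‖p₀ + p₁‖ ^ 2 = 4 - ‖p₀ - p₁‖ ^ 2 := by
  have h := parallelogram_law_with_norm ℝ p₀ p₁
  rw [h₀, h₁] at h
  nlinarith

theorem norm_add_pos (h : NonAntipodal p₀ p₁) : 0 < ‖p₀ + p₁‖ := by
  have h1 := norm_add_sq_of_norm_eq_one h.1 h.2.1
  have h2 : ‖p₀ - p₁‖ ^ 2 < 4 := by nlinarith [h.2.2, norm_nonneg (p₀ - p₁)]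
  by_contra h3
  have : ‖p₀ + p₁‖ = 0 := le_antisymm (not_lt.mp h3) (norm_nonneg _)
  rw [this] at h1
  linarith

theorem norm_arcMid (h : NonAntipodal p₀ p₁) : ‖arcMid p₀ p₁‖ = 1 := by
  rw [arcMid, norm_div, Complex.norm_real, norm_norm, div_self (norm_add_pos h).ne']

theorem arcMid_ne_zero (h : NonAntipodal p₀ p₁) : arcMid p₀ p₁ ≠ 0 :=
  norm_ne_zero_iff.mp (by rw [norm_arcMid h]; exact one_ne_zero)

theorem re_im_sq_eq_one {p : ℂ} (h : ‖p‖ = 1) : p.re ^ 2 + p.im ^ 2 = 1 := by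
  have := Complex.sq_norm p
  rw [h, Complex.normSq_apply] at this
  nlinarith

theorem norm_add_sq_re_im (p q : ℂ) : ‖p + q‖ ^ 2 = (p.re + q.re) ^ 2 + (p.im + q.im) ^ 2 := by
  rw [Complex.sq_norm, Complex.normSq_apply]; simp; ring

/-- `offset p q` is the imaginary part of `q` times the conjugate of `arcMid p q`, since `q` times
its own conjugate is real. The axial component is `‖p + q‖ / 2`. -/
theorem offset_sq (h : NonAntipodal p₀ p₁) : offset p₀ p₁ ^ 2 = 1 - (‖p₀ + p₁‖ / 2) ^ 2 := by
  have hN := norm_add_pos h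
  have h0 := re_im_sq_eq_one h.1
  have h1 := re_im_sq_eq_one h.2.1
  have h2 := norm_add_sq_re_im p₀ p₁
  rw [offset, div_pow, div_eq_iff (by positivity)]
  simp only [Complex.mul_im, Complex.conj_re, Complex.conj_im]
  set N := ‖p₀ + p₁‖
  rw [sub_mul, div_pow, div_mul_eq_mul_div, one_mul, ← pow_add, show 2 + 2 = 2 * 2 by norm_num,
    pow_mul, h2]
  have h3 : (p₀.re + p₁.re) ^ 2 + (p₀.im + p₁.im) ^ 2 = 2 + 2 * (p₀.re * p₁.re + p₀.im * p₁.im) := by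
    linear_combination h0 + h1
  rw [h3]
  linear_combination (p₁.re ^ 2 + p₁.im ^ 2) * h0 + h1

theorem offset_sq_lt_one (h : NonAntipodal p₀ p₁) : offset p₀ p₁ ^ 2 < 1 := by
  rw [offset_sq h]
  have := norm_add_pos h
  have : 0 < (‖p₀ + p₁‖ / 2) ^ 2 := by positivity
  linarith

theorem axial_offset (h : NonAntipodal p₀ p₁) : axial (offset p₀ p₁) = ‖p₀ + p₁‖ / 2 := by
  rw [axial, offset_sq h, sub_sub_cancel, sqrt_sq (by positivity)]

theorem axial_offset_eq_norm_sub (h : NonAntipodal p₀ p₁) :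
    axial (offset p₀ p₁) = √(1 - ‖p₀ - p₁‖ ^ 2 / 4) := by
  rw [axial, offset_sq h, sub_sub_cancel, div_pow, norm_add_sq_of_norm_eq_one h.1 h.2.1]
  congr 1; ring

/-- Rotation by `arcMid` carries the symmetric pair `frameEnd (±δ)` to the given end points, which
reduces the problem to the one parameter `δ`. -/
theorem arcMid_mul_frameEnd (h : NonAntipodal p₀ p₁) :
    arcMid p₀ p₁ * frameEnd (offset p₀ p₁) = p₁ := by
  have hN := norm_add_pos h
  have h0 := re_im_sq_eq_one h.1
  have h1 := re_im_sq_eq_one h.2.1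
  have h2 := norm_add_sq_re_im p₀ p₁
  rw [frameEnd, axial_offset h, arcMid, offset]
  set N := ‖p₀ + p₁‖
  apply Complex.ext
  · simp
    field_simp
    linear_combination (p₀.re - p₁.re) * h2 + (p₀.re + p₁.re) * (h0 - h1)
  · simp
    field_simp
    linear_combination (p₀.im - p₁.im) * h2 + (p₀.im + p₁.im) * (h0 - h1)

theorem NonAntipodal.symm (h : NonAntipodal p₀ p₁) : NonAntipodal p₁ p₀ :=
  ⟨h.2.1, h.1, by rw [norm_sub_rev]; exact h.2.2⟩

theorem offset_symm (p q : ℂ) : offset q p = -offset p q := by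
  simp only [offset, add_comm q p, Complex.mul_im, Complex.conj_re, Complex.conj_im]
  ring

theorem arcMid_mul_frameEnd_neg (h : NonAntipodal p₀ p₁) :
    arcMid p₀ p₁ * frameEnd (-offset p₀ p₁) = p₀ := by
  have := arcMid_mul_frameEnd (NonAntipodal.symm h)
  rwa [offset_symm, arcMid, add_comm, ← arcMid] at this

theorem nonAntipodal_self {p : ℂ} (hp : ‖p‖ = 1) : NonAntipodal p p := ⟨hp, hp, by simp⟩

theorem offset_self (p : ℂ) : offset p p = 0 := by simp [offset, mul_comm]

theorem arcMid_self {p : ℂ} (hp : ‖p‖ = 1) : arcMid p p = p := by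
  have := arcMid_mul_frameEnd (nonAntipodal_self hp)
  rw [offset_self] at this
  simpa [frameEnd, axial_zero] using this

theorem offset_ne_zero (h : NonAntipodal p₀ p₁) (hne : p₀ ≠ p₁) : offset p₀ p₁ ≠ 0 := fun h0 => by
  have h1 := arcMid_mul_frameEnd h
  have h2 := arcMid_mul_frameEnd_neg h
  rw [h0] at h1 h2
  rw [neg_zero] at h2
  exact hne (h2.symm.trans h1)

end EndPoints

/-! ### The index of a curve between points of the circle -/

theorem arg_frameEnd_lt {δ : ℝ} (hδ : δ ^ 2 < 1) : |Complex.arg (frameEnd δ)| < π / 2 :=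
  Complex.abs_arg_lt_pi_div_two_iff.mpr (Or.inl (by rw [frameEnd_re]; exact axial_pos hδ))

theorem exp_arg_frameEnd {δ : ℝ} (hδ : δ ^ 2 < 1) :
    Complex.exp (Complex.arg (frameEnd δ) * Complex.I) = frameEnd δ := by
  have := Complex.norm_mul_exp_arg_mul_I (frameEnd δ)
  rwa [norm_frameEnd hδ, Complex.ofReal_one, one_mul] at this

/-- The quotient is `exp (-2iθ)` with `|θ| < π / 2`, so `-2θ` is already the principal argument. -/
theorem arg_div_frameEnd {δ : ℝ} (hδ : δ ^ 2 < 1) :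
    Complex.arg (frameEnd (-δ) / frameEnd δ) = -2 * Complex.arg (frameEnd δ) := by
  have h1 := abs_lt.mp (arg_frameEnd_lt hδ)
  have h2 : frameEnd (-δ) / frameEnd δ =
      Complex.exp (((-2 * Complex.arg (frameEnd δ) : ℝ) : ℂ) * Complex.I) := by
    rw [div_eq_iff (frameEnd_ne_zero hδ)]
    have : frameEnd (-δ) = (frameEnd δ)⁻¹ :=
      eq_inv_of_mul_eq_one_right (frameEnd_mul_frameEnd_neg hδ)
    rw [this]
    nth_rewrite 1 3 [← exp_arg_frameEnd hδ]
    rw [← Complex.exp_neg, ← Complex.exp_add]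
    congr 1
    push_cast; ring
  rw [h2, Complex.arg_exp_mul_I, toIocMod_eq_self]
  constructor <;> linarith

theorem arg_div_eq {p₀ p₁ : ℂ} (h : NonAntipodal p₀ p₁) :
    Complex.arg (p₀ / p₁) = -2 * Complex.arg (frameEnd (offset p₀ p₁)) := by
  rw [← arg_div_frameEnd (offset_sq_lt_one h),
    ← mul_div_mul_left (frameEnd (-offset p₀ p₁)) _ (arcMid_ne_zero h),
    arcMid_mul_frameEnd h, arcMid_mul_frameEnd_neg h]

theorem integral_shortestArc {p q : ℂ} (hp : p ≠ 0) :
    ∫ t in (0 : ℝ)..1, deriv (shortestArc p q) t / shortestArc p q t =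
      Complex.arg (q / p) * Complex.I := by
  have h : ∀ t : ℝ, deriv (shortestArc p q) t / shortestArc p q t =
      Complex.arg (q / p) * Complex.I := fun t => by
    have h1 : HasDerivAt (fun t : ℝ => (t : ℂ) * Complex.arg (q / p) * Complex.I)
        (Complex.arg (q / p) * Complex.I) t := by
      simpa using ((Complex.ofRealCLM.hasDerivAt (x := t)).mul_const
        (Complex.arg (q / p) : ℂ)).mul_const Complex.I
    have h2 : HasDerivAt (shortestArc p q) _ t := (h1.cexp).const_mul p
    rw [h2.deriv, shortestArc]
    have := Complex.exp_ne_zero ((t : ℂ) * Complex.arg (q / p) * Complex.I)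
    field_simp
  simp only [h, intervalIntegral.integral_const, sub_zero, one_smul]

/-- The shortest arc contributes `-2θ i`, where `θ` is the argument of `frameEnd (offset p₀ p₁)`;
the index thus records only `∫ v / z`. -/
theorem openCurveIndex_eq {p₀ p₁ : ℂ} (h : NonAntipodal p₀ p₁) {T : ℝ} {z : ℝ → ℂ}
    (hz : JoinsInside p₀ p₁ T z) {v : ℝ → ℂ}
    (hv : ∀ s ∈ Icc 0 T, HasDerivWithinAt z (v s) (Icc 0 T) s) :
    openCurveIndex z 0 T = 1 / (2 * π * Complex.I) * ((∫ s in (0 : ℝ)..T, v s / z s) -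
      2 * Complex.arg (frameEnd (offset p₀ p₁)) * Complex.I) := by
  have hp₁ : p₁ ≠ 0 := norm_ne_zero_iff.mp (by rw [h.2.1]; exact one_ne_zero)
  have h1 : ∫ s in (0 : ℝ)..T, derivWithin z (Icc 0 T) s / z s = ∫ s in (0 : ℝ)..T, v s / z s := by
    refine intervalIntegral.integral_congr fun s hs => ?_
    rw [uIcc_of_le hz.pos.le] at hs
    simp only [(hv s hs).derivWithin (uniqueDiffOn_Icc hz.pos s hs)]
  rw [openCurveIndex, h1, hz.left, hz.right, integral_shortestArc hp₁, arg_div_eq h]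
  push_cast
  ring

/-! ### The orbits solve the problem -/

/-- The duration of the orbit. -/
noncomputable def duration (a n δ : ℝ) : ℝ := 2 * endMean a (axial δ) / n

/-- The velocity on the orbit with mean motion `n`. -/
noncomputable def frameVelocity (a n δ s : ℝ) : ℂ :=
  ((a * sinh (anomaly a n δ s) * (n / (ecc a (axial δ) * cosh (anomaly a n δ s) - 1)) : ℝ) : ℂ) +
  ((δ / endSinh a (axial δ) * cosh (anomaly a n δ s) *
    (n / (ecc a (axial δ) * cosh (anomaly a n δ s) - 1)) : ℝ) : ℂ) * Complex.I

section Orbit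

variable {a n δ : ℝ}

theorem anomaly_eq_iff (ha : 0 < a) (hδ : δ ^ 2 < 1) {s u : ℝ} :
    anomaly a n δ s = u ↔ kepler (ecc a (axial δ)) u = n * s - endMean a (axial δ) :=
  keplerInv_eq_iff (one_le_ecc_axial ha hδ)

theorem strictMono_anomaly (ha : 0 < a) (hn : 0 < n) (hδ : δ ^ 2 < 1) :
    StrictMono (anomaly a n δ) := fun s t h =>
  strictMono_keplerInv (one_le_ecc_axial ha hδ) (by
    have := mul_lt_mul_of_pos_left h hn; linarith)

theorem anomaly_zero (ha : 0 < a) (hδ : δ ^ 2 < 1) :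
    anomaly a n δ 0 = -endAnomaly a (axial δ) := by
  rw [anomaly_eq_iff ha hδ, kepler_neg, kepler_endAnomaly]; ring

theorem anomaly_duration (ha : 0 < a) (hn : 0 < n) (hδ : δ ^ 2 < 1) :
    anomaly a n δ (duration a n δ) = endAnomaly a (axial δ) := by
  rw [anomaly_eq_iff ha hδ, kepler_endAnomaly, duration]; field_simp; ring

theorem duration_pos (ha : 0 < a) (hn : 0 < n) (hδ : δ ^ 2 < 1) : 0 < duration a n δ := by
  have := endMean_pos ha (axial_pos hδ) (axial_le_one δ)
  unfold duration; positivity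

theorem framePoint_endAnomaly (ha : 0 < a) (δ : ℝ) :
    framePoint a δ (endAnomaly a (axial δ)) = frameEnd δ := by
  have h := (endSinh_pos ha (neg_one_lt_axial δ)).ne'
  rw [framePoint, cosh_endAnomaly ha (neg_one_lt_axial δ), sinh_endAnomaly,
    endCosh_sub_ecc ha, div_mul_cancel₀ _ h, frameEnd]

theorem framePoint_neg_endAnomaly (ha : 0 < a) (δ : ℝ) :
    framePoint a δ (-endAnomaly a (axial δ)) = frameEnd (-δ) := by
  have h := (endSinh_pos ha (neg_one_lt_axial δ)).ne'
  rw [framePoint, cosh_neg, sinh_neg, cosh_endAnomaly ha (neg_one_lt_axial δ), sinh_endAnomaly,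
    endCosh_sub_ecc ha, mul_neg, div_mul_cancel₀ _ h, ← conj_frameEnd, frameEnd]
  simp

theorem frameOrbit_zero (ha : 0 < a) (hδ : δ ^ 2 < 1) : frameOrbit a n δ 0 = frameEnd (-δ) := by
  rw [frameOrbit, anomaly_zero ha hδ, framePoint_neg_endAnomaly ha]

theorem frameOrbit_duration (ha : 0 < a) (hn : 0 < n) (hδ : δ ^ 2 < 1) :
    frameOrbit a n δ (duration a n δ) = frameEnd δ := by
  rw [frameOrbit, anomaly_duration ha hn hδ, framePoint_endAnomaly ha]

theorem norm_frameOrbit_lt_one (ha : 0 < a) (hn : 0 < n) (hδ : δ ^ 2 < 1) {s : ℝ}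
    (hs : s ∈ Ioo 0 (duration a n δ)) : ‖frameOrbit a n δ s‖ < 1 := by
  have h1 := strictMono_anomaly ha hn hδ hs.1
  have h2 := strictMono_anomaly ha hn hδ hs.2
  rw [anomaly_zero ha hδ] at h1
  rw [anomaly_duration ha hn hδ] at h2
  have h3 : cosh (anomaly a n δ s) < endCosh a (axial δ) := by
    rw [← cosh_endAnomaly ha (neg_one_lt_axial δ), cosh_lt_cosh]
    exact (abs_lt.mpr ⟨h1, h2⟩).trans_le (le_abs_self _)
  rw [frameOrbit, norm_framePoint ha hδ]
  have h4 := ecc_mul_endCosh ha (axial δ)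
  have h5 : a * (ecc a (axial δ) * cosh (anomaly a n δ s)) <
      a * (ecc a (axial δ) * endCosh a (axial δ)) := by
    have := ecc_pos ha (axial δ)
    gcongr
  linarith

theorem joinsInside_orbit {p₀ p₁ : ℂ} (ha : 0 < a) (hn : 0 < n) (h : NonAntipodal p₀ p₁) :
    JoinsInside p₀ p₁ (duration a n (offset p₀ p₁))
      (fun s => arcMid p₀ p₁ * frameOrbit a n (offset p₀ p₁) s) where
  pos := duration_pos ha hn (offset_sq_lt_one h)
  left := by
    simp only [frameOrbit_zero ha (offset_sq_lt_one h), arcMid_mul_frameEnd_neg h]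
  right := by
    simp only [frameOrbit_duration ha hn (offset_sq_lt_one h), arcMid_mul_frameEnd h]
  inside s hs := by
    rw [norm_mul, norm_arcMid h, one_mul]
    exact norm_frameOrbit_lt_one ha hn (offset_sq_lt_one h) hs

theorem continuous_anomaly (ha : 0 < a) (hδ : δ ^ 2 < 1) : Continuous (anomaly a n δ) :=
  (continuous_keplerInv (one_le_ecc_axial ha hδ)).comp (by fun_prop)

theorem continuous_frameOrbit (ha : 0 < a) (hδ : δ ^ 2 < 1) : Continuous (frameOrbit a n δ) := by
  have := continuous_anomaly (n := n) ha hδ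
  unfold frameOrbit framePoint
  fun_prop

theorem hasDerivAt_anomaly (ha : 0 < a) (hδ : δ ^ 2 < 1) {s : ℝ}
    (h : frameOrbit a n δ s ≠ 0) : HasDerivAt (anomaly a n δ)
      (n / (ecc a (axial δ) * cosh (anomaly a n δ s) - 1)) s := by
  have h1 := (framePoint_ne_zero_iff ha hδ _).mp h
  have h2 : HasDerivAt (fun s => n * s - endMean a (axial δ)) n s := by
    simpa using ((hasDerivAt_id s).const_mul n).sub_const (endMean a (axial δ))
  have h3 := (hasDerivAt_keplerInv (one_le_ecc_axial ha hδ) h1).comp s h2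
  refine h3.congr_deriv ?_
  rw [mul_comm, ← div_eq_mul_inv, anomaly]

theorem hasDerivAt_frameOrbit (ha : 0 < a) (hδ : δ ^ 2 < 1) {s : ℝ}
    (h : frameOrbit a n δ s ≠ 0) : HasDerivAt (frameOrbit a n δ) (frameVelocity a n δ s) s := by
  have hu := hasDerivAt_anomaly ha hδ h
  have h1 := ((hu.cosh.sub_const (ecc a (axial δ))).const_mul a).ofReal_comp
  have h2 := ((hu.sinh.const_mul (δ / endSinh a (axial δ))).ofReal_comp).mul_const Complex.I
  refine (h1.add h2).congr_deriv ?_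
  rw [frameVelocity, mul_assoc a, mul_assoc (δ / _)]

theorem hasDerivAt_frameVelocity (ha : 0 < a) (hδ : δ ^ 2 < 1) {s : ℝ}
    (h : frameOrbit a n δ s ≠ 0) : HasDerivAt (frameVelocity a n δ)
      (-((n ^ 2 * a ^ 3 / ‖frameOrbit a n δ s‖ ^ 3 : ℝ) : ℂ) * frameOrbit a n δ s) s := by
  have hu := hasDerivAt_anomaly ha hδ h
  have hD := (framePoint_ne_zero_iff ha hδ _).mp h
  have hd := ((hu.cosh.const_mul (ecc a (axial δ))).sub_const 1)
  have hq := (hasDerivAt_const s n).fun_div hd hD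
  have h1 := ((hu.sinh.const_mul a).mul hq).ofReal_comp
  have h2 := (((hu.cosh.const_mul (δ / endSinh a (axial δ))).mul hq).ofReal_comp).mul_const Complex.I
  refine (h1.add h2).congr_deriv ?_
  rw [show ‖frameOrbit a n δ s‖ = _ from norm_framePoint ha hδ _, frameOrbit, framePoint]
  set u := anomaly a n δ s
  set ε := ecc a (axial δ)
  set ρ := δ / endSinh a (axial δ)
  have hs : sinh u ^ 2 = cosh u ^ 2 - 1 := sinh_sq u
  rw [mul_add, ← Complex.ofReal_neg, ← Complex.ofReal_mul, ← mul_assoc (_ : ℂ), ← Complex.ofReal_mul]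
  congr 2
  · field_simp
    linear_combination (-ε * n ^ 2 / (ε * cosh u - 1) ^ 3) * hs
  · congr 1
    field_simp
    ring

theorem norm_frameVelocity_sq (ha : 0 < a) (hδ : δ ^ 2 < 1) {s : ℝ}
    (h : frameOrbit a n δ s ≠ 0) :
    ‖frameVelocity a n δ s‖ ^ 2 = n ^ 2 * a ^ 2 + 2 * (n ^ 2 * a ^ 3) / ‖frameOrbit a n δ s‖ := by
  have hD := (framePoint_ne_zero_iff ha hδ _).mp h
  rw [show ‖frameOrbit a n δ s‖ = _ from norm_framePoint ha hδ _, frameVelocity,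
    Complex.norm_add_mul_I, sq_sqrt (by positivity), mul_pow (δ / _ * _), mul_pow (δ / _),
    transversal_sq ha hδ]
  set u := anomaly a n δ s
  set ε := ecc a (axial δ)
  have hs : sinh u ^ 2 = cosh u ^ 2 - 1 := sinh_sq u
  field_simp
  linear_combination n ^ 2 * hs

theorem solvesInner_orbit {E h μ : ℝ} {m : ℂ} {S : Set ℝ} (ha : 0 < a) (hδ : δ ^ 2 < 1)
    (hE : E + h = n ^ 2 * a ^ 2 / 2) (hμ : μ = n ^ 2 * a ^ 3) (hm : ‖m‖ = 1)
    (hS : ∀ s ∈ S, frameOrbit a n δ s ≠ 0) : SolvesInner E h μ (fun s => m * frameOrbit a n δ s) S := by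
  have hm0 : m ≠ 0 := norm_ne_zero_iff.mp (by rw [hm]; exact one_ne_zero)
  refine ⟨fun s => m * frameVelocity a n δ s, fun s hs => ⟨mul_ne_zero hm0 (hS s hs), ?_, ?_, ?_⟩⟩
  · exact ((hasDerivAt_frameOrbit ha hδ (hS s hs)).const_mul m).hasDerivWithinAt
  · rw [(hasGradientAt_innerPotential E h μ (mul_ne_zero hm0 (hS s hs))).gradient]
    refine (((hasDerivAt_frameVelocity ha hδ (hS s hs)).const_mul m).congr_deriv ?_).hasDerivWithinAt
    rw [norm_mul, hm, one_mul, hμ, Complex.real_smul]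
    push_cast
    ring
  · simp only [innerPotential, norm_mul, hm, one_mul]
    rw [norm_frameVelocity_sq ha hδ (hS s hs), hE, hμ]
    ring

/-! ### Simplicity and index of the collisionless orbits. -/

theorem frameOrbit_ne_zero (ha : 0 < a) (hδ : δ ^ 2 < 1) (h0 : δ ≠ 0) (s : ℝ) :
    frameOrbit a n δ s ≠ 0 := by
  refine (framePoint_ne_zero_iff ha hδ _).mpr ?_
  nlinarith [one_lt_ecc ha (axial_pos hδ) (axial_lt_one h0), one_le_cosh (anomaly a n δ s)]

/-- The transversal coordinate is a nonzero multiple of `sinh u`, hence strictly monotone in time.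
-/
theorem injective_frameOrbit (ha : 0 < a) (hn : 0 < n) (hδ : δ ^ 2 < 1) (h0 : δ ≠ 0) :
    Function.Injective (frameOrbit a n δ) := fun s t h => by
  have h1 := congrArg Complex.im h
  simp only [frameOrbit, framePoint, Complex.add_im, Complex.ofReal_im, Complex.im_ofReal_mul,
    Complex.I_im, mul_one, zero_add] at h1
  have h2 := mul_left_cancel₀ (div_ne_zero h0 (endSinh_pos ha (neg_one_lt_axial δ)).ne') h1
  exact (strictMono_anomaly ha hn hδ).injective (sinh_injective h2)

/-- The orbit meets the real axis only at `u = 0`, at the negative point `a (1 - ε)`. Hence `log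
(-z)` is a smooth branch of the logarithm along it. -/
theorem neg_frameOrbit_mem_slitPlane (ha : 0 < a) (hδ : δ ^ 2 < 1) (h0 : δ ≠ 0) (s : ℝ) :
    -frameOrbit a n δ s ∈ Complex.slitPlane := by
  rw [Complex.mem_slitPlane_iff]
  simp only [frameOrbit, framePoint, Complex.neg_re, Complex.neg_im, Complex.add_re,
    Complex.add_im, Complex.ofReal_re, Complex.ofReal_im, Complex.im_ofReal_mul,
    Complex.re_ofReal_mul, Complex.I_im, Complex.I_re, mul_one, mul_zero, add_zero, zero_add]
  by_cases hu : anomaly a n δ s = 0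
  · left
    rw [hu, cosh_zero]
    nlinarith [one_lt_ecc ha (axial_pos hδ) (axial_lt_one h0)]
  · right
    rw [neg_ne_zero]
    exact mul_ne_zero (div_ne_zero h0 (endSinh_pos ha (neg_one_lt_axial δ)).ne')
      (sinh_ne_zero.mpr hu)

/-- The two ends lie on opposite sides of the real axis, so negation shifts their arguments by `π`
in opposite directions. The difference of `2π` is the winding of the orbit around the origin. -/
theorem log_neg_frameEnd (hδ : δ ^ 2 < 1) (h0 : δ ≠ 0) :
    Complex.log (-frameEnd δ) - Complex.log (-frameEnd (-δ)) =
      2 * Complex.arg (frameEnd δ) * Complex.I - 2 * π * Complex.I ∨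
    Complex.log (-frameEnd δ) - Complex.log (-frameEnd (-δ)) =
      2 * Complex.arg (frameEnd δ) * Complex.I + 2 * π * Complex.I := by
  have h1 : ∀ d : ℝ, d ^ 2 < 1 → Complex.log (-frameEnd d) = Complex.arg (-frameEnd d) * Complex.I :=
    fun d hd => by
      apply Complex.ext <;> simp [Complex.log_re, Complex.log_im, norm_frameEnd hd]
  have h2 : Complex.arg (frameEnd (-δ)) = -Complex.arg (frameEnd δ) := by
    rw [← conj_frameEnd, Complex.arg_conj, if_neg]
    have := abs_lt.mp (arg_frameEnd_lt hδ)
    linarith [pi_pos]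
  rw [h1 δ hδ, h1 (-δ) (by rwa [neg_sq])]
  rcases lt_or_gt_of_ne h0 with h | h
  · right
    rw [Complex.arg_neg_eq_arg_add_pi_of_im_neg (by rwa [frameEnd_im]),
      Complex.arg_neg_eq_arg_sub_pi_of_im_pos (by rw [frameEnd_im]; linarith), h2]
    push_cast; ring
  · left
    rw [Complex.arg_neg_eq_arg_sub_pi_of_im_pos (by rwa [frameEnd_im]),
      Complex.arg_neg_eq_arg_add_pi_of_im_neg (by rw [frameEnd_im]; linarith), h2]
    push_cast; ring

theorem index_orbit {p₀ p₁ : ℂ} (ha : 0 < a) (hn : 0 < n) (h : NonAntipodal p₀ p₁)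
    (hne : p₀ ≠ p₁) :
    openCurveIndex (fun s => arcMid p₀ p₁ * frameOrbit a n (offset p₀ p₁) s) 0
      (duration a n (offset p₀ p₁)) = 1 ∨
    openCurveIndex (fun s => arcMid p₀ p₁ * frameOrbit a n (offset p₀ p₁) s) 0
      (duration a n (offset p₀ p₁)) = -1 := by
  have hδ := offset_sq_lt_one h
  have h0 := offset_ne_zero h hne
  rw [openCurveIndex_eq h (joinsInside_orbit ha hn h) (v := fun s => arcMid p₀ p₁ *
    frameVelocity a n (offset p₀ p₁) s) fun s _ =>
      ((hasDerivAt_frameOrbit ha hδ (frameOrbit_ne_zero ha hδ h0 s)).const_mul _).hasDerivWithinAt]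
  set δ := offset p₀ p₁
  have hcv : Continuous (frameVelocity a n δ) := continuous_iff_continuousAt.mpr fun s =>
    (hasDerivAt_frameVelocity ha hδ (frameOrbit_ne_zero ha hδ h0 s)).continuousAt
  have hint : ∫ s in (0 : ℝ)..duration a n δ, (arcMid p₀ p₁ * frameVelocity a n δ s) /
      (arcMid p₀ p₁ * frameOrbit a n δ s) =
      Complex.log (-frameEnd δ) - Complex.log (-frameEnd (-δ)) := by
    have hd : ∀ s : ℝ, HasDerivAt (fun s => Complex.log (-frameOrbit a n δ s))
        ((arcMid p₀ p₁ * frameVelocity a n δ s) / (arcMid p₀ p₁ * frameOrbit a n δ s)) s :=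
      fun s => by
        have := (hasDerivAt_frameOrbit (n := n) ha hδ (frameOrbit_ne_zero ha hδ h0 s)).neg.clog_real
          (neg_frameOrbit_mem_slitPlane ha hδ h0 s)
        rw [mul_div_mul_left _ _ (arcMid_ne_zero h)]
        refine this.congr_deriv ?_
        simp [neg_div_neg_eq]
    rw [intervalIntegral.integral_eq_sub_of_hasDerivAt (fun s _ => hd s), frameOrbit_zero ha hδ,
      frameOrbit_duration ha hn hδ]
    refine Continuous.intervalIntegrable ?_ _ _
    refine (continuous_const.mul hcv).div (continuous_const.mul (continuous_frameOrbit ha hδ)) ?_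
    exact fun s => mul_ne_zero (arcMid_ne_zero h) (frameOrbit_ne_zero ha hδ h0 s)
  rw [hint]
  have hpi : (π : ℂ) ≠ 0 := by exact_mod_cast pi_ne_zero
  have hI := Complex.I_ne_zero
  rcases log_neg_frameEnd hδ h0 with h1 | h1 <;> rw [h1]
  · right; field_simp; ring
  · left; field_simp; ring

/-! ### Coinciding end points -/

theorem isEjectionCollisionArc_orbit {E h μ : ℝ} {p : ℂ} (ha : 0 < a) (hn : 0 < n)
    (hE : E + h = n ^ 2 * a ^ 2 / 2) (hμ : μ = n ^ 2 * a ^ 3) (hp : ‖p‖ = 1) :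
    IsEjectionCollisionArc E h μ p p (duration a n (offset p p))
      (fun s => arcMid p p * frameOrbit a n (offset p p) s) := by
  have hN := nonAntipodal_self hp
  refine ⟨joinsInside_orbit ha hn hN,
    (continuous_const.mul (continuous_frameOrbit ha (offset_sq_lt_one hN))).continuousOn, ?_⟩
  rw [offset_self, arcMid_self hp]
  have hδ : (0:ℝ) ^ 2 < 1 := by norm_num
  have hT := duration_pos ha hn hδ
  have hform : ∀ s, frameOrbit a n 0 s = ((a * (cosh (anomaly a n 0 s) - 1) : ℝ) : ℂ) := fun s => by
    simp [frameOrbit, framePoint, axial_zero, ecc_one ha]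
  -- By symmetry the collision takes place at half the duration. At all other times the orbit is a
  -- positive multiple of `p`, so its direction is constant.
  have hmid : anomaly a n 0 (duration a n 0 / 2) = 0 := by
    rw [anomaly_eq_iff ha hδ, kepler_zero, duration]; field_simp; ring
  have hne : ∀ s, s ≠ duration a n 0 / 2 → 0 < a * (cosh (anomaly a n 0 s) - 1) := fun s hs => by
    have : anomaly a n 0 s ≠ 0 := fun h0 =>
      hs ((strictMono_anomaly ha hn hδ).injective (h0.trans hmid.symm))
    exact mul_pos ha (sub_pos.mpr (one_lt_cosh.mpr this))
  refine ⟨duration a n 0 / 2, ⟨by linarith, by linarith⟩, by simp [hform, hmid], ?_, p, ?_⟩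
  · refine solvesInner_orbit ha hδ hE hμ hp fun s hs => ?_
    rw [hform]
    exact_mod_cast (hne s hs.2).ne'
  · refine tendsto_const_nhds.congr' ?_
    filter_upwards [self_mem_nhdsWithin] with s hs
    have h1 := hne s hs
    rw [norm_mul, hp, one_mul, hform, Complex.norm_real, Real.norm_of_nonneg h1.le,
      mul_div_cancel_right₀]
    exact_mod_cast h1.ne'

/-! ### Transversality -/

theorem inner_add_mul_I (x y b c : ℝ) :
    inner ℝ ((x : ℂ) + (y : ℂ) * Complex.I) ((b : ℂ) + (c : ℂ) * Complex.I) = x * b + y * c := by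
  simp [Complex.inner]; ring

/-- At radius `1` the inner product is the radial speed `a ε sinh u · u'`, where `u' = n / (ε cosh u
- 1) = n a`. -/
theorem inner_frameEnd_frameVelocity (ha : 0 < a) (hn : 0 < n) (hδ : δ ^ 2 < 1) :
    inner ℝ (frameEnd δ) (frameVelocity a n δ (duration a n δ)) =
      n * a ^ 2 * (ecc a (axial δ) * endSinh a (axial δ)) ∧
    -inner ℝ (frameEnd (-δ)) (frameVelocity a n δ 0) =
      n * a ^ 2 * (ecc a (axial δ) * endSinh a (axial δ)) := by
  have hs := endSinh_pos ha (neg_one_lt_axial δ)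
  have hs2 := endSinh_sq ha (neg_one_lt_axial δ)
  have h1 := ecc_mul_endCosh ha (axial δ)
  have h2 := endCosh_sub_ecc ha (axial δ)
  have h3 := transversal_sq ha hδ
  have h4 : a * (ecc a (axial δ) * endCosh a (axial δ) - 1) = 1 := by linarith
  have hD : ecc a (axial δ) * endCosh a (axial δ) - 1 ≠ 0 := fun h0 => by simp [h0] at h4
  have key : axial δ * (a * endSinh a (axial δ) * (n / (ecc a (axial δ) * endCosh a (axial δ) - 1)))
      + δ * (δ / endSinh a (axial δ) * endCosh a (axial δ) *
        (n / (ecc a (axial δ) * endCosh a (axial δ) - 1))) =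
      n * a ^ 2 * (ecc a (axial δ) * endSinh a (axial δ)) := by
    have h5 : δ = δ / endSinh a (axial δ) * endSinh a (axial δ) := by field_simp
    have h6 : n / (ecc a (axial δ) * endCosh a (axial δ) - 1) = n * a := by
      rw [div_eq_iff hD]; linear_combination (-n) * h4
    rw [h6]
    have h7 : axial δ = a * (endCosh a (axial δ) - ecc a (axial δ)) := h2.symm
    have h8 : δ * (δ / endSinh a (axial δ) * endCosh a (axial δ) * (n * a)) =
        (δ / endSinh a (axial δ)) ^ 2 * endSinh a (axial δ) * endCosh a (axial δ) * (n * a) := by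
      nth_rewrite 1 [h5]; ring
    rw [h8, h3]
    set ε := ecc a (axial δ)
    set x := endCosh a (axial δ)
    set y := endSinh a (axial δ)
    rw [h7]
    linear_combination (n * a ^ 2 * y * ε) * h4
  constructor
  · rw [frameVelocity, anomaly_duration ha hn hδ, cosh_endAnomaly ha (neg_one_lt_axial δ),
      sinh_endAnomaly, ← key, frameEnd, inner_add_mul_I]
  · rw [frameVelocity, anomaly_zero ha hδ, cosh_neg, sinh_neg,
      cosh_endAnomaly ha (neg_one_lt_axial δ), sinh_endAnomaly, ← key, frameEnd, inner_add_mul_I,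
      axial, neg_sq, ← axial]
    ring

/-- The squared cosine of the angle between the velocity and the normal to the circle at the end
points. -/
noncomputable def sqCosEnd (a c : ℝ) : ℝ := 1 - a ^ 2 * (ecc a c ^ 2 - 1) / (1 + 2 * a)

/-- At radius `1` the squared speed is `n² a² (1 + 2a)`, and `a² ε² (X² - 1) = (a + 1)² - a² ε²`
with `X = endCosh`, because `a ε X = a + 1`. -/
theorem transversality_frame (ha : 0 < a) (hn : 0 < n) {p v : ℂ} (hp : ‖p‖ = 1)
    (hv : ‖v‖ ^ 2 = n ^ 2 * a ^ 2 + 2 * (n ^ 2 * a ^ 3) / ‖p‖) {x : ℝ}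
    (hx : x = n * a ^ 2 * (ecc a (axial δ) * endSinh a (axial δ))) :
    x / ‖v‖ = √(sqCosEnd a (axial δ)) := by
  have hs := endSinh_pos ha (neg_one_lt_axial δ)
  have hs2 := endSinh_sq ha (neg_one_lt_axial δ)
  have hε := ecc_pos ha (axial δ)
  have h1 := ecc_mul_endCosh ha (axial δ)
  rw [hp, div_one] at hv
  have hv0 : ‖v‖ = √(n ^ 2 * a ^ 2 + 2 * (n ^ 2 * a ^ 3)) := by
    rw [← hv, sqrt_sq (norm_nonneg v)]
  have hx0 : 0 ≤ x := by rw [hx]; positivity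
  rw [hv0, ← sqrt_sq hx0, ← sqrt_div (sq_nonneg x), hx, sqCosEnd]
  congr 1
  have h1a : (0:ℝ) < 1 + 2 * a := by positivity
  have h2 : n ^ 2 * a ^ 2 + 2 * (n ^ 2 * a ^ 3) = n ^ 2 * a ^ 2 * (1 + 2 * a) := by ring
  rw [h2, div_eq_iff (by positivity), mul_pow, mul_pow (ecc a _), hs2]
  set ε := ecc a (axial δ)
  set X := endCosh a (axial δ)
  field_simp
  linear_combination (a * (ε * X) + a + 1) * h1

end Orbit

/-! ### Levi-Civita regularisation and uniqueness of classical solutions -/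

theorem eq_left_of_hasDerivWithinAt_zero {F : Type*} [NormedAddCommGroup F] [NormedSpace ℝ F]
    {g : ℝ → F} {T : ℝ} (hT : 0 < T)
    (h : ∀ s ∈ Icc 0 T, HasDerivWithinAt g 0 (Icc 0 T) s) : ∀ s ∈ Icc 0 T, g s = g 0 :=
  constant_of_derivWithin_zero (fun s hs => (h s hs).differentiableWithinAt) fun s hs =>
    (h s (Ico_subset_Icc_self hs)).derivWithin
      (uniqueDiffOn_Icc hT s (Ico_subset_Icc_self hs))

theorem hasDerivWithinAt_integral {F : Type*} [NormedAddCommGroup F] [NormedSpace ℝ F]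
    [CompleteSpace F] {f : ℝ → F} {T : ℝ} (hT : 0 < T) (hf : ContinuousOn f (Icc 0 T)) :
    ∀ s ∈ Icc 0 T, HasDerivWithinAt (fun s => ∫ t in (0 : ℝ)..s, f t) (f s) (Icc 0 T) s := by
  intro s hs
  -- Extending `f` by constants beyond the interval makes the fundamental theorem of calculus
  -- available at the end points too.
  let g := IccExtend hT.le (domRestrict (Icc 0 T) f)
  have hg : Continuous g := hf.domRestrict.Icc_extend'
  have hgf : ∀ t ∈ Icc 0 T, g t = f t := fun t ht => IccExtend_of_mem hT.le _ ht
  have h1 := (intervalIntegral.integral_hasDerivAt_right (hg.intervalIntegrable 0 s)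
    (hg.stronglyMeasurableAtFilter _ _) hg.continuousAt).hasDerivWithinAt (s := Icc 0 T)
  rw [hgf s hs] at h1
  refine h1.congr_of_mem (fun t ht => ?_) hs
  refine intervalIntegral.integral_congr fun r hr => (hgf r ?_).symm
  rw [uIcc_of_le ht.1] at hr
  exact ⟨hr.1, hr.2.trans ht.2⟩

variable {a n : ℝ}

/-- The Levi-Civita transform of a collisionless solution of energy `n² a² / 2`. -/
theorem exists_leviCivita {E h μ T : ℝ} {p₀ p₁ : ℂ} {z v : ℝ → ℂ} (ha : 0 < a) (hn : 0 < n)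
    (hE : E + h = n ^ 2 * a ^ 2 / 2) (hμ : μ = n ^ 2 * a ^ 3) (hz : JoinsInside p₀ p₁ T z)
    (hv : ∀ s ∈ Icc 0 T, z s ≠ 0 ∧ HasDerivWithinAt z (v s) (Icc 0 T) s ∧
      HasDerivWithinAt v (gradient (innerPotential E h μ) (z s)) (Icc 0 T) s ∧
      1 / 2 * ‖v s‖ ^ 2 - innerPotential E h μ (z s) = 0) :
    ∃ (w : ℝ → ℂ) (u : ℝ → ℝ) (A B : ℂ) (U : ℝ), 0 < U ∧ u 0 = -U ∧ u T = U ∧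
      ‖B‖ ^ 2 - ‖A‖ ^ 2 = 2 * a ∧
      w T = w 0 * Complex.exp ((∫ s in (0 : ℝ)..T, v s / z s) / 2) ∧
      ∀ s ∈ Icc 0 T, z s = w s ^ 2 ∧
        w s = A * (cosh (u s / 2) : ℝ) + B * (sinh (u s / 2) : ℝ) ∧
        HasDerivWithinAt u (n * a / ‖z s‖) (Icc 0 T) s := by
  have hT := hz.pos
  have h0mem : (0 : ℝ) ∈ Icc 0 T := ⟨le_rfl, hT.le⟩
  have hTmem : T ∈ Icc 0 T := ⟨hT.le, le_rfl⟩
  have hzc : ContinuousOn z (Icc 0 T) := fun s hs => (hv s hs).2.1.continuousWithinAt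
  have hvc : ContinuousOn v (Icc 0 T) := fun s hs => (hv s hs).2.2.1.continuousWithinAt
  have hfc : ContinuousOn (fun s => v s / z s) (Icc 0 T) := hvc.div hzc fun s hs => (hv s hs).1
  have hF := hasDerivWithinAt_integral hT hfc
  set F : ℝ → ℂ := fun s => ∫ t in (0 : ℝ)..s, v t / z t with hFdef
  obtain ⟨w₀, hw₀⟩ := IsAlgClosed.exists_pow_nat_eq p₀ (n := 2) two_pos
  -- A continuous square root of `z`: the exponential of half the integral of `z' / z`, which
  -- records the winding exactly.
  set w : ℝ → ℂ := fun s => w₀ * Complex.exp (F s / 2) with hwdef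
  have hw0 : w 0 = w₀ := by simp [hwdef, hFdef]
  have hwd : ∀ s ∈ Icc 0 T, HasDerivWithinAt w (w s * (v s / z s / 2)) (Icc 0 T) s := fun s hs => by
    have := (((hF s hs).div_const 2).cexp).const_mul w₀
    refine this.congr_deriv ?_
    simp only [hwdef]; ring
  have hw2 : ∀ s ∈ Icc 0 T, z s = w s ^ 2 := fun s hs => by
    have hconst := eq_left_of_hasDerivWithinAt_zero (g := fun s => w s ^ 2 / z s) hT
      (fun s hs => by
        have h1 := ((hwd s hs).fun_pow 2).fun_div (hv s hs).2.1 (hv s hs).1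
        refine h1.congr_deriv ?_
        have := (hv s hs).1
        field_simp
        push_cast
        ring) s hs
    have hz0 := (hv 0 h0mem).1
    simp only [hw0, hw₀, hz.left] at hconst
    rw [hz.left] at hz0
    rw [div_self hz0, div_eq_one_iff_eq (hv s hs).1] at hconst
    exact hconst.symm
  have hwne : ∀ s ∈ Icc 0 T, w s ≠ 0 := fun s hs h0 => (hv s hs).1 (by rw [hw2 s hs, h0]; simp)
  have hr : ∀ s ∈ Icc 0 T, 0 < ‖z s‖ := fun s hs => norm_pos_iff.mpr (hv s hs).1
  have hrc : ContinuousOn (fun s => n * a / ‖z s‖) (Icc 0 T) :=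
    continuousOn_const.div hzc.norm fun s hs => (hr s hs).ne'
  have hτ := hasDerivWithinAt_integral hT hrc
  set τ : ℝ → ℝ := fun s => ∫ t in (0 : ℝ)..s, n * a / ‖z t‖ with hτdef
  have hτT : 0 < τ T := by
    refine intervalIntegral.intervalIntegral_pos_of_pos_on ?_ (fun s hs => ?_) hT
    · exact hrc.intervalIntegrable_of_Icc hT.le
    · have := hr s (Ioo_subset_Icc_self hs)
      positivity
  -- The regularised time is shifted so that it runs over the symmetric interval `[-U, U]`.
  set u : ℝ → ℝ := fun s => τ s - τ T / 2 with hudef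
  have hu : ∀ s ∈ Icc 0 T, HasDerivWithinAt u (n * a / ‖z s‖) (Icc 0 T) s := fun s hs =>
    (hτ s hs).sub_const _
  have hrw : ∀ s ∈ Icc 0 T, ((‖z s‖ : ℝ) : ℂ) = w s * (starRingEnd ℂ) (w s) := fun s hs => by
    rw [hw2 s hs, norm_pow, Complex.mul_conj, Complex.normSq_eq_norm_sq]
  have hen : ∀ s ∈ Icc 0 T, ‖v s‖ ^ 2 = n ^ 2 * a ^ 2 + 2 * (n ^ 2 * a ^ 3) / ‖z s‖ := fun s hs => by
    have := (hv s hs).2.2.2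
    rw [innerPotential, hE, hμ] at this
    linear_combination 2 * this
  -- The momentum conjugate to `w`. Energy conservation linearises the system to `w' = P / |z|`, `P'
  -- = ω² w / |z|` with `ω = n a / 2`.
  set P : ℝ → ℂ := fun s => (starRingEnd ℂ) (w s) * v s / 2 with hPdef
  set ω : ℂ := ((n * a / 2 : ℝ) : ℂ) with hω
  have hω0 : ω ≠ 0 := by rw [hω]; exact_mod_cast (by positivity : n * a / 2 ≠ 0)
  have hwd' : ∀ s ∈ Icc 0 T, HasDerivWithinAt w (P s / ‖z s‖) (Icc 0 T) s := fun s hs => by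
    refine (hwd s hs).congr_deriv ?_
    have h1 := hwne s hs
    have h2 : (starRingEnd ℂ) (w s) ≠ 0 := (map_ne_zero _).mpr h1
    rw [hrw s hs, hw2 s hs, hPdef]
    field_simp
  have hPd : ∀ s ∈ Icc 0 T, HasDerivWithinAt P (ω ^ 2 * w s / ‖z s‖) (Icc 0 T) s := fun s hs => by
    have hc : HasDerivWithinAt (fun s => (starRingEnd ℂ) (w s))
        ((starRingEnd ℂ) (w s * (v s / z s / 2))) (Icc 0 T) s :=
      Complex.conjCLE.hasFDerivAt.comp_hasDerivWithinAt s (hwd s hs)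
    refine ((hc.fun_mul (hv s hs).2.2.1).div_const 2).congr_deriv ?_
    rw [(hasGradientAt_innerPotential E h μ (hv s hs).1).gradient, Complex.real_smul]
    have h1 := hwne s hs
    have h2 : (starRingEnd ℂ) (w s) ≠ 0 := (map_ne_zero _).mpr h1
    have h3 : v s * (starRingEnd ℂ) (v s) = (n ^ 2 * a ^ 2 : ℝ) +
        2 * (n ^ 2 * a ^ 3 : ℝ) / (‖z s‖ : ℝ) := by
      rw [Complex.mul_conj, Complex.normSq_eq_norm_sq, hen s hs]; push_cast; ring
    push_cast
    rw [hrw s hs] at h3 ⊢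
    rw [hw2 s hs, hμ, hω]
    push_cast at h3 ⊢
    simp only [map_mul, map_div₀, map_pow, map_ofNat]
    field_simp at h3 ⊢
    linear_combination h3
  have hexp : ∀ (σ : ℝ), ∀ s ∈ Icc 0 T, HasDerivWithinAt (fun s => Complex.exp ((σ * u s / 2 : ℝ)))
      (Complex.exp ((σ * u s / 2 : ℝ)) * (σ * ω / ‖z s‖)) (Icc 0 T) s := fun σ s hs => by
    have h1 := ((((hu s hs).const_mul σ).div_const 2).ofReal_comp).cexp
    refine h1.congr_deriv ?_
    rw [hω]; push_cast; ring
  -- The eigenvectors `P ± ω w` of the linear system grow like `exp (± u / 2)`; the two constants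
  -- give `A` and `B`.
  have hplus : ∀ s ∈ Icc 0 T, (P s + ω * w s) * Complex.exp (((-1) * u s / 2 : ℝ)) =
      (P 0 + ω * w 0) * Complex.exp (((-1) * u 0 / 2 : ℝ)) :=
    eq_left_of_hasDerivWithinAt_zero
      (g := fun s => (P s + ω * w s) * Complex.exp (((-1) * u s / 2 : ℝ))) hT (fun s hs => by
        have h1 := ((hPd s hs).fun_add ((hwd' s hs).const_mul ω)).fun_mul (hexp (-1) s hs)
        refine h1.congr_deriv ?_
        push_cast; ring)
  have hminus : ∀ s ∈ Icc 0 T, (P s - ω * w s) * Complex.exp ((1 * u s / 2 : ℝ)) =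
      (P 0 - ω * w 0) * Complex.exp ((1 * u 0 / 2 : ℝ)) :=
    eq_left_of_hasDerivWithinAt_zero
      (g := fun s => (P s - ω * w s) * Complex.exp ((1 * u s / 2 : ℝ))) hT (fun s hs => by
        have h1 := ((hPd s hs).fun_sub ((hwd' s hs).const_mul ω)).fun_mul (hexp 1 s hs)
        refine h1.congr_deriv ?_
        push_cast; ring)
  set Cp := (P 0 + ω * w 0) * Complex.exp (((-1) * u 0 / 2 : ℝ)) with hCp
  set Cm := (P 0 - ω * w 0) * Complex.exp ((1 * u 0 / 2 : ℝ)) with hCm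
  refine ⟨w, u, (Cp - Cm) / (2 * ω), (Cp + Cm) / (2 * ω), τ T / 2, by positivity,
    by simp [hudef, hτdef], by simp only [hudef]; ring, ?_, by rw [hw0], fun s hs =>
      ⟨hw2 s hs, ?_, hu s hs⟩⟩
  -- The relation for `A` and `B` is the energy at time `0`: `‖P‖² - ω² ‖w‖² = 2 a ω²`.
  · have hprod : Cp * (starRingEnd ℂ) Cm =
        (P 0 + ω * w 0) * (starRingEnd ℂ) (P 0 - ω * w 0) := by
      rw [hCp, hCm, map_mul, ← Complex.exp_conj, Complex.conj_ofReal]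
      have : Complex.exp (((-1) * u 0 / 2 : ℝ)) * Complex.exp ((1 * u 0 / 2 : ℝ)) = 1 := by
        rw [← Complex.exp_add, Complex.exp_eq_one_iff]
        exact ⟨0, by push_cast; ring⟩
      linear_combination ((P 0 + ω * w 0) * (starRingEnd ℂ) (P 0 - ω * w 0)) * this
    have hre : ∀ x y : ℂ, ‖x + y‖ ^ 2 - ‖x - y‖ ^ 2 = 4 * (x * (starRingEnd ℂ) y).re := fun x y => by
      simp only [Complex.sq_norm, Complex.normSq_apply, Complex.add_re, Complex.add_im,
        Complex.sub_re, Complex.sub_im, Complex.mul_re, Complex.conj_re, Complex.conj_im]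
      ring
    have hre2 : ∀ x y : ℂ, ((x + y) * (starRingEnd ℂ) (x - y)).re = ‖x‖ ^ 2 - ‖y‖ ^ 2 := fun x y => by
      simp only [Complex.sq_norm, Complex.normSq_apply, map_sub, Complex.add_re, Complex.add_im,
        Complex.sub_re, Complex.sub_im, Complex.mul_re, Complex.conj_re, Complex.conj_im]
      ring
    have hr0 := hr 0 h0mem
    have hωn : ‖ω‖ = n * a / 2 := by
      rw [hω, Complex.norm_real, Real.norm_of_nonneg (by positivity)]
    have hP0 : ‖P 0‖ ^ 2 = ‖z 0‖ * ‖v 0‖ ^ 2 / 4 := by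
      simp only [hPdef, norm_div, norm_mul, RCLike.norm_conj, Complex.norm_ofNat]
      rw [hw2 0 h0mem, norm_pow]; ring
    have hw0n : ‖w 0‖ ^ 2 = ‖z 0‖ := by rw [hw2 0 h0mem, norm_pow]
    rw [norm_div, norm_div, div_pow, div_pow, ← sub_div, hre, hprod, hre2, hP0, hen 0 h0mem,
      norm_mul ω (w 0), norm_mul 2 ω, mul_pow, mul_pow, hw0n, hωn, Complex.norm_ofNat]
    field_simp
    ring
  · have e1 := hplus s hs
    have e2 := hminus s hs
    rw [← e1, ← e2]
    have x1 : Complex.exp (((-1) * u s / 2 : ℝ)) = (cosh (u s / 2) : ℝ) - (sinh (u s / 2) : ℝ) := by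
      rw [← Complex.ofReal_exp, ← Complex.ofReal_sub, Real.cosh_sub_sinh]
      congr 2; ring
    have x2 : Complex.exp ((1 * u s / 2 : ℝ)) = (cosh (u s / 2) : ℝ) + (sinh (u s / 2) : ℝ) := by
      rw [← Complex.ofReal_exp, ← Complex.ofReal_add, Real.cosh_add_sinh]
      congr 2; ring
    rw [x1, x2]
    have hcs : ((cosh (u s / 2) : ℝ) : ℂ) ^ 2 - ((sinh (u s / 2) : ℝ) : ℂ) ^ 2 = 1 := by
      exact_mod_cast Real.cosh_sq_sub_sinh_sq (u s / 2)
    set ch : ℂ := ((cosh (u s / 2) : ℝ) : ℂ)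
    set sh : ℂ := ((sinh (u s / 2) : ℝ) : ℂ)
    field_simp
    linear_combination (-2 * ω * w s) * hcs


/-- The boundary value problem for the Levi-Civita transform. -/
theorem eq_framePoint_of_leviCivita {p₀ p₁ : ℂ} {A B : ℂ} {U : ℝ} (ha : 0 < a)
    (hN : NonAntipodal p₀ p₁) (hU : 0 < U) (hAB : ‖B‖ ^ 2 - ‖A‖ ^ 2 = 2 * a)
    (h₀ : (A * (cosh (U / 2) : ℝ) - B * (sinh (U / 2) : ℝ)) ^ 2 = p₀)
    (h₁ : (A * (cosh (U / 2) : ℝ) + B * (sinh (U / 2) : ℝ)) ^ 2 = p₁)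
    (h₀₁ : (A * (cosh (U / 2) : ℝ) - B * (sinh (U / 2) : ℝ)) *
      (A * (cosh (U / 2) : ℝ) + B * (sinh (U / 2) : ℝ)) = -arcMid p₀ p₁) :
    U = endAnomaly a (axial (offset p₀ p₁)) ∧
    ∀ u : ℝ, (A * (cosh (u / 2) : ℝ) + B * (sinh (u / 2) : ℝ)) ^ 2 =
      arcMid p₀ p₁ * framePoint a (offset p₀ p₁) u := by
  have e1 := arcMid_mul_frameEnd hN
  have e2 := arcMid_mul_frameEnd_neg hN
  have hδ := offset_sq_lt_one hN
  have hm := norm_arcMid hN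
  set m := arcMid p₀ p₁
  set δ := offset p₀ p₁
  set c := axial δ
  have hc0 : 0 < c := axial_pos hδ
  have hc1 : c ≤ 1 := axial_le_one δ
  rw [← conj_frameEnd, frameEnd] at e2
  rw [frameEnd] at e1
  simp only [map_add, map_mul, Complex.conj_ofReal, Complex.conj_I] at e2
  have hC2 : ∀ u : ℝ, cosh (u / 2) ^ 2 = (cosh u + 1) / 2 ∧ sinh (u / 2) ^ 2 = (cosh u - 1) / 2 ∧
      2 * (sinh (u / 2) * cosh (u / 2)) = sinh u := fun u => by
    have h1 := Real.cosh_two_mul (u / 2)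
    have h2 := Real.cosh_sq (u / 2)
    have h3 := Real.sinh_two_mul (u / 2)
    rw [mul_div_cancel₀ u two_ne_zero] at h1 h3
    refine ⟨by linarith, by linarith, by linarith⟩
  obtain ⟨q1, q2, q3⟩ := hC2 U
  set X := cosh U
  have hX : 1 < X := one_lt_cosh.mpr hU.ne'
  -- Sum and difference of the two end values of `w` are `2 A cosh (U/2)` and `2 B sinh (U/2)`.
  -- Their squares involve only `p₀ + p₁ = 2 c m` and the product `-m`.
  have hA : A ^ 2 * ((X + 1 : ℝ) : ℂ) = ((c - 1 : ℝ) : ℂ) * m := by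
    have q1' : (((cosh (U / 2) : ℝ) : ℂ)) ^ 2 = ((X + 1 : ℝ) : ℂ) / 2 := by
      rw [← Complex.ofReal_pow, q1]; push_cast; ring
    have : 4 * (A ^ 2 * ((cosh (U / 2) : ℝ) : ℂ) ^ 2) = p₀ + p₁ + 2 * (-m) := by
      rw [← h₀, ← h₁, ← h₀₁]; ring
    rw [q1', ← e1, ← e2] at this
    push_cast at this ⊢
    linear_combination this / 2
  have hB : B ^ 2 * ((X - 1 : ℝ) : ℂ) = ((c + 1 : ℝ) : ℂ) * m := by
    have q2' : (((sinh (U / 2) : ℝ) : ℂ)) ^ 2 = ((X - 1 : ℝ) : ℂ) / 2 := by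
      rw [← Complex.ofReal_pow, q2]; push_cast; ring
    have : 4 * (B ^ 2 * ((sinh (U / 2) : ℝ) : ℂ) ^ 2) = p₀ + p₁ - 2 * (-m) := by
      rw [← h₀, ← h₁, ← h₀₁]; ring
    rw [q2', ← e1, ← e2] at this
    push_cast at this ⊢
    linear_combination this / 2
  have hABp : A * B * ((sinh U : ℝ) : ℂ) = δ * Complex.I * m := by
    have : 4 * (A * B * ((sinh (U / 2) * cosh (U / 2) : ℝ) : ℂ)) = p₁ - p₀ := by
      rw [← h₀, ← h₁]; push_cast; ring
    rw [← e1, ← e2] at this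
    rw [← q3]
    push_cast at this ⊢
    linear_combination this / 2
  have hnA : ‖A‖ ^ 2 * (X + 1) = 1 - c := by
    have := congrArg norm hA
    rw [norm_mul, norm_mul, norm_pow, hm, Complex.norm_real, Complex.norm_real,
      Real.norm_of_nonneg (by linarith : (0:ℝ) ≤ X + 1),
      Real.norm_of_nonpos (by linarith : c - 1 ≤ 0)] at this
    linarith
  have hnB : ‖B‖ ^ 2 * (X - 1) = 1 + c := by
    have := congrArg norm hB
    rw [norm_mul, norm_mul, norm_pow, hm, Complex.norm_real, Complex.norm_real,
      Real.norm_of_nonneg (by linarith : (0:ℝ) ≤ X - 1),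
      Real.norm_of_nonneg (by linarith : (0:ℝ) ≤ c + 1)] at this
    linarith
  -- Inserting the moduli of `A` and `B` into the energy relation gives the quadratic equation of
  -- `endCosh`.
  have hquad : a * X ^ 2 - c * X = a + 1 := by
    linear_combination (X + 1) / 2 * hnB - (X - 1) / 2 * hnA - (X ^ 2 - 1) / 2 * hAB
  have hXe : X = endCosh a c := eq_endCosh ha (by linarith) hquad
  have hUe : U = endAnomaly a c := by
    have h1 : cosh U = cosh (endAnomaly a c) := by
      rw [cosh_endAnomaly ha (neg_one_lt_axial δ)]; exact hXe
    have h2 := le_antisymm (cosh_le_cosh.mp h1.le) (cosh_le_cosh.mp h1.ge)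
    rwa [abs_of_pos hU, abs_of_pos (endAnomaly_pos ha (neg_one_lt_axial δ))] at h2
  refine ⟨hUe, fun u => ?_⟩
  obtain ⟨r1, r2, r3⟩ := hC2 u
  have hec : a * ecc a c = a * X - c := by
    have := endCosh_sub_ecc ha c
    rw [← hXe] at this; linarith
  have hsU : sinh U = endSinh a c := by rw [hUe, sinh_endAnomaly]
  have hs0 := (endSinh_pos ha (neg_one_lt_axial δ)).ne'
  have hX1 : ((X + 1 : ℝ) : ℂ) ≠ 0 := by exact_mod_cast (by linarith : X + 1 ≠ 0)
  have hX2 : ((X - 1 : ℝ) : ℂ) ≠ 0 := by exact_mod_cast (by linarith : X - 1 ≠ 0)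
  have hs0' : ((endSinh a c : ℝ) : ℂ) ≠ 0 := by exact_mod_cast hs0
  rw [hsU] at hABp
  have key : (A * (cosh (u / 2) : ℝ) + B * (sinh (u / 2) : ℝ)) ^ 2 =
      A ^ 2 * ((cosh u + 1) / 2 : ℝ) + B ^ 2 * ((cosh u - 1) / 2 : ℝ) + A * B * (sinh u : ℝ) := by
    rw [← r1, ← r2, ← r3]; push_cast; ring
  have hA' : A ^ 2 = ((c - 1 : ℝ) : ℂ) * m / ((X + 1 : ℝ) : ℂ) := eq_div_of_mul_eq hX1 hA
  have hB' : B ^ 2 = ((c + 1 : ℝ) : ℂ) * m / ((X - 1 : ℝ) : ℂ) := eq_div_of_mul_eq hX2 hB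
  have hAB' : A * B = δ * Complex.I * m / ((endSinh a c : ℝ) : ℂ) := eq_div_of_mul_eq hs0' hABp
  have hreal : (c - 1) / (X + 1) * ((cosh u + 1) / 2) + (c + 1) / (X - 1) * ((cosh u - 1) / 2) =
      a * (cosh u - ecc a c) := by
    rw [mul_sub, hec]
    have x1 : X + 1 ≠ 0 := by linarith
    have x2 : X - 1 ≠ 0 := by linarith
    field_simp
    linear_combination (-2 * cosh u + 2 * X) * hquad
  rw [key, framePoint, ← hreal, hA', hB', hAB']
  push_cast
  ring

/-- Uniqueness of the classical solution of index `±1`. -/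
theorem classicalArc_unique {E h μ T : ℝ} {p₀ p₁ : ℂ} {z : ℝ → ℂ} (ha : 0 < a) (hn : 0 < n)
    (hE : E + h = n ^ 2 * a ^ 2 / 2) (hμ : μ = n ^ 2 * a ^ 3) (hN : NonAntipodal p₀ p₁)
    (hz : IsClassicalArc E h μ p₀ p₁ T z)
    (hi : openCurveIndex z 0 T = 1 ∨ openCurveIndex z 0 T = -1) :
    T = duration a n (offset p₀ p₁) ∧
      EqOn z (fun s => arcMid p₀ p₁ * frameOrbit a n (offset p₀ p₁) s) (Icc 0 T) := by
  obtain ⟨hj, v, hv⟩ := hz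
  have hT := hj.pos
  have h0mem : (0 : ℝ) ∈ Icc 0 T := ⟨le_rfl, hT.le⟩
  have hTmem : T ∈ Icc 0 T := ⟨hT.le, le_rfl⟩
  have hδ := offset_sq_lt_one hN
  obtain ⟨w, u, A, B, U, hU, hu0, huT, hAB, hwT, hs⟩ := exists_leviCivita ha hn hE hμ hj hv
  rw [openCurveIndex_eq hN hj fun s hs => (hv s hs).2.1] at hi
  -- Index `±1` means that half the integral is `iθ ± iπ`. Both signs give the same factor `-1`, so
  -- the two indices lead to one boundary condition.
  have hexp : Complex.exp ((∫ s in (0 : ℝ)..T, v s / z s) / 2) = -frameEnd (offset p₀ p₁) := by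
    have hpi : (2 * π * Complex.I : ℂ) ≠ 0 := Complex.two_pi_I_ne_zero
    rw [← exp_arg_frameEnd hδ]
    rcases hi with hi | hi
    · rw [one_div, inv_mul_eq_iff_eq_mul₀ hpi] at hi
      rw [show (∫ s in (0 : ℝ)..T, v s / z s) / 2 =
        Complex.arg (frameEnd (offset p₀ p₁)) * Complex.I + π * Complex.I by
          linear_combination hi / 2, Complex.exp_add, Complex.exp_pi_mul_I, mul_neg_one]
    · rw [one_div, inv_mul_eq_iff_eq_mul₀ hpi] at hi
      rw [show (∫ s in (0 : ℝ)..T, v s / z s) / 2 =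
        Complex.arg (frameEnd (offset p₀ p₁)) * Complex.I - π * Complex.I by
          linear_combination hi / 2, Complex.exp_sub, Complex.exp_pi_mul_I, div_neg, div_one]
  have hw0' := (hs 0 h0mem).2.1
  have hwT' := (hs T hTmem).2.1
  rw [hu0, neg_div, cosh_neg, sinh_neg, Complex.ofReal_neg, mul_neg, ← sub_eq_add_neg] at hw0'
  rw [huT] at hwT'
  have h₀ : w 0 ^ 2 = p₀ := by rw [← (hs 0 h0mem).1, hj.left]
  have h₁ : w T ^ 2 = p₁ := by rw [← (hs T hTmem).1, hj.right]
  have h₀₁ : w 0 * w T = -arcMid p₀ p₁ := by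
    rw [hwT, hexp, ← mul_assoc, ← pow_two, h₀, mul_neg, neg_inj]
    nth_rewrite 1 [← arcMid_mul_frameEnd_neg hN]
    rw [mul_assoc, mul_comm (frameEnd _), frameEnd_mul_frameEnd_neg hδ, mul_one]
  rw [hw0'] at h₀ h₀₁
  rw [hwT'] at h₁ h₀₁
  obtain ⟨hUe, hfp⟩ := eq_framePoint_of_leviCivita ha hN hU hAB h₀ h₁ h₀₁
  have hzu : ∀ s ∈ Icc 0 T, z s = arcMid p₀ p₁ * framePoint a (offset p₀ p₁) (u s) := fun s hs' => by
    rw [(hs s hs').1, (hs s hs').2.1, hfp]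
  set δ := offset p₀ p₁
  -- Since `u' = n a / r` and `r = a (ε cosh u - 1)`, Kepler's function of `u` has constant speed
  -- `n`.
  have hk : ∀ s ∈ Icc 0 T, kepler (ecc a (axial δ)) (u s) = n * s - endMean a (axial δ) := by
    intro s hs'
    have := eq_left_of_hasDerivWithinAt_zero
      (g := fun s => kepler (ecc a (axial δ)) (u s) - n * s) hT (fun t ht => by
        have h1 := ((hasDerivAt_kepler (ecc a (axial δ)) (u t)).comp_hasDerivWithinAt t
          (hs t ht).2.2).sub ((hasDerivAt_id t).const_mul n).hasDerivWithinAt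
        refine h1.congr_deriv ?_
        have hne : ‖z t‖ ≠ 0 := norm_ne_zero_iff.mpr (hv t ht).1
        have hr : ‖z t‖ = a * (ecc a (axial δ) * cosh (u t) - 1) := by
          rw [hzu t ht, norm_mul, norm_arcMid hN, one_mul, norm_framePoint ha hδ]
        rw [hr] at hne ⊢
        have hne' := right_ne_zero_of_mul hne
        field_simp
        ring) s hs'
    simp only [hu0, kepler_neg, hUe, kepler_endAnomaly, mul_zero] at this
    linarith
  have huA : ∀ s ∈ Icc 0 T, anomaly a n δ s = u s := fun s hs' =>
    (anomaly_eq_iff ha hδ).mpr (hk s hs')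
  refine ⟨?_, fun s hs' => ?_⟩
  · have := hk T hTmem
    rw [huT, hUe, kepler_endAnomaly] at this
    rw [duration, eq_div_iff hn.ne']
    linarith
  · simp only [frameOrbit, huA s hs']
    exact hzu s hs'

/-- There is no classical solution with coinciding end points. -/
theorem not_isClassicalArc_self {E h μ T : ℝ} {p : ℂ} {z : ℝ → ℂ} (ha : 0 < a) (hn : 0 < n)
    (hE : E + h = n ^ 2 * a ^ 2 / 2) (hμ : μ = n ^ 2 * a ^ 3) :
    ¬ IsClassicalArc E h μ p p T z := by
  rintro ⟨hj, v, hv⟩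
  have hT := hj.pos
  have h0mem : (0 : ℝ) ∈ Icc 0 T := ⟨le_rfl, hT.le⟩
  have hTmem : T ∈ Icc 0 T := ⟨hT.le, le_rfl⟩
  obtain ⟨w, u, A, B, U, hU, hu0, huT, hAB, -, hs⟩ := exists_leviCivita ha hn hE hμ hj hv
  have hw0' := (hs 0 h0mem).2.1
  have hwT' := (hs T hTmem).2.1
  rw [hu0, neg_div, cosh_neg, sinh_neg, Complex.ofReal_neg, mul_neg, ← sub_eq_add_neg] at hw0'
  rw [huT] at hwT'
  have hsq : w T ^ 2 = w 0 ^ 2 := by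
    rw [← (hs 0 h0mem).1, hj.left, ← (hs T hTmem).1, hj.right]
  have hch : ((cosh (U / 2) : ℝ) : ℂ) ≠ 0 := by exact_mod_cast (cosh_pos _).ne'
  have hsh : ((sinh (U / 2) : ℝ) : ℂ) ≠ 0 := by
    exact_mod_cast (sinh_pos_iff.mpr (by positivity : 0 < U / 2)).ne'
  -- Equal end values of `w` force `B = 0`, against `‖B‖² - ‖A‖² = 2a > 0`. Opposite ones force `A =
  -- 0`, and then `w` vanishes where `u = 0`.
  rcases sq_eq_sq_iff_eq_or_eq_neg.mp hsq with h1 | h1 <;> rw [hw0', hwT'] at h1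
  · have h2 : B * ((sinh (U / 2) : ℝ) : ℂ) = 0 := by linear_combination h1 / 2
    have h3 : B = 0 := (mul_eq_zero.mp h2).resolve_right hsh
    rw [h3, norm_zero] at hAB
    nlinarith [sq_nonneg ‖A‖]
  · have h2 : A * ((cosh (U / 2) : ℝ) : ℂ) = 0 := by linear_combination h1 / 2
    have h3 : A = 0 := (mul_eq_zero.mp h2).resolve_right hch
    have huc : ContinuousOn u (Icc 0 T) := fun s hs' => (hs s hs').2.2.continuousWithinAt
    obtain ⟨s, hs', hus⟩ := intermediate_value_Icc hT.le huc
      (show (0 : ℝ) ∈ Icc (u 0) (u T) by rw [hu0, huT]; constructor <;> linarith)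
    refine (hv s hs').1 ?_
    rw [(hs s hs').1, (hs s hs').2.1, h3, hus]
    simp

/-! ### Uniqueness of ejection-collision solutions -/

/-- The inverse of the radial speed at distance `x` from the centre. -/
noncomputable def slowness (e μ x : ℝ) : ℝ := √(max x 0 / (2 * e * max x 0 + 2 * μ))

/-- The time of free fall from distance `r` to the centre. -/
noncomputable def fallTime (e μ r : ℝ) : ℝ := ∫ x in (0 : ℝ)..r, slowness e μ x

section FallTime

variable {e μ : ℝ}

/-- Truncation at `0` keeps the denominator at least `2μ`, so the integrand of the fall time is
continuous up to the centre and beyond. -/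
theorem continuous_slowness (he : 0 < e) (hμ : 0 < μ) : Continuous (slowness e μ) := by
  unfold slowness
  refine Continuous.sqrt (Continuous.div (by fun_prop) (by fun_prop) fun x => ?_)
  have := le_max_right x 0
  positivity

theorem hasDerivAt_fallTime (he : 0 < e) (hμ : 0 < μ) (r : ℝ) :
    HasDerivAt (fallTime e μ) (slowness e μ r) r :=
  (continuous_slowness he hμ).integral_hasStrictDerivAt 0 r |>.hasDerivAt

theorem slowness_pos (he : 0 < e) (hμ : 0 < μ) {x : ℝ} (hx : 0 < x) : 0 < slowness e μ x := by
  rw [slowness, max_eq_left hx.le]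
  positivity

theorem slowness_sq (he : 0 < e) (hμ : 0 < μ) {x : ℝ} (hx : 0 < x) :
    slowness e μ x ^ 2 * (2 * e + 2 * μ / x) = 1 := by
  rw [slowness, max_eq_left hx.le, sq_sqrt (by positivity)]
  field_simp

theorem strictMonoOn_fallTime (he : 0 < e) (hμ : 0 < μ) : StrictMonoOn (fallTime e μ) (Ici 0) := by
  refine strictMonoOn_of_deriv_pos (convex_Ici 0)
    (fun r _ => (hasDerivAt_fallTime he hμ r).continuousAt.continuousWithinAt) fun r hr => ?_
  rw [interior_Ici] at hr
  rw [(hasDerivAt_fallTime he hμ r).deriv]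
  exact slowness_pos he hμ hr

theorem fallTime_zero (e μ : ℝ) : fallTime e μ 0 = 0 := by simp [fallTime]

end FallTime

theorem eq_left_of_hasDerivWithinAt_zero_Ico {F : Type*} [NormedAddCommGroup F] [NormedSpace ℝ F]
    {g : ℝ → F} {c : ℝ} (h : ∀ s ∈ Ico 0 c, HasDerivWithinAt g 0 (Ico 0 c) s) :
    ∀ s ∈ Ico 0 c, g s = g 0 := fun s hs =>
  eq_left_of_hasDerivWithinAt_zero (T := (s + c) / 2) (by linarith [hs.1, hs.2])
    (fun t ht => (h t ⟨ht.1, by linarith [ht.2, hs.2]⟩).mono fun x hx =>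
      ⟨hx.1, by linarith [hx.2, hs.2]⟩) s ⟨hs.1, by linarith [hs.2]⟩

theorem re_sq_add_im_sq_conj_mul (z w : ℂ) :
    ((starRingEnd ℂ) z * w).re ^ 2 + ((starRingEnd ℂ) z * w).im ^ 2 = ‖z‖ ^ 2 * ‖w‖ ^ 2 := by
  simp only [Complex.sq_norm, Complex.normSq_apply, Complex.mul_re, Complex.mul_im,
    Complex.conj_re, Complex.conj_im]
  ring

theorem real_inner_eq_re (z w : ℂ) : inner ℝ z w = ((starRingEnd ℂ) z * w).re := by
  rw [Complex.inner, mul_comm]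

/-- A solution falling into the origin in finite time falls along a ray. -/
theorem radial_of_collision {e μ c : ℝ} {z v : ℝ → ℂ} (he : 0 < e) (hμ : 0 < μ) (hc : 0 < c)
    (hzc : ContinuousOn z (Icc 0 c)) (hz0 : ‖z 0‖ = 1) (hzero : z c = 0)
    (hv : ∀ s ∈ Ico 0 c, z s ≠ 0 ∧ HasDerivWithinAt z (v s) (Ico 0 c) s ∧
      HasDerivWithinAt v (-(μ / ‖z s‖ ^ 3) • z s) (Ico 0 c) s ∧
      ‖v s‖ ^ 2 = 2 * e + 2 * μ / ‖z s‖) :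
    c = fallTime e μ 1 ∧
      ∀ s ∈ Icc 0 c, z s = ‖z s‖ * z 0 ∧ fallTime e μ ‖z s‖ = fallTime e μ 1 - s := by
  have h0mem : (0 : ℝ) ∈ Ico 0 c := ⟨le_rfl, hc⟩
  have hcmem : c ∈ Icc 0 c := ⟨hc.le, le_rfl⟩
  have hr : ∀ s ∈ Ico 0 c, 0 < ‖z s‖ := fun s hs => norm_pos_iff.mpr (hv s hs).1
  have hlim : Tendsto (fun s => ‖z s‖) (𝓝[<] c) (𝓝 0) := by
    have h1 : Tendsto z (𝓝[Icc 0 c] c) (𝓝 (z c)) := hzc c hcmem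
    rw [hzero] at h1
    have h2 := h1.norm.mono_left (nhdsWithin_mono c Ico_subset_Icc_self)
    rwa [norm_zero, nhdsWithin_Ico_eq_nhdsLT hc] at h2
  have hIco : ∀ᶠ s in 𝓝[<] c, s ∈ Ico 0 c := Ico_mem_nhdsLT hc
  -- Angular momentum is constant, and its square is at most `r² |v|² = 2 e r² + 2 μ r`, which tends
  -- to `0` at the collision.
  have hL : ∀ s ∈ Ico 0 c, ((starRingEnd ℂ) (z s) * v s).im = 0 := by
    have hconst := eq_left_of_hasDerivWithinAt_zero_Ico
      (g := fun s => ((starRingEnd ℂ) (z s) * v s).im) (c := c) fun s hs => by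
        have h1 : HasDerivWithinAt (fun s => (starRingEnd ℂ) (z s)) ((starRingEnd ℂ) (v s))
            (Ico 0 c) s := Complex.conjCLE.hasFDerivAt.comp_hasDerivWithinAt s (hv s hs).2.1
        have h2 := Complex.imCLM.hasFDerivAt.comp_hasDerivWithinAt s
          (h1.fun_mul (hv s hs).2.2.1)
        refine h2.congr_deriv ?_
        simp only [Complex.imCLM_apply, Complex.add_im, Complex.mul_im, Complex.conj_re,
          Complex.conj_im, Complex.smul_re, Complex.smul_im, smul_eq_mul]
        ring
    have h0 : ((starRingEnd ℂ) (z 0) * v 0).im ^ 2 ≤ 0 := by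
      have h1 : Tendsto (fun s => 2 * e * ‖z s‖ ^ 2 + 2 * μ * ‖z s‖) (𝓝[<] c) (𝓝 0) := by
        simpa using ((hlim.pow 2).const_mul (2 * e)).add (hlim.const_mul (2 * μ))
      refine ge_of_tendsto h1 ?_
      filter_upwards [hIco] with s hs
      rw [← hconst s hs]
      have h2 := re_sq_add_im_sq_conj_mul (z s) (v s)
      have h3 := hr s hs
      have h4 : ‖z s‖ ^ 2 * (2 * e + 2 * μ / ‖z s‖) = 2 * e * ‖z s‖ ^ 2 + 2 * μ * ‖z s‖ := by
        field_simp
      rw [(hv s hs).2.2.2, h4] at h2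
      linarith [sq_nonneg ((starRingEnd ℂ) (z s) * v s).re]
    intro s hs
    rw [hconst s hs]
    nlinarith
  have hrd : ∀ s ∈ Ico 0 c, HasDerivWithinAt (fun s => ‖z s‖)
      (((starRingEnd ℂ) (z s) * v s).re / ‖z s‖) (Ico 0 c) s := fun s hs => by
    have h1 := ((hv s hs).2.1.norm_sq).sqrt (pow_pos (hr s hs) 2).ne'
    simp only [sqrt_sq (norm_nonneg _)] at h1
    refine h1.congr_deriv ?_
    rw [real_inner_eq_re]
    have := (hr s hs).ne'
    field_simp
  have hdir : ∀ s ∈ Ico 0 c, z s = ‖z s‖ * z 0 := fun s hs => by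
    have h1 := eq_left_of_hasDerivWithinAt_zero_Ico (g := fun s => z s / ((‖z s‖ : ℝ) : ℂ))
      (c := c) (fun s hs => by
        have hne : ((‖z s‖ : ℝ) : ℂ) ≠ 0 := by exact_mod_cast (hr s hs).ne'
        have h1 := (hv s hs).2.1.fun_div (hrd s hs).ofReal_comp hne
        refine h1.congr_deriv ?_
        have h2 : (((((starRingEnd ℂ) (z s) * v s).re : ℝ)) : ℂ) = (starRingEnd ℂ) (z s) * v s := by
          apply Complex.ext
          · simp
          · rw [Complex.ofReal_im, hL s hs]
        have h3 : z s * (starRingEnd ℂ) (z s) = ((‖z s‖ : ℝ) : ℂ) ^ 2 := by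
          rw [Complex.mul_conj, Complex.normSq_eq_norm_sq]; push_cast; ring
        rw [Complex.ofReal_div, h2, div_eq_zero_iff]
        left
        field_simp
        linear_combination (-v s) * h3) s hs
    simp only [hz0, Complex.ofReal_one, div_one] at h1
    have hne : ((‖z s‖ : ℝ) : ℂ) ≠ 0 := by exact_mod_cast (hr s hs).ne'
    rw [div_eq_iff hne] at h1
    rw [mul_comm]; exact h1
  set ρ : ℝ → ℝ := fun s => ((starRingEnd ℂ) (z s) * v s).re / ‖z s‖ with hρ
  have hρsq : ∀ s ∈ Ico 0 c, ρ s ^ 2 = 2 * e + 2 * μ / ‖z s‖ := fun s hs => by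
    have h2 := re_sq_add_im_sq_conj_mul (z s) (v s)
    rw [hL s hs, (hv s hs).2.2.2] at h2
    have := hr s hs
    simp only [hρ]
    rw [div_pow, div_eq_iff (by positivity)]
    linarith
  have hρne : ∀ s ∈ Ico 0 c, ρ s ≠ 0 := fun s hs h0 => by
    have h1 := hρsq s hs
    have := hr s hs
    rw [h0] at h1
    have : 0 < 2 * e + 2 * μ / ‖z s‖ := by positivity
    linarith
  have hρc : ContinuousOn ρ (Ico 0 c) := by
    have c1 : ContinuousOn z (Ico 0 c) := hzc.mono Ico_subset_Icc_self
    have c2 : ContinuousOn v (Ico 0 c) := fun s hs => (hv s hs).2.2.1.continuousWithinAt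
    exact (Complex.continuous_re.comp_continuousOn
      ((Complex.continuous_conj.comp_continuousOn c1).mul c2)).div c1.norm fun s hs => (hr s hs).ne'
  -- The radial speed never vanishes. Once positive it would stay so, and the distance could not
  -- decrease to `0` at time `c`.
  have hρneg : ∀ s ∈ Ico 0 c, ρ s < 0 := by
    intro s₀ hs₀
    by_contra hcon
    have hpos₀ : 0 < ρ s₀ := lt_of_le_of_ne (not_lt.mp hcon) (hρne s₀ hs₀).symm
    have hpos : ∀ s ∈ Ico s₀ c, 0 < ρ s := by
      intro s₁ hs₁
      by_contra hcon₁
      have hsub : Icc s₀ s₁ ⊆ Ico 0 c := fun x hx => ⟨hs₀.1.trans hx.1, hx.2.trans_lt hs₁.2⟩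
      obtain ⟨x, hx, hx0⟩ := intermediate_value_Icc' hs₁.1 (hρc.mono hsub)
        ⟨not_lt.mp hcon₁, hpos₀.le⟩
      exact hρne x (hsub hx) hx0
    have hmono : MonotoneOn (fun s => ‖z s‖) (Icc s₀ c) := by
      have hd : ∀ s ∈ Ioo s₀ c, HasDerivAt (fun s => ‖z s‖) (ρ s) s := fun s hs =>
        (hrd s ⟨hs₀.1.trans hs.1.le, hs.2⟩).hasDerivAt
          (Ico_mem_nhds (hs₀.1.trans_lt hs.1) hs.2)
      refine monotoneOn_of_deriv_nonneg (convex_Icc s₀ c)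
        (hzc.norm.mono (Icc_subset_Icc_left hs₀.1)) ?_ ?_
      · rw [interior_Icc]
        exact fun s hs => (hd s hs).differentiableAt.differentiableWithinAt
      · rw [interior_Icc]
        intro s hs
        rw [(hd s hs).deriv]
        exact (hpos s ⟨hs.1.le, hs.2⟩).le
    have := hmono ⟨le_rfl, hs₀.2.le⟩ ⟨hs₀.2.le, le_rfl⟩ hs₀.2.le
    simp only [hzero, norm_zero] at this
    exact (hr s₀ hs₀).not_ge this
  -- Separation of variables: slowness times radial speed is `-1`.
  have hΦ : ∀ s ∈ Ico 0 c, fallTime e μ ‖z s‖ + s = fallTime e μ 1 := fun s hs => by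
    have h1 := eq_left_of_hasDerivWithinAt_zero_Ico (g := fun s => fallTime e μ ‖z s‖ + s) (c := c)
      (fun s hs => by
        have h1 := ((hasDerivAt_fallTime he hμ ‖z s‖).comp_hasDerivWithinAt s (hrd s hs)).add
          (hasDerivAt_id s).hasDerivWithinAt
        refine h1.congr_deriv ?_
        have h2 := slowness_sq he hμ (hr s hs)
        have h3 := slowness_pos he hμ (hr s hs)
        rw [← hρsq s hs, ← mul_pow] at h2
        have h4 : slowness e μ ‖z s‖ * ρ s < 0 := mul_neg_of_pos_of_neg h3 (hρneg s hs)
        have h5 : slowness e μ ‖z s‖ * ρ s = -1 := by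
          rcases sq_eq_sq_iff_eq_or_eq_neg.mp (h2.trans (one_pow 2).symm) with h | h <;> linarith
        rw [h5]; norm_num) s hs
    simpa [hz0] using h1
  have hΦc : c = fallTime e μ 1 := by
    have h1 : Tendsto (fun s => fallTime e μ ‖z s‖ + s) (𝓝[<] c) (𝓝 (fallTime e μ 0 + c)) :=
      ((hasDerivAt_fallTime he hμ 0).continuousAt.tendsto.comp hlim).add
        (tendsto_id.mono_left nhdsWithin_le_nhds)
    have h2 : Tendsto (fun s => fallTime e μ ‖z s‖ + s) (𝓝[<] c) (𝓝 (fallTime e μ 1)) :=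
      tendsto_const_nhds.congr' (hIco.mono fun s hs => (hΦ s hs).symm)
    have := tendsto_nhds_unique h1 h2
    rwa [fallTime_zero, zero_add] at this
  refine ⟨hΦc, fun s hs => ?_⟩
  rcases eq_or_lt_of_le hs.2 with h | h
  · rw [h, hzero, norm_zero, fallTime_zero, ← hΦc]; simp
  · exact ⟨hdir s ⟨hs.1, h⟩, by linarith [hΦ s ⟨hs.1, h⟩]⟩

/-- The part after the collision, run backwards from time `T`, is again a fall from the unit circle,
so `radial_of_collision` applies to both halves and both last equally long. -/
theorem ejectionCollisionArc_radial {E h μ T : ℝ} {p : ℂ} {z : ℝ → ℂ} (he : 0 < E + h)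
    (hμ : 0 < μ) (hp : ‖p‖ = 1) (hz : IsEjectionCollisionArc E h μ p p T z) :
    T = 2 * fallTime (E + h) μ 1 ∧ ∀ s ∈ Icc 0 T, z s = ‖z s‖ * p ∧
      fallTime (E + h) μ ‖z s‖ = |s - fallTime (E + h) μ 1| := by
  obtain ⟨hj, hcont, c, hc, hzc, ⟨v, hv⟩, -⟩ := hz
  have hgrad : ∀ s ∈ Icc 0 T \ {c}, gradient (innerPotential E h μ) (z s) =
      -(μ / ‖z s‖ ^ 3) • z s := fun s hs =>
    (hasGradientAt_innerPotential E h μ (hv s hs).1).gradient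
  have hen : ∀ s ∈ Icc 0 T \ {c}, ‖v s‖ ^ 2 = 2 * (E + h) + 2 * μ / ‖z s‖ := fun s hs => by
    have := (hv s hs).2.2.2
    rw [innerPotential] at this
    linear_combination 2 * this
  have hsub1 : Ico 0 c ⊆ Icc 0 T \ {c} := fun s hs => ⟨⟨hs.1, (hs.2.trans hc.2).le⟩, hs.2.ne⟩
  obtain ⟨hc1, h1⟩ := radial_of_collision he hμ hc.1 (hcont.mono (Icc_subset_Icc_right hc.2.le))
    (by rw [hj.left, hp]) hzc fun s hs => ⟨(hv s (hsub1 hs)).1,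
      (hv s (hsub1 hs)).2.1.mono hsub1, by
        rw [← hgrad s (hsub1 hs)]; exact (hv s (hsub1 hs)).2.2.1.mono hsub1, hen s (hsub1 hs)⟩
  have hsub2 : ∀ s ∈ Ico 0 (T - c), T - s ∈ Icc 0 T \ {c} := fun s hs =>
    ⟨⟨by linarith [hs.2, hc.1], by linarith [hs.1]⟩, fun h => by
      have : T - s = c := h
      linarith [hs.2]⟩
  have hrev : ∀ s ∈ Ico 0 (T - c), HasDerivWithinAt (fun s => T - s) (-1) (Ico 0 (T - c)) s :=
    fun s _ => ((hasDerivAt_id s).const_sub T).hasDerivWithinAt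
  obtain ⟨hc2, h2⟩ := radial_of_collision (z := fun s => z (T - s)) (v := fun s => -v (T - s))
    he hμ (sub_pos.mpr hc.2)
    (hcont.comp (by fun_prop) fun s hs => ⟨by linarith [hs.2, hc.1], by linarith [hs.1]⟩)
    (by rw [sub_zero, hj.right, hp]) (by rw [sub_sub_cancel, hzc]) fun s hs =>
      ⟨(hv _ (hsub2 s hs)).1, by
        refine ((hv _ (hsub2 s hs)).2.1.scomp s (hrev s hs) hsub2).congr_deriv ?_
        rw [neg_one_smul], by
        refine ((hv _ (hsub2 s hs)).2.2.1.scomp s (hrev s hs) hsub2).neg.congr_deriv ?_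
        rw [hgrad _ (hsub2 s hs), neg_one_smul, neg_neg], by rw [norm_neg]; exact hen _ (hsub2 s hs)⟩
  refine ⟨by linarith, fun s hs => ?_⟩
  rcases le_total s c with h | h
  · have := h1 s ⟨hs.1, h⟩
    rw [hj.left] at this
    refine ⟨this.1, ?_⟩
    rw [this.2, abs_of_nonpos (by linarith)]
    ring
  · have := h2 (T - s) ⟨by linarith [hs.2], by linarith⟩
    simp only [sub_sub_cancel, sub_zero, hj.right] at this
    refine ⟨this.1, ?_⟩
    rw [this.2, abs_of_nonneg (by linarith)]
    linarith

/-- Uniqueness of the ejection-collision solution. -/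
theorem ejectionCollisionArc_unique {E h μ T T' : ℝ} {p : ℂ} {z z' : ℝ → ℂ} (he : 0 < E + h)
    (hμ : 0 < μ) (hp : ‖p‖ = 1) (hz : IsEjectionCollisionArc E h μ p p T z)
    (hz' : IsEjectionCollisionArc E h μ p p T' z') : T' = T ∧ EqOn z' z (Icc 0 T') := by
  obtain ⟨h1, h2⟩ := ejectionCollisionArc_radial he hμ hp hz
  obtain ⟨h1', h2'⟩ := ejectionCollisionArc_radial he hμ hp hz'
  have hT : T' = T := by rw [h1, h1']
  refine ⟨hT, fun s hs => ?_⟩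
  have a1 := h2 s (hT ▸ hs)
  have a2 := h2' s hs
  have hn : ‖z' s‖ = ‖z s‖ := (strictMonoOn_fallTime he hμ).injOn (norm_nonneg _) (norm_nonneg _)
    (a2.2.trans a1.2.symm)
  rw [a1.1, a2.1, hn]

/-! ### Dependence on the end points -/

theorem contDiff_circlePoint : ContDiff ℝ 1 circlePoint := by
  have h : ContDiff ℝ 1 (fun t : ℝ => (t : ℂ)) := Complex.ofRealCLM.contDiff
  exact (Complex.contDiff_exp (𝕜 := ℝ)).comp (h.mul contDiff_const)

theorem contDiffAt_arcMid {p q : ℂ} (h : NonAntipodal p q) :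
    ContDiffAt ℝ 1 (fun x : ℂ × ℂ => arcMid x.1 x.2) (p, q) := by
  have h0 : p + q ≠ 0 := norm_pos_iff.mp (norm_add_pos h)
  have h1 : ContDiffAt ℝ 1 (fun x : ℂ × ℂ => x.1 + x.2) (p, q) := contDiffAt_fst.add contDiffAt_snd
  have h2 : ContDiffAt ℝ 1 (fun x : ℂ × ℂ => ((‖x.1 + x.2‖ : ℝ) : ℂ)) (p, q) :=
    Complex.ofRealCLM.contDiff.contDiffAt.comp (p, q) (h1.norm ℝ h0)
  refine (h1.mul (h2.inv (by exact_mod_cast (norm_add_pos h).ne'))).congr_of_eventuallyEq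
    (Eventually.of_forall fun x => ?_)
  exact div_eq_mul_inv _ _

theorem contDiffAt_offset {p q : ℂ} (h : NonAntipodal p q) :
    ContDiffAt ℝ 1 (fun x : ℂ × ℂ => offset x.1 x.2) (p, q) := by
  have h0 : p + q ≠ 0 := norm_pos_iff.mp (norm_add_pos h)
  have h1 : ContDiffAt ℝ 1 (fun x : ℂ × ℂ => x.1 + x.2) (p, q) := contDiffAt_fst.add contDiffAt_snd
  have h2 : ContDiff ℝ 1 (fun x : ℂ × ℂ => (x.2 * (starRingEnd ℂ) x.1).im) :=
    Complex.imCLM.contDiff.comp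
      (contDiff_snd.mul (Complex.conjCLE.contDiff.comp contDiff_fst))
  exact h2.contDiffAt.div (h1.norm ℝ h0) (norm_add_pos h).ne'

theorem contDiffAt_duration {a n δ : ℝ} (ha : 0 < a) (hδ : δ ^ 2 < 1) :
    ContDiffAt ℝ 1 (duration a n) δ := by
  have h1 : ContDiffAt ℝ 1 (fun δ => endMean a (axial δ)) δ :=
    ContDiffAt.comp (g := endMean a) δ (contDiffAt_endMean ha (neg_one_lt_axial δ))
      (contDiffAt_axial hδ)
  exact (contDiffAt_const.mul h1).div_const n

theorem contDiffAt_circlePoint_pair (ξ : ℝ × ℝ) :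
    ContDiffAt ℝ 1 (fun ξ : ℝ × ℝ => (circlePoint ξ.1, circlePoint ξ.2)) ξ :=
  ((contDiff_circlePoint.comp contDiff_fst).prodMk
    (contDiff_circlePoint.comp contDiff_snd)).contDiffAt

theorem contDiffAt_offset_circlePoint {ξ : ℝ × ℝ}
    (h : NonAntipodal (circlePoint ξ.1) (circlePoint ξ.2)) :
    ContDiffAt ℝ 1 (fun ξ : ℝ × ℝ => offset (circlePoint ξ.1) (circlePoint ξ.2)) ξ :=
  ContDiffAt.comp (g := fun x : ℂ × ℂ => offset x.1 x.2) ξ (contDiffAt_offset h)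
    (contDiffAt_circlePoint_pair ξ)

theorem contDiffAt_arcMid_circlePoint {ξ : ℝ × ℝ}
    (h : NonAntipodal (circlePoint ξ.1) (circlePoint ξ.2)) :
    ContDiffAt ℝ 1 (fun ξ : ℝ × ℝ => arcMid (circlePoint ξ.1) (circlePoint ξ.2)) ξ :=
  ContDiffAt.comp (g := fun x : ℂ × ℂ => arcMid x.1 x.2) ξ (contDiffAt_arcMid h)
    (contDiffAt_circlePoint_pair ξ)

theorem tendsto_orbit {a n : ℝ} (ha : 0 < a) {p₀ : ℂ} (hp : ‖p₀‖ = 1) :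
    Tendsto (fun p₁ => duration a n (offset p₀ p₁)) (𝓝[Metric.sphere 0 1] p₀)
      (𝓝 (duration a n (offset p₀ p₀))) ∧
    TendstoUniformlyOn
      (fun p₁ t => arcMid p₀ p₁ * frameOrbit a n (offset p₀ p₁) (t * duration a n (offset p₀ p₁)))
      (fun t => arcMid p₀ p₀ * frameOrbit a n (offset p₀ p₀) (t * duration a n (offset p₀ p₀)))
      (𝓝[Metric.sphere 0 1] p₀) (Icc 0 1) := by
  have hself := nonAntipodal_self hp
  have hpair : ∀ p : ℂ, Continuous fun q : ℂ => (p, q) := fun p => by fun_prop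
  have hoff : ∀ q, NonAntipodal p₀ q → ContinuousAt (fun q => offset p₀ q) q := fun q hq =>
    ContinuousAt.comp (g := fun x : ℂ × ℂ => offset x.1 x.2) (contDiffAt_offset hq).continuousAt
      (hpair p₀).continuousAt
  have hmid : ∀ q, NonAntipodal p₀ q → ContinuousAt (fun q => arcMid p₀ q) q := fun q hq =>
    ContinuousAt.comp (g := fun x : ℂ × ℂ => arcMid x.1 x.2) (contDiffAt_arcMid hq).continuousAt
      (hpair p₀).continuousAt
  have hdur : ∀ q, NonAntipodal p₀ q → ContinuousAt (fun q => duration a n (offset p₀ q)) q :=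
    fun q hq => ContinuousAt.comp (g := duration a n)
      (contDiffAt_duration ha (offset_sq_lt_one hq)).continuousAt (hoff q hq)
  refine ⟨(hdur p₀ hself).continuousWithinAt, ?_⟩
  have hcont : ContinuousOn (Function.uncurry fun p₁ t =>
      arcMid p₀ p₁ * frameOrbit a n (offset p₀ p₁) (t * duration a n (offset p₀ p₁)))
      ({q : ℂ | NonAntipodal p₀ q} ×ˢ Icc (0 : ℝ) 1) := by
    rintro ⟨q, t⟩ ⟨hq, -⟩
    refine ContinuousAt.continuousWithinAt ?_
    have hq' : NonAntipodal p₀ q := hq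
    have h1 : ContinuousAt (fun x : ℂ × ℝ => offset p₀ x.1) (q, t) :=
      ContinuousAt.comp (g := fun q => offset p₀ q) (hoff q hq') continuousAt_fst
    have h2 : ContinuousAt (fun x : ℂ × ℝ => arcMid p₀ x.1) (q, t) :=
      ContinuousAt.comp (g := fun q => arcMid p₀ q) (hmid q hq') continuousAt_fst
    have h3 : ContinuousAt (fun x : ℂ × ℝ => duration a n (offset p₀ x.1)) (q, t) :=
      ContinuousAt.comp (g := fun q => duration a n (offset p₀ q)) (hdur q hq') continuousAt_fst
    have h4 : ContinuousAt (fun x : ℂ × ℝ => x.2 * duration a n (offset p₀ x.1)) (q, t) :=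
      continuousAt_snd.mul h3
    exact h2.mul (tendsto_frameOrbit ha h1 h4 (offset_sq_lt_one hq'))
  intro V hV
  -- Joint continuity, collision included, becomes uniform in `t` because the rescaled time interval
  -- is compact.
  obtain ⟨W, hW, h⟩ := isCompact_Icc.mem_uniformity_of_prod hcont
    (show p₀ ∈ {q : ℂ | NonAntipodal p₀ q} from hself) (symm_le_uniformity hV)
  have hsub : 𝓝[Metric.sphere 0 1] p₀ ≤ 𝓝[{q : ℂ | NonAntipodal p₀ q}] p₀ := by
    refine nhdsWithin_le_iff.mpr ?_
    have h2 : ∀ᶠ q in 𝓝 p₀, ‖p₀ - q‖ < 2 :=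
      (continuous_const.sub continuous_id).norm.continuousAt.eventually
        (gt_mem_nhds (by simp))
    filter_upwards [self_mem_nhdsWithin, h2.filter_mono nhdsWithin_le_nhds] with q hq hq2
    exact ⟨hp, by simpa using hq, hq2⟩
  filter_upwards [hsub hW] with q hq t ht using h q hq t ht

/-! ### The transversality constants -/

/-- The semi-axis of the orbits with energy `e`. -/
noncomputable def semiAxis (e μ : ℝ) : ℝ := μ / (2 * e)

/-- The transversality constant that is uniform in the end points. -/
noncomputable def minCos (e μ : ℝ) : ℝ := √((1 + semiAxis e μ) / (1 + 2 * semiAxis e μ))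

/-- The transversality constant for end points at distance `d`. -/
noncomputable def cosBound (e μ d : ℝ) : ℝ :=
  if d = 0 then minCos e μ else max (minCos e μ) (sqCosEnd (semiAxis e μ) √(1 - d ^ 2 / 4))

/-- Immediate from `ε² < 1 + 1/a`. The bound does not involve the end points and tends to `1` as `a
→ 0`, that is, for large energy. -/
theorem sqCosEnd_bounds {a c : ℝ} (ha : 0 < a) (hc0 : 0 < c) (hc1 : c ≤ 1) :
    (1 + a) / (1 + 2 * a) < sqCosEnd a c := by
  have h := (ecc_mem ha hc0 hc1).2
  have h1 : a ^ 2 * (ecc a c ^ 2 - 1) < a := by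
    have : a ^ 2 * (ecc a c ^ 2 - 1) < a ^ 2 * (1 / a) := by gcongr; linarith
    calc _ < _ := this
      _ = a := by field_simp
  rw [sqCosEnd, lt_sub_iff_add_lt, ← add_div, div_lt_one (by positivity)]
  linarith

theorem sqCosEnd_lt_one {a c : ℝ} (ha : 0 < a) (hc0 : 0 < c) (hc1 : c < 1) : sqCosEnd a c < 1 := by
  have h := one_lt_ecc ha hc0 hc1
  have : 0 < a ^ 2 * (ecc a c ^ 2 - 1) / (1 + 2 * a) := by
    have : 0 < ecc a c ^ 2 - 1 := by nlinarith
    positivity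
  rw [sqCosEnd]; linarith

theorem semiAxis_pos {e μ : ℝ} (he : 0 < e) (hμ : 0 < μ) : 0 < semiAxis e μ := by
  unfold semiAxis; positivity

theorem minCos_pos {e μ : ℝ} (he : 0 < e) (hμ : 0 < μ) : 0 < minCos e μ := by
  have := semiAxis_pos he hμ
  unfold minCos; positivity

theorem minCos_lt_one {e μ : ℝ} (he : 0 < e) (hμ : 0 < μ) : minCos e μ < 1 := by
  have := semiAxis_pos he hμ
  rw [minCos, sqrt_lt' one_pos, one_pow, div_lt_one (by positivity)]
  linarith

theorem chord_mem {d : ℝ} (h0 : 0 ≤ d) (h2 : d < 2) :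
    0 < √(1 - d ^ 2 / 4) ∧ √(1 - d ^ 2 / 4) ≤ 1 ∧ (d ≠ 0 → √(1 - d ^ 2 / 4) < 1) := by
  refine ⟨sqrt_pos.mpr (by nlinarith), sqrt_le_one.mpr (by nlinarith), fun hd => ?_⟩
  rw [sqrt_lt' one_pos]
  have : 0 < d ^ 2 := by positivity
  linarith

theorem minCos_le_cosBound (e μ d : ℝ) : minCos e μ ≤ cosBound e μ d := by
  unfold cosBound
  split_ifs
  exacts [le_rfl, le_max_left _ _]

theorem cosBound_lt_one {e μ d : ℝ} (he : 0 < e) (hμ : 0 < μ) (h0 : 0 ≤ d) (h2 : d < 2) :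
    cosBound e μ d < 1 := by
  obtain ⟨c0, -, c1⟩ := chord_mem h0 h2
  unfold cosBound
  split_ifs with h
  exacts [minCos_lt_one he hμ, max_lt (minCos_lt_one he hμ)
    (sqCosEnd_lt_one (semiAxis_pos he hμ) c0 (c1 h))]

/-- For `d ≠ 0` the squared cosine lies strictly between `0` and `1`, so it is strictly below its
root; taking it as the bound makes the inequality strict. For `d = 0` it equals `1`, and only the
uniform constant remains strictly below. -/
theorem cosBound_lt {e μ d : ℝ} (he : 0 < e) (hμ : 0 < μ) (h0 : 0 ≤ d) (h2 : d < 2) :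
    cosBound e μ d < √(sqCosEnd (semiAxis e μ) √(1 - d ^ 2 / 4)) := by
  obtain ⟨c0, c1, c2⟩ := chord_mem h0 h2
  have ha := semiAxis_pos he hμ
  have hb := sqCosEnd_bounds ha c0 c1
  have hlt : minCos e μ < √(sqCosEnd (semiAxis e μ) √(1 - d ^ 2 / 4)) :=
    sqrt_lt_sqrt (by positivity) hb
  unfold cosBound
  split_ifs with h
  · exact hlt
  · refine max_lt hlt ?_
    have h1 := sqCosEnd_lt_one ha c0 (c2 h)
    have hp : 0 < sqCosEnd (semiAxis e μ) √(1 - d ^ 2 / 4) := lt_trans (by positivity) hb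
    exact lt_sqrt_of_sq_lt (by nlinarith)

theorem tendsto_cosBound {e μ : ℝ} (he : 0 < e) (hμ : 0 < μ) :
    Tendsto (fun d => cosBound e μ d) (𝓝[>] 0) (𝓝 1) := by
  have ha := semiAxis_pos he hμ
  have h1 : ContinuousAt (fun d : ℝ => sqCosEnd (semiAxis e μ) √(1 - d ^ 2 / 4)) 0 := by
    have h2 : ContinuousAt (fun d : ℝ => √(1 - d ^ 2 / 4)) 0 := by fun_prop
    have h3 : ContinuousAt (fun d : ℝ => ecc (semiAxis e μ) √(1 - d ^ 2 / 4)) 0 :=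
      ContinuousAt.comp (g := ecc (semiAxis e μ)) (contDiffAt_ecc ha _).continuousAt h2
    exact continuousAt_const.sub ((continuousAt_const.mul ((h3.pow 2).sub continuousAt_const)).div_const _)
  have h4 : sqCosEnd (semiAxis e μ) √(1 - (0:ℝ) ^ 2 / 4) = 1 := by
    simp [sqCosEnd, ecc_one ha]
  have h5 : Tendsto (fun d : ℝ => max (minCos e μ) (sqCosEnd (semiAxis e μ) √(1 - d ^ 2 / 4)))
      (𝓝[>] 0) (𝓝 1) := by
    have := (tendsto_const_nhds (x := minCos e μ)).max
      (h1.tendsto.mono_left (nhdsWithin_le_nhds (s := Ioi 0)))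
    rwa [h4, max_eq_right (minCos_lt_one he hμ).le] at this
  refine h5.congr' ?_
  filter_upwards [self_mem_nhdsWithin] with d hd
  rw [cosBound, if_neg (ne_of_gt hd)]

theorem tendsto_minCos (μ : ℝ) : Tendsto (fun e => minCos e μ) atTop (𝓝 1) := by
  have h1 : Tendsto (fun e => semiAxis e μ) atTop (𝓝 0) :=
    tendsto_const_nhds.div_atTop (tendsto_id.const_mul_atTop two_pos)
  have h2 : Tendsto (fun e => (1 + semiAxis e μ) / (1 + 2 * semiAxis e μ)) atTop
      (𝓝 ((1 + 0) / (1 + 2 * 0))) :=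
    (h1.const_add 1).div ((h1.const_mul 2).const_add 1) (by norm_num)
  have h3 := h2.sqrt
  norm_num at h3
  exact h3

end HyperbolicKepler

/-! ### The main theorem. -/

open HyperbolicKepler in
theorem mainTheorem9 :
    -- transversality constants depending on `E + h` and `μ`, resp. also on `|p₀ - p₁|`
    ∃ (C₀ : ℝ → ℝ → ℝ) (C : ℝ → ℝ → ℝ → ℝ),
      (∀ e μ : ℝ, 0 < e → 0 < μ → 0 < C₀ e μ ∧
        (∀ d ∈ Ico (0 : ℝ) 2, C₀ e μ ≤ C e μ d ∧ C e μ d < 1) ∧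
        Tendsto (fun d => C e μ d) (𝓝[>] 0) (𝓝 1)) ∧
      (∀ μ : ℝ, 0 < μ → Tendsto (fun e => C₀ e μ) atTop (𝓝 1)) ∧
      ∀ E h μ : ℝ, 0 < E + h → 0 < μ →
        ∃ (T : ℂ → ℂ → ℝ) (z : ℂ → ℂ → ℝ → ℂ),
          -- coinciding end points: the unique solution is an ejection-collision one
          (∀ p : ℂ, ‖p‖ = 1 →
            IsEjectionCollisionArc E h μ p p (T p p) (z p p) ∧
            ∀ (T' : ℝ) (z' : ℝ → ℂ),
              (IsEjectionCollisionArc E h μ p p T' z' ∨ IsClassicalArc E h μ p p T' z') →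
              T' = T p p ∧ EqOn z' (z p p) (Icc 0 T')) ∧
          -- distinct end points: the unique classical solution of index `1` or `-1`
          (∀ p₀ p₁ : ℂ, NonAntipodal p₀ p₁ → p₀ ≠ p₁ →
            IsClassicalArc E h μ p₀ p₁ (T p₀ p₁) (z p₀ p₁) ∧
            InjOn (z p₀ p₁) (Icc 0 (T p₀ p₁)) ∧
            (openCurveIndex (z p₀ p₁) 0 (T p₀ p₁) = 1 ∨
              openCurveIndex (z p₀ p₁) 0 (T p₀ p₁) = -1) ∧
            ∀ (T' : ℝ) (z' : ℝ → ℂ), IsClassicalArc E h μ p₀ p₁ T' z' →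
              (openCurveIndex z' 0 T' = 1 ∨ openCurveIndex z' 0 T' = -1) →
              T' = T p₀ p₁ ∧ EqOn z' (z p₀ p₁) (Icc 0 T')) ∧
          -- `C¹` dependence on the end points: of the duration,
          ContDiffOn ℝ 1 (fun ξ : ℝ × ℝ => T (circlePoint ξ.1) (circlePoint ξ.2))
            {ξ | NonAntipodal (circlePoint ξ.1) (circlePoint ξ.2)} ∧
          -- of the position at every fixed time (collision included),
          (∀ s : ℝ, ContDiffOn ℝ 1
            (fun ξ : ℝ × ℝ => z (circlePoint ξ.1) (circlePoint ξ.2) s)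
            {ξ | NonAntipodal (circlePoint ξ.1) (circlePoint ξ.2) ∧
              s ∈ Icc 0 (T (circlePoint ξ.1) (circlePoint ξ.2))}) ∧
          -- and, away from the collision, jointly with time
          ContDiffOn ℝ 1
            (fun x : ℝ × ℝ × ℝ => z (circlePoint x.2.1) (circlePoint x.2.2) x.1)
            {x | NonAntipodal (circlePoint x.2.1) (circlePoint x.2.2) ∧
              x.1 ∈ Icc 0 (T (circlePoint x.2.1) (circlePoint x.2.2)) ∧
              z (circlePoint x.2.1) (circlePoint x.2.2) x.1 ≠ 0} ∧
          -- convergence to the ejection-collision solution as `p₁ → p₀`, in durations and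
          -- uniformly in the rescaled time
          (∀ p₀ : ℂ, ‖p₀‖ = 1 →
            Tendsto (fun p₁ => T p₀ p₁) (𝓝[Metric.sphere 0 1] p₀) (𝓝 (T p₀ p₀)) ∧
            TendstoUniformlyOn (fun p₁ t => z p₀ p₁ (t * T p₀ p₁))
              (fun t => z p₀ p₀ (t * T p₀ p₀)) (𝓝[Metric.sphere 0 1] p₀) (Icc 0 1)) ∧
          -- transversality to the circle at both end points
          ∀ p₀ p₁ : ℂ, NonAntipodal p₀ p₁ →
            C (E + h) μ ‖p₀ - p₁‖ <
              -inner ℝ p₀ (derivWithin (z p₀ p₁) (Icc 0 (T p₀ p₁)) 0) /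
                ‖derivWithin (z p₀ p₁) (Icc 0 (T p₀ p₁)) 0‖ ∧
            C (E + h) μ ‖p₀ - p₁‖ <
              inner ℝ p₁ (derivWithin (z p₀ p₁) (Icc 0 (T p₀ p₁)) (T p₀ p₁)) /
                ‖derivWithin (z p₀ p₁) (Icc 0 (T p₀ p₁)) (T p₀ p₁)‖ := by
  refine ⟨minCos, cosBound, fun e μ he hμ => ⟨minCos_pos he hμ, fun d hd =>
    ⟨minCos_le_cosBound e μ d, cosBound_lt_one he hμ hd.1 hd.2⟩, tendsto_cosBound he hμ⟩,
    fun μ _ => tendsto_minCos μ, fun E h μ he hμ => ?_⟩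
  have ha := semiAxis_pos he hμ
  set a := semiAxis (E + h) μ with hadef
  -- The mean motion is fixed by `n a = √(2 (E + h))`; Kepler's third law `n² a³ = μ` then follows
  -- from `a = μ / (2 (E + h))`.
  set n := √(2 * (E + h)) / a with hndef
  have hn : 0 < n := by positivity
  have hna : n ^ 2 * a ^ 2 = 2 * (E + h) := by
    rw [hndef, div_pow, Real.sq_sqrt (by positivity)]; field_simp
  have hE : E + h = n ^ 2 * a ^ 2 / 2 := by rw [hna]; ring
  have hμa : μ = n ^ 2 * a ^ 3 := by
    rw [show n ^ 2 * a ^ 3 = n ^ 2 * a ^ 2 * a by ring, hna, hadef, semiAxis]; field_simp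
  refine ⟨fun p q => duration a n (offset p q),
    fun p q s => arcMid p q * frameOrbit a n (offset p q) s, ?_, ?_, ?_, ?_, ?_, ?_, ?_⟩
  · intro p hp
    have hec := isEjectionCollisionArc_orbit ha hn hE hμa hp
    refine ⟨hec, fun T' z' hz' => ?_⟩
    rcases hz' with hz' | hz'
    · exact ejectionCollisionArc_unique he hμ hp hec hz'
    · exact absurd hz' (not_isClassicalArc_self ha hn hE hμa)
  · intro p₀ p₁ hN hne
    have hδ := offset_sq_lt_one hN
    have h0 := offset_ne_zero hN hne
    refine ⟨⟨joinsInside_orbit ha hn hN, solvesInner_orbit ha hδ hE hμa (norm_arcMid hN)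
      fun s _ => frameOrbit_ne_zero ha hδ h0 s⟩, fun s _ t _ hst => ?_, index_orbit ha hn hN hne,
      fun T' z' hz' hi => classicalArc_unique ha hn hE hμa hN hz' hi⟩
    exact injective_frameOrbit ha hn hδ h0 (mul_left_cancel₀ (arcMid_ne_zero hN) hst)
  · intro ξ hξ
    exact (ContDiffAt.comp (g := duration a n) ξ
      (contDiffAt_duration ha (offset_sq_lt_one hξ))
      (contDiffAt_offset_circlePoint hξ)).contDiffWithinAt
  · rintro s ξ ⟨hξ, -⟩
    have h1 := ContDiffAt.comp (g := fun δ => frameOrbit a n δ s) ξ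
      (contDiffAt_frameOrbit_fixed_time (n := n) ha (offset_sq_lt_one hξ) s)
      (contDiffAt_offset_circlePoint hξ)
    exact ((contDiffAt_arcMid_circlePoint hξ).mul h1).contDiffWithinAt
  · rintro ⟨s, ξ⟩ ⟨hξ, -, hz⟩
    have h1 : ContDiffAt ℝ 1
        (fun x : ℝ × ℝ × ℝ => offset (circlePoint x.2.1) (circlePoint x.2.2)) (s, ξ) :=
      ContDiffAt.comp (g := fun ξ : ℝ × ℝ => offset (circlePoint ξ.1) (circlePoint ξ.2)) (s, ξ)
        (contDiffAt_offset_circlePoint hξ) contDiffAt_snd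
    have h2 : ContDiffAt ℝ 1
        (fun x : ℝ × ℝ × ℝ => arcMid (circlePoint x.2.1) (circlePoint x.2.2)) (s, ξ) :=
      ContDiffAt.comp (g := fun ξ : ℝ × ℝ => arcMid (circlePoint ξ.1) (circlePoint ξ.2)) (s, ξ)
        (contDiffAt_arcMid_circlePoint hξ) contDiffAt_snd
    exact (h2.mul (contDiffAt_frameOrbit ha h1 contDiffAt_fst (offset_sq_lt_one hξ)
      (right_ne_zero_of_mul hz))).contDiffWithinAt
  · exact fun p₀ hp => tendsto_orbit ha hp
  · intro p₀ p₁ hN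
    have hδ := offset_sq_lt_one hN
    have hm := norm_arcMid hN
    have hm0 := arcMid_ne_zero hN
    have hT := duration_pos (n := n) ha hn hδ
    have e0 := frameOrbit_zero (n := n) ha hδ
    have e1 := frameOrbit_duration (n := n) ha hn hδ
    have hδ' : (-offset p₀ p₁) ^ 2 < 1 := by rwa [neg_sq]
    have n0 : frameOrbit a n (offset p₀ p₁) 0 ≠ 0 := by rw [e0]; exact frameEnd_ne_zero hδ'
    have n1 : frameOrbit a n (offset p₀ p₁) (duration a n (offset p₀ p₁)) ≠ 0 := by
      rw [e1]; exact frameEnd_ne_zero hδ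
    have d : ∀ s ∈ Set.Icc 0 (duration a n (offset p₀ p₁)), frameOrbit a n (offset p₀ p₁) s ≠ 0 →
        derivWithin (fun s => arcMid p₀ p₁ * frameOrbit a n (offset p₀ p₁) s)
          (Set.Icc 0 (duration a n (offset p₀ p₁))) s =
        arcMid p₀ p₁ * frameVelocity a n (offset p₀ p₁) s := fun s hs h0 =>
      ((hasDerivAt_frameOrbit ha hδ h0).const_mul _).hasDerivWithinAt.derivWithin
        (uniqueDiffOn_Icc hT s hs)
    -- Multiplication by a unit complex number is a rotation, so the angles may be computed in the
    -- frame of the axis.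
    have hin : ∀ x y : ℂ, inner ℝ (arcMid p₀ p₁ * x) (arcMid p₀ p₁ * y) = inner ℝ x y := by
      intro x y
      have h2 : arcMid p₀ p₁ * (starRingEnd ℂ) (arcMid p₀ p₁) = 1 := by
        rw [Complex.mul_conj, Complex.normSq_eq_norm_sq, hm]; simp
      rw [real_inner_eq_re, real_inner_eq_re, map_mul]
      congr 1
      linear_combination ((starRingEnd ℂ) x * y) * h2
    obtain ⟨i1, i0⟩ := inner_frameEnd_frameVelocity ha hn hδ
    have hb := cosBound_lt he hμ (norm_nonneg (p₀ - p₁)) hN.2.2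
    rw [← axial_offset_eq_norm_sub hN, ← hadef] at hb
    refine ⟨?_, ?_⟩
    · rw [d 0 ⟨le_rfl, hT.le⟩ n0, norm_mul, hm, one_mul]
      nth_rewrite 2 [← arcMid_mul_frameEnd_neg hN]
      rw [hin, transversality_frame ha hn (norm_frameEnd hδ')
        (by rw [norm_frameVelocity_sq ha hδ n0, e0]) i0]
      exact hb
    · rw [d _ ⟨hT.le, le_rfl⟩ n1, norm_mul, hm, one_mul]
      nth_rewrite 2 [← arcMid_mul_frameEnd hN]
      rw [hin, transversality_frame ha hn (norm_frameEnd hδ)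
        (by rw [norm_frameVelocity_sq ha hδ n1, e1]) i1]
      exact hb
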